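/- Let $M$ be a smooth manifold and $(G,H,t,m)$ a Lie crossed module: $G,H$ are Lie groups with Lie algebras $\mathfrak g,\mathfrak h$, $t:H\to G$ is a smooth homomorphism, $m$ is a smooth action of $G$ on $H$ by automorphisms, $t(m(a)(A))=a\,t(A)\,a^{-1}$ and $m(t(A))(B)=ABA^{-1}$. Write $\dot t:\mathfrak h\to\mathfrak g$ for the differential of $t$ at $1$, $\dot m(a):\mathfrak h\to\mathfrak h$ for the differential of $m(a)$ at $1$, and $\widehat m:\mathfrak g\times\mathfrak h\to\mathfrak h$ for the derived action. Let $\theta\in\Omega^1(M,\mathfrak g)$, $\Upsilon\in\Omega^2(M,\mathfrak h)$ satisfy $d\theta+\tfrac12[\theta,\theta]-\dot t(\Upsilon)=0$. A curve $\gamma:p_0\to p_1$ is a smooth map $\gamma:\mathbb R\to M$ with $\gamma(x)=p_0$ for $x<\epsilon$ and $\gamma(x)=p_1$ for $x>1-\epsilon$, for some $0<\epsilon<1/2$. A surface $\Sigma:\gamma_0\Rightarrow\gamma_1$ between curves $\gamma_0,\gamma_1:p_0\to p_1$ is a smooth map $\Sigma:\mathbb R^2\to M$ such that, for some $0<\epsilon<1/2$,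 $\Sigma(x,y)$ equals $p_0$ for $x<\epsilon$, $p_1$ for $x>1-\epsilon$, $\gamma_0(x)$ for $y<\epsilon$ and $\gamma_1(x)$ for $y>1-\epsilon$. Given a surface $\Sigma$, put $a=\Sigma^*\theta$, $B=\Sigma^*\Upsilon$. Let $f(x,x_0;y)$, $g(x;y,y_0)\in G$, $W(x,x_0;y,y_0)\in H$ be the solutions, smooth in $(x,y)$ for all fixed $x_0,y_0$, of $$\partial_xf\,f^{-1}=-a_x(x,y),\quad f(x_0,x_0;y)=1;\qquad \partial_yg\,g^{-1}=-a_y(x,y),\quad g(x;y_0,y_0)=1;$$ $$\partial_x\big(\partial_yW\,W^{-1}\big)=-\dot m\big(g(x_0;y,y_0)^{-1}f(x,x_0;y)^{-1}\big)(B_{xy}(x,y)),\quad W(x_0,x_0;y,y_0)=W(x,x_0;y_0,y_0)=1 .$$ The 1-parallel transports along the source and the target curve of $\Sigma$ are $f(1,0;0)$ and $f(1,0;1)$; the 2-parallel transport along $\Sigma$ is $F(\Sigma)=W(0,1;1,0)$. For a single curve $\gamma$, $F(\gamma)$ is the 1-parallel transport $f(1,0;0)$ obtained from the unit surface $I_\gamma(x,y)=\gamma(x)$.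 Let $p_0,p_1\in M$ and, for $z\in\mathbb R$, let $\gamma_{0z},\gamma_{1z}:p_0\to p_1$ be curves and $\Sigma_z:\gamma_{0z}\Rightarrow\gamma_{1z}$ surfaces, and put $K(x,y,z)=\Sigma_z(x,y)$. Call $K$ a homotopy of $\Sigma_0,\Sigma_1$ if $K:\mathbb R^3\to M$ is smooth; for some $\epsilon>0$, $K(x,y,z)$ equals $p_0$ for $x<\epsilon$, $p_1$ for $x>1-\epsilon$, $K(x,0,z)$ for $y<\epsilon$, $K(x,1,z)$ for $y>1-\epsilon$, $\Sigma_0(x,y)$ for $z<\epsilon$ and $\Sigma_1(x,y)$ for $z>1-\epsilon$; and $\operatorname{rank}dK(x,0,z)\le1$, $\operatorname{rank}dK(x,1,z)\le1$ for all $x,z$. Call it thin if moreover $\operatorname{rank}dK\le2$ everywhere. Suppose that either (a) $K$ is a thin homotopy of $\Sigma_0,\Sigma_1$, or (b) $K$ is a homotopy of $\Sigma_0,\Sigma_1$ and $(\theta,\Upsilon)$ is flat, i.e. $d\Upsilon+[\theta,\Upsilon]=0$, the bracket being formed with $\widehat m$. Then for every $z$ the above differential problems for $\Sigma_z$ have exactly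 one solution for all $x_0,y_0$; the transports along the source and the target curve of $\Sigma_z$ equal $F(\gamma_{0z})$ and $F(\gamma_{1z})$; and for all $z\in\mathbb R$ $$F(\gamma_{0z})=F(\gamma_{00}),\qquad F(\gamma_{1z})=F(\gamma_{10}),\qquad F(\Sigma_z)=F(\Sigma_0).$$ In particular $F(\gamma_{01})=F(\gamma_{00})$, $F(\gamma_{11})=F(\gamma_{10})$ and $F(\Sigma_1)=F(\Sigma_0)$. -/

import Mathlib

open scoped Manifold ContDiff

noncomputable section

namespace HigherTransport

/-! ### Vector valued differential forms on a manifold -/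

section Forms

variable {EM : Type*} [NormedAddCommGroup EM] [NormedSpace ℝ EM]
  {M : Type*} [TopologicalSpace M] [ChartedSpace EM M]
  {V : Type*} [NormedAddCommGroup V] [NormedSpace ℝ V]
  {F : Type*} [NormedAddCommGroup F] [NormedSpace ℝ F]

/-- Pull-back of a field of alternating `k`-linear maps on `M` along a map `Φ` from a normed
space `F` to `M`. -/
def pullback {k : ℕ} (η : ∀ p : M, TangentSpace 𝓘(ℝ, EM) p [⋀^Fin k]→L[ℝ] V)
    (Φ : F → M) (q : F) : F [⋀^Fin k]→L[ℝ] V :=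
  (η (Φ q)).compContinuousLinearMap (mfderiv 𝓘(ℝ, F) 𝓘(ℝ, EM) Φ q)

/-- The expression of a field of alternating maps in the preferred chart at `p`
(meaningful on the target of the chart). -/
def localRep {k : ℕ} (η : ∀ p : M, TangentSpace 𝓘(ℝ, EM) p [⋀^Fin k]→L[ℝ] V)
    (p : M) : EM → EM [⋀^Fin k]→L[ℝ] V :=
  pullback η (chartAt EM p).symm

variable (EM M V) in
/-- Smooth `V`-valued differential `k`-forms on `M`. -/
structure DiffForm (k : ℕ) where
  /-- the underlying field of alternating maps -/
  toFun : ∀ p : M, TangentSpace 𝓘(ℝ, EM) p [⋀^Fin k]→L[ℝ] V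
  smooth : ∀ p : M, ContDiffOn ℝ ∞ (localRep toFun p) (chartAt EM p).target

/-- The exterior derivative, computed in the preferred chart at each point. -/
def DiffForm.d {k : ℕ} (η : DiffForm EM M V k) (p : M) :
    TangentSpace 𝓘(ℝ, EM) p [⋀^Fin (k + 1)]→L[ℝ] V :=
  (extDeriv (localRep η.toFun p) (chartAt EM p p)).compContinuousLinearMap
    (mfderiv 𝓘(ℝ, EM) 𝓘(ℝ, EM) (chartAt EM p) p)

end Forms

/-! ### Lie groups and Lie crossed modules

The Lie algebra of a Lie group `G` modelled on `EG` is the tangent space of `G` at `1`, whose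
underlying vector space in Mathlib is `EG` itself. -/

section Groups

variable {EG : Type*} [NormedAddCommGroup EG] [NormedSpace ℝ EG]
  {G : Type*} [TopologicalSpace G] [ChartedSpace EG G] [Group G]
  {EH : Type*} [NormedAddCommGroup EH] [NormedSpace ℝ EH]
  {H : Type*} [TopologicalSpace H] [ChartedSpace EH H] [Group H]

variable (G) in
/-- The Lie bracket of the Lie algebra of `G`. -/
def lieBr (x y : EG) : EG :=
  Bracket.bracket (L := GroupLieAlgebra 𝓘(ℝ, EG) G) (M := GroupLieAlgebra 𝓘(ℝ, EG) G) x y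

/-- The right logarithmic derivative `u'(x) u(x)⁻¹` of a curve `u` in `G`, an element of the
Lie algebra. -/
def logDerivR (u : ℝ → G) (x : ℝ) : EG :=
  mfderiv 𝓘(ℝ, ℝ) 𝓘(ℝ, EG) (fun s => u s * (u x)⁻¹) x (1 : ℝ)

variable (EG G EH H) in
/-- A Lie crossed module: a smooth homomorphism `t : H → G` and a smooth action `m` of `G` on `H`
by automorphisms, with `t` equivariant and satisfying the Peiffer identity. -/
structure LieCrossedModule where
  /-- the target map -/
  t : H →* G
  /-- the action -/
  m : G →* MulAut H
  smooth_t : ContMDiff 𝓘(ℝ, EH) 𝓘(ℝ, EG) ∞ t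
  smooth_m : ContMDiff (𝓘(ℝ, EG).prod 𝓘(ℝ, EH)) 𝓘(ℝ, EH) ∞ (fun q : G × H => m q.1 q.2)
  equivariant : ∀ (a : G) (A : H), t (m a A) = a * t A * a⁻¹
  peiffer : ∀ A B : H, m (t A) B = A * B * A⁻¹

namespace LieCrossedModule

/-- `ṫ : 𝔥 → 𝔤`, the differential of `t` at `1`. -/
def tDot (X : LieCrossedModule EG G EH H) (x : EH) : EG :=
  mfderiv 𝓘(ℝ, EH) 𝓘(ℝ, EG) X.t 1 x

/-- `ṁ(a) : 𝔥 → 𝔥`, the differential of `m(a)` at `1`. -/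
def mDot (X : LieCrossedModule EG G EH H) (a : G) (x : EH) : EH :=
  mfderiv 𝓘(ℝ, EH) 𝓘(ℝ, EH) (X.m a) 1 x

/-- The derived action of `𝔤` on `𝔥`: the differential of `a ↦ ṁ(a)(y)` at `1` along `x`. -/
def mHat (X : LieCrossedModule EG G EH H) (x : EG) (y : EH) : EH :=
  mfderiv 𝓘(ℝ, EG) 𝓘(ℝ, EH) (fun a : G => X.mDot a y) 1 x

end LieCrossedModule

/-! ### Connection doublets -/

section Connections

variable {EM : Type*} [NormedAddCommGroup EM] [NormedSpace ℝ EM]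
  {M : Type*} [TopologicalSpace M] [ChartedSpace EM M]

variable (EM M) in
/-- A `(G, H)`-connection doublet on `M`: a `𝔤`-valued 1-form `θ` and an `𝔥`-valued 2-form `Υ`
with `dθ + ½[θ, θ] - ṫ(Υ) = 0`. (On vectors, `½[θ, θ](v, w) = [θ(v), θ(w)]`.) -/
structure ConnDoublet (X : LieCrossedModule EG G EH H) where
  /-- the 1-form -/
  θ : DiffForm EM M EG 1
  /-- the 2-form -/
  Υ : DiffForm EM M EH 2
  fakeFlat : ∀ (p : M) (v w : TangentSpace 𝓘(ℝ, EM) p),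
    θ.d p ![v, w] + lieBr G (θ.toFun p ![v]) (θ.toFun p ![w]) - X.tDot (Υ.toFun p ![v, w]) = 0

/-- Flatness `dΥ + [θ, Υ] = 0`, where `[θ, Υ]` is the wedge product formed with the derived
action of `𝔤` on `𝔥`. -/
def ConnDoublet.IsFlat {X : LieCrossedModule EG G EH H} (D : ConnDoublet EM M X) : Prop :=
  ∀ (p : M) (u v w : TangentSpace 𝓘(ℝ, EM) p),
    D.Υ.d p ![u, v, w]
      + (X.mHat (D.θ.toFun p ![u]) (D.Υ.toFun p ![v, w])
        - X.mHat (D.θ.toFun p ![v]) (D.Υ.toFun p ![u, w])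
        + X.mHat (D.θ.toFun p ![w]) (D.Υ.toFun p ![u, v])) = 0

end Connections

/-! ### The cocycle of a pair of forms `(a, B)` on the plane -/

/-- `u(x, y)` is the smooth solution of `∂ₓu u⁻¹ = -aₓ`, `u(x₀, y) = 1`. -/
structure IsSolF (a : ℝ × ℝ → (ℝ × ℝ) [⋀^Fin 1]→L[ℝ] EG) (x₀ : ℝ) (u : ℝ × ℝ → G) : Prop where
  smooth : ContMDiff 𝓘(ℝ, ℝ × ℝ) 𝓘(ℝ, EG) ∞ u
  eqn : ∀ x y : ℝ, logDerivR (fun s => u (s, y)) x = -(a (x, y) ![((1 : ℝ), (0 : ℝ))])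
  init : ∀ y : ℝ, u (x₀, y) = 1

/-- `v(x, y)` is the smooth solution of `∂ᵧv v⁻¹ = -aᵧ`, `v(x, y₀) = 1`. -/
structure IsSolG (a : ℝ × ℝ → (ℝ × ℝ) [⋀^Fin 1]→L[ℝ] EG) (y₀ : ℝ) (v : ℝ × ℝ → G) : Prop where
  smooth : ContMDiff 𝓘(ℝ, ℝ × ℝ) 𝓘(ℝ, EG) ∞ v
  eqn : ∀ x y : ℝ, logDerivR (fun s => v (x, s)) y = -(a (x, y) ![((0 : ℝ), (1 : ℝ))])
  init : ∀ x : ℝ, v (x, y₀) = 1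

/-- `f(x, x₀; y)`. -/
def cocycleF (a : ℝ × ℝ → (ℝ × ℝ) [⋀^Fin 1]→L[ℝ] EG) (x x₀ y : ℝ) : G :=
  Classical.epsilon (fun u : ℝ × ℝ → G => IsSolF a x₀ u) (x, y)

/-- `g(x; y, y₀)`. -/
def cocycleG (a : ℝ × ℝ → (ℝ × ℝ) [⋀^Fin 1]→L[ℝ] EG) (x y y₀ : ℝ) : G :=
  Classical.epsilon (fun v : ℝ × ℝ → G => IsSolG a y₀ v) (x, y)

/-- `E(x, y)` is the smooth solution of
`∂ₓ(∂ᵧE E⁻¹) = -ṁ(g(x₀; y, y₀)⁻¹ f(x, x₀; y)⁻¹)(Bₓᵧ)`, `E(x₀, y) = E(x, y₀) = 1`. -/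
structure IsSolW (X : LieCrossedModule EG G EH H) (a : ℝ × ℝ → (ℝ × ℝ) [⋀^Fin 1]→L[ℝ] EG)
    (B : ℝ × ℝ → (ℝ × ℝ) [⋀^Fin 2]→L[ℝ] EH) (x₀ y₀ : ℝ) (E : ℝ × ℝ → H) : Prop where
  smooth : ContMDiff 𝓘(ℝ, ℝ × ℝ) 𝓘(ℝ, EH) ∞ E
  eqn : ∀ x y : ℝ, deriv (fun s => (logDerivR (fun r => E (s, r)) y : EH)) x =
    -X.mDot ((cocycleG a x₀ y y₀)⁻¹ * (cocycleF a x x₀ y)⁻¹)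
      (B (x, y) ![((1 : ℝ), (0 : ℝ)), ((0 : ℝ), (1 : ℝ))])
  init_x : ∀ y : ℝ, E (x₀, y) = 1
  init_y : ∀ x : ℝ, E (x, y₀) = 1

/-- `W(x, x₀; y, y₀)`. -/
def cocycleW (X : LieCrossedModule EG G EH H) (a : ℝ × ℝ → (ℝ × ℝ) [⋀^Fin 1]→L[ℝ] EG)
    (B : ℝ × ℝ → (ℝ × ℝ) [⋀^Fin 2]→L[ℝ] EH) (x x₀ y y₀ : ℝ) : H :=
  Classical.epsilon (fun E : ℝ × ℝ → H => IsSolW X a B x₀ y₀ E) (x, y)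

/-- The differential problems defining `f`, `g` and `W` each have exactly one solution, for all
base points. -/
def HasCocycle (X : LieCrossedModule EG G EH H) (a : ℝ × ℝ → (ℝ × ℝ) [⋀^Fin 1]→L[ℝ] EG)
    (B : ℝ × ℝ → (ℝ × ℝ) [⋀^Fin 2]→L[ℝ] EH) : Prop :=
  (∀ x₀ : ℝ, ∃! u : ℝ × ℝ → G, IsSolF a x₀ u) ∧
  (∀ y₀ : ℝ, ∃! v : ℝ × ℝ → G, IsSolG a y₀ v) ∧
  (∀ x₀ y₀ : ℝ, ∃! E : ℝ × ℝ → H, IsSolW X a B x₀ y₀ E)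

/-! ### Parallel transport -/

section Transport

variable {EM : Type*} [NormedAddCommGroup EM] [NormedSpace ℝ EM]
  {M : Type*} [TopologicalSpace M] [ChartedSpace EM M]
  {X : LieCrossedModule EG G EH H}

/-- 1-parallel transport along the source curve of a surface `S`: `f(1, 0)` at `y = 0`. -/
def ConnDoublet.transportSource (D : ConnDoublet EM M X) (S : ℝ × ℝ → M) : G :=
  cocycleF (pullback D.θ.toFun S) 1 0 0

/-- 1-parallel transport along the target curve of a surface `S`: `f(1, 0)` at `y = 1`. -/
def ConnDoublet.transportTarget (D : ConnDoublet EM M X) (S : ℝ × ℝ → M) : G :=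
  cocycleF (pullback D.θ.toFun S) 1 0 1

/-- 2-parallel transport along a surface `S`: `W(0, 1; 1, 0)`. -/
def ConnDoublet.transportSurface (D : ConnDoublet EM M X) (S : ℝ × ℝ → M) : H :=
  cocycleW X (pullback D.θ.toFun S) (pullback D.Υ.toFun S) 0 1 1 0

/-- The unit surface of a curve. -/
def unitSurface (γ : ℝ → M) : ℝ × ℝ → M := fun q => γ q.1

/-- 1-parallel transport along a curve `γ`, defined through its unit surface. -/
def ConnDoublet.transportCurve (D : ConnDoublet EM M X) (γ : ℝ → M) : G :=
  D.transportSource (unitSurface γ)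

end Transport

end Groups

/-! ### Curves, surfaces and homotopies -/

section Paths

variable (EM : Type*) [NormedAddCommGroup EM] [NormedSpace ℝ EM]
  {M : Type*} [TopologicalSpace M] [ChartedSpace EM M]

/-- `γ : p₀ → p₁` is a smooth curve with sitting instants. -/
def IsCurve (p₀ p₁ : M) (γ : ℝ → M) : Prop :=
  ContMDiff 𝓘(ℝ, ℝ) 𝓘(ℝ, EM) ∞ γ ∧
  ∃ ε : ℝ, 0 < ε ∧ ε < 1 / 2 ∧ (∀ x, x < ε → γ x = p₀) ∧ (∀ x, 1 - ε < x → γ x = p₁)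

/-- `S : γ₀ ⇒ γ₁` is a smooth surface with sitting instants between the curves
`γ₀, γ₁ : p₀ → p₁`. -/
def IsSurface (p₀ p₁ : M) (γ₀ γ₁ : ℝ → M) (S : ℝ × ℝ → M) : Prop :=
  ContMDiff 𝓘(ℝ, ℝ × ℝ) 𝓘(ℝ, EM) ∞ S ∧
  ∃ ε : ℝ, 0 < ε ∧ ε < 1 / 2 ∧
    (∀ x y, x < ε → S (x, y) = p₀) ∧ (∀ x y, 1 - ε < x → S (x, y) = p₁) ∧
    (∀ x y, y < ε → S (x, y) = γ₀ x) ∧ (∀ x y, 1 - ε < y → S (x, y) = γ₁ x)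

/-- The rank of the differential of a map `K : ℝ³ → M` at a point. -/
def rankAt (K : ℝ × ℝ × ℝ → M) (q : ℝ × ℝ × ℝ) : Cardinal :=
  LinearMap.rank
    (mfderiv 𝓘(ℝ, ℝ × ℝ × ℝ) 𝓘(ℝ, EM) K q :
      TangentSpace 𝓘(ℝ, ℝ × ℝ × ℝ) q →ₗ[ℝ] TangentSpace 𝓘(ℝ, EM) (K q))

/-- `K : ℝ³ → M` is a homotopy of the surfaces `S₀`, `S₁`, whose bounding curves join `p₀` to
`p₁`; the homotopies of the bounding curves are required to be thin. -/
def IsHomotopy (p₀ p₁ : M) (S₀ S₁ : ℝ × ℝ → M) (K : ℝ × ℝ × ℝ → M) : Prop :=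
  ContMDiff 𝓘(ℝ, ℝ × ℝ × ℝ) 𝓘(ℝ, EM) ∞ K ∧
  (∃ ε : ℝ, 0 < ε ∧
    (∀ x y z, x < ε → K (x, y, z) = p₀) ∧ (∀ x y z, 1 - ε < x → K (x, y, z) = p₁) ∧
    (∀ x y z, y < ε → K (x, y, z) = K (x, 0, z)) ∧
    (∀ x y z, 1 - ε < y → K (x, y, z) = K (x, 1, z)) ∧
    (∀ x y z, z < ε → K (x, y, z) = S₀ (x, y)) ∧
    (∀ x y z, 1 - ε < z → K (x, y, z) = S₁ (x, y))) ∧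
  (∀ x z, rankAt EM K (x, 0, z) ≤ 1) ∧ (∀ x z, rankAt EM K (x, 1, z) ≤ 1)

/-- A homotopy of surfaces is thin if its differential has rank at most 2 everywhere. -/
def IsThinHomotopy (p₀ p₁ : M) (S₀ S₁ : ℝ × ℝ → M) (K : ℝ × ℝ × ℝ → M) : Prop :=
  IsHomotopy EM p₀ p₁ S₀ S₁ K ∧ ∀ q, rankAt EM K q ≤ 2

end Paths

end HigherTransport

end

open scoped Manifold ContDiff
open Set Filter Topology

noncomputable section

namespace HigherTransport

set_option linter.unusedSectionVars false

/-! Pull the doublet back along `K` to ℝ³, with components a₁, a₂, a₃ and B₁₂, B₁₃, B₂₃. Since `K`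
is locally constant near x = 0 and x = 1, all components vanish on these faces; rank at most 1 on
the faces y = 0 and y = 1 gives B₁₃ = 0 there (`IsHomotopy.isFramed`). The curvature 3-form vanishes
on the cube, in case (b) by hypothesis, in case (a) because dΥ and [θ, Υ] are alternating and the
three vectors dK(eᵢ) are dependent. From there on the two cases are the same.

Let a prime denote the gauge transform by the transport along x, which kills a₁. By the
Maurer-Cartan equation, fake flatness becomes ∂ₓa'ᵢ = ṫ(B'₁ᵢ) for i = 2, 3 (`fderiv_gauge`). For the
1-transport f based at x = 0, a'₃ is therefore constant in x on the faces y = 0 and y = 1. It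
vanishes at x = 0, hence at x = 1, where it is ∂_z f f⁻¹ up to the adjoint action. So f(1, y, z)
does not depend on z (`IsFramed.transport_eq`).

For the 2-transport take the base x = 1, and let w₂, w₃ be the x-primitives of -B'₁₂, -B'₁₃
vanishing at x = 1. Then a'ᵢ = -ṫ(wᵢ), and the Peiffer identity turns the action of a'ᵢ on 𝔥 into
-[wᵢ, ·]. Flatness now says that ∂_y w₃ - ∂_z w₂ - [w₂, w₃] + B'₂₃ is constant in x. It is zero at x
= 1, and B'₂₃ = 0 at x = 0, so (w₂, w₃) is flat on the face x = 0 (`curvature_left`). The cocycle W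
with base (1, 0) solves ∂_y W W⁻¹ = w₂. By Maurer-Cartan again, ∂_z W W⁻¹ - w₃ solves a homogeneous
linear equation in y on that face; it is zero at y = 0, hence at y = 1, where w₃ = 0 as well. So
W(0, 1, z) is constant in z (`surface_transport_eq`).

The analytic input is existence, uniqueness and smooth parameter dependence for u' u⁻¹ = A in a Lie
group (`exists_global_solution`). Locally this is the implicit function theorem for the Picard
integral equation on continuous curves, transported by the chart at 1; local solutions are then
glued by right translations. -/

/-! ### Composition operators on spaces of continuous maps -/

section Nemytskii

universe u

variable {K : Type*} [TopologicalSpace K] [CompactSpace K]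

/-- Pointwise evaluation of a continuous family of linear maps at a continuous family of
vectors. -/
def pointwiseEval (K : Type*) [TopologicalSpace K] [CompactSpace K]
    (X Y : Type*) [NormedAddCommGroup X] [NormedSpace ℝ X] [NormedAddCommGroup Y]
    [NormedSpace ℝ Y] : C(K, X →L[ℝ] Y) →L[ℝ] C(K, X) →L[ℝ] C(K, Y) :=
  LinearMap.mkContinuous₂
    (LinearMap.mk₂ ℝ
      (fun (A : C(K, X →L[ℝ] Y)) (h : C(K, X)) =>
        (⟨fun s => A s (h s), A.continuous.clm_apply h.continuous⟩ : C(K, Y)))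
      (fun A B h => by ext s; simp) (fun c A h => by ext s; simp)
      (fun A h k => by ext s; simp) (fun c A h => by ext s; simp)) 1 (by
    intro A h
    rw [ContinuousMap.norm_le _ (by positivity)]
    intro s
    rw [one_mul]
    exact ((A s).le_opNorm (h s)).trans
      (by gcongr; exacts [A.norm_coe_le_norm s, h.norm_coe_le_norm s]))

/-- The mean value inequality is applied pointwise in `s`; compactness of `K` makes the resulting
estimate uniform. -/
theorem hasFDerivAt_postcomp {X Y : Type*} [NormedAddCommGroup X] [NormedSpace ℝ X]
    [NormedAddCommGroup Y] [NormedSpace ℝ Y] (F : C(X, Y)) (F' : C(X, X →L[ℝ] Y))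
    (hF : ∀ x, HasFDerivAt F (F' x) x) (γ : C(K, X)) :
    HasFDerivAt (fun γ : C(K, X) => F.comp γ) (pointwiseEval K X Y (F'.comp γ)) γ := by
  rw [hasFDerivAt_iff_isLittleO, Asymptotics.isLittleO_iff]
  intro ε hε
  have hc : ContinuousAt (fun γ : C(K, X) => F'.comp γ) γ := F'.continuous_postcomp.continuousAt
  obtain ⟨δ, hδ, hb⟩ := (Metric.continuousAt_iff (f := fun γ : C(K, X) => F'.comp γ)).1 hc ε hε
  filter_upwards [Metric.ball_mem_nhds γ hδ] with η hη
  rw [ContinuousMap.norm_le _ (by positivity)]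
  intro s
  -- Shifting the whole curve `γ` by the constant `x - γ s` moves it by ‖x - γ s‖ in the sup norm.
  -- Continuity of postcomposition with `F'` at `γ` thus yields one `δ` that serves every `s`.
  have key : ∀ x ∈ Metric.ball (γ s) δ, ‖F' x - F' (γ s)‖ ≤ ε := by
    intro x hx
    have h1 : dist (γ + ContinuousMap.const K (x - γ s)) γ < δ := by
      rw [dist_eq_norm, add_sub_cancel_left]
      refine lt_of_le_of_lt ?_ (mem_ball_iff_norm.1 hx)
      rw [ContinuousMap.norm_le _ (norm_nonneg _)]
      intro _; simp
    have h2 := (ContinuousMap.norm_coe_le_norm (F'.comp (γ + ContinuousMap.const K (x - γ s)) -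
      F'.comp γ) s)
    rw [← dist_eq_norm] at h2
    have h3 := h2.trans (hb h1).le
    simpa using h3
  have hηs : η s ∈ Metric.ball (γ s) δ :=
    lt_of_le_of_lt (ContinuousMap.dist_apply_le_dist s) hη
  have := Convex.norm_image_sub_le_of_norm_hasFDerivWithin_le'
    (fun x _ => (hF x).hasFDerivWithinAt) key (convex_ball (γ s) δ) (Metric.mem_ball_self hδ) hηs
  refine this.trans (mul_le_mul_of_nonneg_left ?_ hε.le)
  exact (η - γ).norm_coe_le_norm s

/-- The derivative of postcomposition with `F` is postcomposition with `F'` followed by the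
continuous linear `pointwiseEval`, so induction applies with `Y` replaced by `X →L[ℝ] Y`. A common
universe for `X` and `Y` keeps that space within reach of the induction hypothesis. -/
theorem contDiff_postcomp_nat {X : Type u} [NormedAddCommGroup X] [NormedSpace ℝ X] (n : ℕ) :
    ∀ {Y : Type u} [NormedAddCommGroup Y] [NormedSpace ℝ Y] (F : C(X, Y)),
      ContDiff ℝ ∞ F → ContDiff ℝ n (fun γ : C(K, X) => F.comp γ) := by
  induction n with
  | zero => intro Y _ _ F _; exact contDiff_zero.2 F.continuous_postcomp
  | succ n ih =>
    intro Y _ _ F hF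
    have hF' : ContDiff ℝ ∞ (fderiv ℝ F) := hF.fderiv_right (by simp)
    rw [Nat.cast_add, Nat.cast_one, contDiff_succ_iff_hasFDerivAt]
    refine ⟨fun γ => pointwiseEval K X Y
      ((⟨fderiv ℝ F, hF'.continuous⟩ : C(X, X →L[ℝ] Y)).comp γ), ?_, ?_⟩
    · exact (pointwiseEval K X Y).contDiff.comp (ih ⟨fderiv ℝ F, hF'.continuous⟩ hF')
    · exact hasFDerivAt_postcomp F _
        (fun x => (hF.differentiable (by simp) x).hasFDerivAt)

theorem contDiff_postcomp {X Y : Type u} [NormedAddCommGroup X] [NormedSpace ℝ X]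
    [NormedAddCommGroup Y] [NormedSpace ℝ Y] (F : C(X, Y))
    (hF : ContDiff ℝ ∞ F) : ContDiff ℝ ∞ (fun γ : C(K, X) => F.comp γ) :=
  contDiff_infty.2 fun n => contDiff_postcomp_nat n F hF

end Nemytskii

/-! ### Primitives depending smoothly on parameters -/

section Primitive

open MeasureTheory intervalIntegral

/-- The time interval `[-1, 1]`. -/
abbrev TimeInterval : Type := Icc (-1 : ℝ) 1

/-- The retraction of `ℝ` onto `[-1, 1]`. -/
def timeProj (r : ℝ) : TimeInterval := projIcc (-1 : ℝ) 1 (by norm_num) r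

theorem continuous_timeProj : Continuous timeProj := continuous_projIcc (h := by norm_num)

theorem timeProj_coe {r : ℝ} (hr : r ∈ Icc (-1 : ℝ) 1) : (timeProj r : ℝ) = r := by
  simp [timeProj, projIcc_of_mem _ hr]

/-- The primitive, vanishing at `0`, of a continuous function on `[-1, 1]`. -/
def volterra (E : Type*) [NormedAddCommGroup E] [NormedSpace ℝ E] :
    C(TimeInterval, E) →L[ℝ] C(TimeInterval, E) :=
  LinearMap.mkContinuous
    { toFun := fun γ => ⟨fun s => ∫ r in (0 : ℝ)..s, γ (timeProj r),
        (continuous_primitive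
          (fun a b => (γ.continuous.comp continuous_timeProj).intervalIntegrable a b) 0).comp
          continuous_subtype_val⟩
      map_add' := fun γ η => by
        ext s
        exact integral_add ((γ.continuous.comp continuous_timeProj).intervalIntegrable _ _)
          ((η.continuous.comp continuous_timeProj).intervalIntegrable _ _)
      map_smul' := fun c γ => by
        ext s
        exact integral_smul c _ } 1 (by
    intro γ
    rw [ContinuousMap.norm_le _ (by positivity)]
    intro s
    have h := norm_integral_le_of_norm_le_const (a := 0) (b := (s : ℝ)) (C := ‖γ‖)
      (f := fun r => γ (timeProj r)) (fun r _ => γ.norm_coe_le_norm _)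
    refine h.trans ?_
    rw [one_mul, sub_zero]
    exact mul_le_of_le_one_right (norm_nonneg _) (abs_le.2 s.2))

theorem volterra_apply {E : Type*} [NormedAddCommGroup E] [NormedSpace ℝ E]
    (γ : C(TimeInterval, E)) (s : TimeInterval) :
    volterra E γ s = ∫ r in (0 : ℝ)..s, γ (timeProj r) := rfl

/-- Constant maps, as a continuous linear map. -/
def constCLM (E : Type*) [NormedAddCommGroup E] [NormedSpace ℝ E] :
    E →L[ℝ] C(TimeInterval, E) where
  toFun := ContinuousMap.const _
  map_add' _ _ := rfl
  map_smul' _ _ := rfl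
  cont := ContinuousMap.continuous_const'

theorem constCLM_apply {E : Type*} [NormedAddCommGroup E] [NormedSpace ℝ E] (e : E)
    (s : TimeInterval) : constCLM E e s = e := rfl

variable {P : Type} [NormedAddCommGroup P] [NormedSpace ℝ P]
  {E : Type*} [NormedAddCommGroup E] [NormedSpace ℝ E]

/-- The map sending `((τ, p), γ)` to the curve `s ↦ (t₀ + s τ, p, γ s)`. -/
def affineCurve (t₀ : ℝ) (z : (ℝ × P) × C(TimeInterval, E)) : C(TimeInterval, ℝ × P × E) :=
  ⟨fun s => (t₀ + s * z.1.1, z.1.2, z.2 s), by fun_prop⟩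

theorem contDiff_affineCurve (t₀ : ℝ) :
    ContDiff ℝ ∞ (affineCurve t₀ : (ℝ × P) × C(TimeInterval, E) → C(TimeInterval, ℝ × P × E)) := by
  -- The map is affine: a constant plus terms that are continuous and linear in `τ`, in `p` and in
  -- `γ`.
  have h : (affineCurve t₀ : (ℝ × P) × C(TimeInterval, E) → C(TimeInterval, ℝ × P × E)) =
      fun z => constCLM (ℝ × P × E) (t₀, 0, 0)
        + z.1.1 • (⟨fun s => (s, 0, 0), by fun_prop⟩ : C(TimeInterval, ℝ × P × E))
        + constCLM (ℝ × P × E) (0, z.1.2, 0)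
        + ((ContinuousLinearMap.inr ℝ ℝ (P × E)).comp
            (ContinuousLinearMap.inr ℝ P E)).compLeftContinuous ℝ TimeInterval z.2 := by
    ext z s <;> simp [affineCurve, constCLM_apply, mul_comm]
  rw [h]
  have h1 : ContDiff ℝ ∞ fun z : (ℝ × P) × C(TimeInterval, E) =>
      constCLM (ℝ × P × E) (0, z.1.2, 0) :=
    (constCLM (ℝ × P × E)).contDiff.comp (by fun_prop)
  have h2 : ContDiff ℝ ∞ fun z : (ℝ × P) × C(TimeInterval, E) =>
      ((ContinuousLinearMap.inr ℝ ℝ (P × E)).comp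
            (ContinuousLinearMap.inr ℝ P E)).compLeftContinuous ℝ TimeInterval z.2 :=
    (ContinuousLinearMap.contDiff _).comp (by fun_prop)
  exact ((contDiff_const.add ((contDiff_fst.fst).smul contDiff_const)).add h1).add h2

/-- The integral operator attached to `F` along affine curves. -/
def picardTerm (F : C(ℝ × P × E, E)) (t₀ : ℝ) (z : (ℝ × P) × C(TimeInterval, E)) :
    C(TimeInterval, E) :=
  volterra E (F.comp (affineCurve t₀ z))

theorem contDiff_picardTerm (F : C(ℝ × P × E, E)) (hF : ContDiff ℝ ∞ F) (t₀ : ℝ) :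
    ContDiff ℝ ∞ (picardTerm F t₀) :=
  (volterra E).contDiff.comp ((contDiff_postcomp F hF).comp (contDiff_affineCurve t₀))

theorem picardTerm_apply (F : C(ℝ × P × E, E)) (t₀ τ : ℝ) (p : P) (γ : C(TimeInterval, E))
    (s : TimeInterval) :
    picardTerm F t₀ ((τ, p), γ) s =
      ∫ r in (0 : ℝ)..s, F (t₀ + r * τ, p, γ (timeProj r)) := by
  rw [picardTerm, volterra_apply]
  refine integral_congr fun r hr => ?_
  have hr' : r ∈ Icc (-1 : ℝ) 1 := by
    have h0 : (0 : ℝ) ∈ Icc (-1 : ℝ) 1 := by constructor <;> norm_num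
    exact uIcc_subset_Icc h0 s.2 hr
  simp [affineCurve, timeProj_coe hr']

theorem exists_primitive [CompleteSpace E] (N : ℝ × P → E) (hN : ContDiff ℝ ∞ N) (t₀ : ℝ) :
    ∃ w : ℝ × P → E, ContDiff ℝ ∞ w ∧ (∀ t p, HasDerivAt (fun s => w (s, p)) (N (t, p)) t) ∧
      ∀ p, w (t₀, p) = 0 := by
  have hFc : ContDiff ℝ ∞ fun x : ℝ × P × E => N (x.1, x.2.1) := hN.comp (by fun_prop)
  let F : C(ℝ × P × E, E) := ⟨fun x => N (x.1, x.2.1), hFc.continuous⟩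
  -- Rescaling to a fixed interval moves the moving endpoint into the integrand, so that smoothness
  -- in `t` and `p` together follows from that of `picardTerm`.
  have hval : ∀ t p, ∫ r in t₀..t, N (r, p) =
      (t - t₀) • picardTerm F t₀ ((t - t₀, p), 0) (timeProj 1) := by
    intro t p
    rw [picardTerm_apply, timeProj_coe (by constructor <;> norm_num)]
    have := smul_integral_comp_add_mul (a := 0) (b := 1) (fun r => N (r, p)) (t - t₀) t₀
    simp only [mul_zero, add_zero, mul_one, add_sub_cancel] at this
    rw [← this]
    simp [F, mul_comm]
  refine ⟨fun q => ∫ r in t₀..q.1, N (r, q.2), ?_, ?_, fun p => integral_same⟩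
  · simp only [hval]
    refine ContDiff.smul (by fun_prop) ?_
    exact (ContinuousMap.evalCLM ℝ (timeProj 1)).contDiff.comp
      ((contDiff_picardTerm F hFc t₀).comp
        (show ContDiff ℝ ∞ fun q : ℝ × P => ((q.1 - t₀, q.2), (0 : C(TimeInterval, E))) by fun_prop))
  · intro t p
    have hc : Continuous fun r : ℝ => N (r, p) := hN.continuous.comp (by fun_prop)
    exact (hc.integral_hasStrictDerivAt t₀ t).hasDerivAt

/-- The map whose zeros in the second variable are the solutions of the integral equation. -/
def picardDefect (F : C(ℝ × P × E, E)) (t₀ : ℝ) (e₀ : E) (z : (ℝ × P) × C(TimeInterval, E)) :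
    C(TimeInterval, E) :=
  z.2 - constCLM E e₀ - z.1.1 • picardTerm F t₀ z

/-- With γ(s) = φ(t₀ + sτ), this is the integral form of φ' = F(t, p, φ), φ(t₀) = e₀. The elapsed
time `τ` has become a parameter, and at `τ = 0` the only zero is the constant curve. -/
theorem picardDefect_eq_zero_iff (F : C(ℝ × P × E, E)) (t₀ : ℝ) (e₀ : E) (τ : ℝ) (p : P)
    (γ : C(TimeInterval, E)) :
    picardDefect F t₀ e₀ ((τ, p), γ) = 0 ↔
      ∀ s : TimeInterval, γ s = e₀ + τ • ∫ r in (0 : ℝ)..s, F (t₀ + r * τ, p, γ (timeProj r)) := by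
  rw [ContinuousMap.ext_iff]
  refine forall_congr' fun s => ?_
  simp only [picardDefect, ContinuousMap.sub_apply, ContinuousMap.smul_apply, picardTerm_apply,
    constCLM_apply, ContinuousMap.zero_apply]
  rw [sub_sub, sub_eq_zero]

/-- The shear `(q, γ) ↦ (q, γ - q.1 h)`. -/
def shearEquiv (h : C(TimeInterval, E)) :
    ((ℝ × P) × C(TimeInterval, E)) ≃L[ℝ] ((ℝ × P) × C(TimeInterval, E)) :=
  ContinuousLinearEquiv.equivOfInverse
    ((ContinuousLinearMap.fst ℝ _ _).prod (ContinuousLinearMap.snd ℝ _ _ -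
      ((ContinuousLinearMap.fst ℝ ℝ P).comp (ContinuousLinearMap.fst ℝ _ _)).smulRight h))
    ((ContinuousLinearMap.fst ℝ _ _).prod (ContinuousLinearMap.snd ℝ _ _ +
      ((ContinuousLinearMap.fst ℝ ℝ P).comp (ContinuousLinearMap.fst ℝ _ _)).smulRight h))
    (fun z => by simp) (fun z => by simp)

/-- Implicit function theorem, in the form of the inverse function theorem for z ↦ (z.1, defect z).
At `τ = 0` the factor `τ` leaves only the term dτ · T(z₀), T being `picardTerm`, so the derivative
is a shear and invertible. -/
theorem exists_smooth_zero_picardDefect [CompleteSpace P] [CompleteSpace E] (F : C(ℝ × P × E, E))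
    (hF : ContDiff ℝ ∞ F) (t₀ : ℝ) (p₀ : P) (e₀ : E) :
    ∃ ψ : ℝ × P → C(TimeInterval, E), ∃ δ > 0, ∃ r > 0,
      ContDiffOn ℝ ∞ ψ (Metric.ball (0, p₀) δ) ∧
      (∀ q ∈ Metric.ball ((0 : ℝ), p₀) δ, picardDefect F t₀ e₀ (q, ψ q) = 0 ∧
        dist (ψ q) (constCLM E e₀) < r) ∧
      ∀ q ∈ Metric.ball ((0 : ℝ), p₀) δ, ∀ γ, dist γ (constCLM E e₀) < r →
        picardDefect F t₀ e₀ (q, γ) = 0 → γ = ψ q := by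
  let Z := (ℝ × P) × C(TimeInterval, E)
  let z₀ : Z := ((0, p₀), constCLM E e₀)
  have hT := contDiff_picardTerm F hF t₀
  have hD : ContDiff ℝ ∞ (picardDefect F t₀ e₀) :=
    (contDiff_snd.sub contDiff_const).sub ((contDiff_fst.fst).smul hT)
  let g : Z → Z := fun z => (z.1, picardDefect F t₀ e₀ z)
  have hg : ContDiff ℝ ∞ g := contDiff_fst.prodMk hD
  have hg0 : HasFDerivAt g ((shearEquiv (picardTerm F t₀ z₀) : Z ≃L[ℝ] Z) : Z →L[ℝ] Z) z₀ := by
    have h1 : HasFDerivAt (fun z : Z => z.1.1)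
        ((ContinuousLinearMap.fst ℝ ℝ P).comp (ContinuousLinearMap.fst ℝ _ _)) z₀ :=
      ((ContinuousLinearMap.fst ℝ ℝ P).comp
        (ContinuousLinearMap.fst ℝ (ℝ × P) C(TimeInterval, E))).hasFDerivAt
    have h2 := h1.smul (hT.differentiable (by simp) z₀).hasFDerivAt
    have h3 : HasFDerivAt (fun z : Z => z.2 - constCLM E e₀) (ContinuousLinearMap.snd ℝ _ _) z₀ :=
      hasFDerivAt_snd.sub_const _
    convert! (hasFDerivAt_fst (𝕜 := ℝ) (p := z₀)).prodMk (h3.sub h2) using 1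
    rw [show z₀.1.1 = 0 from rfl, zero_smul, zero_add]
    rfl
  -- Smoothness of the inverse is needed at every point near the base point, hence invertibility of
  -- the derivative there; invertible operators form an open set.
  have hinv : ∀ᶠ z in 𝓝 z₀, fderiv ℝ g z ∈
      range (ContinuousLinearEquiv.toContinuousLinearMap : (Z ≃L[ℝ] Z) → Z →L[ℝ] Z) := by
    have hc : ContinuousAt (fderiv ℝ g) z₀ := (hg.continuous_fderiv (by simp)).continuousAt
    refine hc ?_
    rw [hg0.fderiv]
    exact ContinuousLinearEquiv.nhds _
  let op := (hg.contDiffAt (x := z₀)).toOpenPartialHomeomorph g hg0 (by simp)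
  have hop : ∀ z, op z = g z := fun z => rfl
  have hz₀ : z₀ ∈ op.source := ContDiffAt.mem_toOpenPartialHomeomorph_source _ hg0 (by simp)
  have hgz₀ : g z₀ = ((0, p₀), 0) := by simp [g, z₀, picardDefect]
  obtain ⟨r, hr, hrb⟩ := Metric.eventually_nhds_iff_ball.1
    (hinv.and (op.open_source.mem_nhds hz₀))
  have htgt : ((0, p₀), (0 : C(TimeInterval, E))) ∈ op.target := by
    rw [← hgz₀]; exact op.map_source hz₀
  have hsymm0 : op.symm ((0, p₀), 0) = z₀ := by rw [← hgz₀]; exact op.left_inv hz₀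
  have hj : Continuous fun q : ℝ × P => (q, (0 : C(TimeInterval, E))) := by fun_prop
  have hev : ∀ᶠ q in 𝓝 ((0 : ℝ), p₀), (q, (0 : C(TimeInterval, E))) ∈ op.target ∧
      op.symm (q, 0) ∈ Metric.ball z₀ r ∧ q ∈ Metric.ball ((0 : ℝ), p₀) r := by
    refine (hj.continuousAt.eventually (op.open_target.mem_nhds htgt)).and (.and ?_ ?_)
    · have h1 : ContinuousAt (fun q : ℝ × P => op.symm (q, 0)) (0, p₀) :=
        (op.continuousAt_symm htgt).comp (f := fun q : ℝ × P => (q, (0 : C(TimeInterval, E))))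
          hj.continuousAt
      refine h1 ?_
      simp only [hsymm0]
      exact Metric.ball_mem_nhds _ hr
    · exact Metric.ball_mem_nhds _ hr
  obtain ⟨δ, hδ, hδb⟩ := Metric.eventually_nhds_iff_ball.1 hev
  have hfst : ∀ q ∈ Metric.ball ((0 : ℝ), p₀) δ,
      g (op.symm (q, 0)) = (q, 0) := fun q hq => op.right_inv (hδb q hq).1
  have hpair : ∀ q ∈ Metric.ball ((0 : ℝ), p₀) δ,
      op.symm (q, 0) = (q, (op.symm (q, 0)).2) := fun q hq =>
    Prod.ext (congrArg Prod.fst (hfst q hq) :) rfl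
  refine ⟨fun q => (op.symm (q, 0)).2, δ, hδ, r, hr, ?_, ?_, ?_⟩
  · intro q hq
    obtain ⟨e, he⟩ := (hrb _ (hδb q hq).2.1).1
    have h1 : HasFDerivAt op (e : Z →L[ℝ] Z) (op.symm (q, 0)) := by
      rw [he]
      exact (hg.differentiable (by simp) _).hasFDerivAt
    have h2 : ContDiffAt ℝ ∞ op.symm (q, 0) :=
      op.contDiffAt_symm (hδb q hq).1 h1 hg.contDiffAt
    exact (contDiffAt_snd.comp q (h2.comp (f := fun q : ℝ × P => (q, (0 : C(TimeInterval, E)))) q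
      (by fun_prop))).contDiffWithinAt
  · intro q hq
    refine ⟨?_, ?_⟩
    · rw [← hpair q hq]
      exact congrArg Prod.snd (hfst q hq)
    · exact lt_of_le_of_lt (le_max_right _ _) (hδb q hq).2.1
  · intro q hq γ hγ h0
    have hmem : (q, γ) ∈ Metric.ball z₀ r := max_lt (hδb q hq).2.2 hγ
    have h1 : op.symm (op (q, γ)) = (q, γ) := op.left_inv (hrb _ hmem).2
    rw [hop, show g (q, γ) = (q, 0) from Prod.ext rfl h0] at h1
    exact (congrArg Prod.snd h1).symm

/-- Smooth dependence on parameters of the local solution of an ordinary differential equation. -/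
theorem exists_smooth_local_solution [CompleteSpace P] [CompleteSpace E] (F : ℝ × P × E → E)
    (hF : ContDiff ℝ ∞ F) (t₀ : ℝ) (p₀ : P) (e₀ : E) :
    ∃ φ : ℝ × P → E, ∃ δ > 0, ContDiffOn ℝ ∞ φ (Metric.ball t₀ δ ×ˢ Metric.ball p₀ δ) ∧
      (∀ p ∈ Metric.ball p₀ δ, φ (t₀, p) = e₀) ∧
      ∀ t ∈ Metric.ball t₀ δ, ∀ p ∈ Metric.ball p₀ δ,
        HasDerivAt (fun s => φ (s, p)) (F (t, p, φ (t, p))) t := by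
  obtain ⟨ψ, δ, hδ, r, hr, hsm, hz, huniq⟩ :=
    exists_smooth_zero_picardDefect ⟨F, hF.continuous⟩ hF t₀ p₀ e₀
  have hmem : ∀ τ : ℝ, |τ| < δ → ∀ p ∈ Metric.ball p₀ δ, (τ, p) ∈ Metric.ball ((0 : ℝ), p₀) δ := by
    intro τ hτ p hp
    rw [Metric.mem_ball, Prod.dist_eq]
    exact max_lt (by simpa [Real.dist_eq] using hτ) hp
  have h1I : ((timeProj 1 : TimeInterval) : ℝ) = 1 := timeProj_coe (by constructor <;> norm_num)
  have hδ2 : |δ / 2| < δ := by rw [abs_of_pos (by positivity)]; linarith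
  -- The solution for elapsed time σδ/2, at the end of its interval, is the solution for elapsed
  -- time δ/2 read at `σ`. The reparametrised curve solves the rescaled integral equation and stays
  -- close to `e₀`, so the uniqueness clause applies.
  have hscale : ∀ p ∈ Metric.ball p₀ δ, ∀ σ ∈ Icc (-1 : ℝ) 1,
      ψ (σ * (δ / 2), p) (timeProj 1) = ψ (δ / 2, p) (timeProj σ) := by
    intro p hp σ hσ
    have hσs : ∀ s ∈ Icc (-1 : ℝ) 1, σ * s ∈ Icc (-1 : ℝ) 1 := by
      intro s hs
      rw [mem_Icc, ← abs_le] at *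
      rw [abs_mul]
      exact mul_le_one₀ hσ (abs_nonneg _) hs
    have hq := hmem _ hδ2 p hp
    let γ : C(TimeInterval, E) := (ψ (δ / 2, p)).comp
      ⟨fun s => timeProj (σ * s), continuous_timeProj.comp (by fun_prop)⟩
    have hγ : γ = ψ (σ * (δ / 2), p) := by
      refine huniq _ (hmem _ ?_ p hp) γ ?_ ?_
      · rw [abs_mul]
        exact lt_of_le_of_lt (mul_le_of_le_one_left (abs_nonneg _) (abs_le.2 hσ)) hδ2
      · refine lt_of_le_of_lt ?_ (hz _ hq).2
        rw [ContinuousMap.dist_le dist_nonneg]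
        intro s
        exact ContinuousMap.dist_apply_le_dist (f := ψ (δ / 2, p)) (g := constCLM E e₀) _
      · rw [picardDefect_eq_zero_iff]
        intro s
        have h := (picardDefect_eq_zero_iff _ _ _ _ _ _).1 (hz _ hq).1 (timeProj (σ * s))
        rw [timeProj_coe (hσs _ s.2)] at h
        change ψ (δ / 2, p) (timeProj (σ * s)) = _
        rw [h, mul_comm σ (δ / 2), mul_smul]
        congr 2
        have h2 := smul_integral_comp_mul_left (a := 0) (b := (s : ℝ))
          (fun r => F (t₀ + r * (δ / 2), p, ψ (δ / 2, p) (timeProj r))) σ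
        rw [mul_zero] at h2
        refine h2.symm.trans ?_
        congr 1
        refine integral_congr fun r hr => ?_
        have hr' : r ∈ Icc (-1 : ℝ) 1 := by
          have h0 : (0 : ℝ) ∈ Icc (-1 : ℝ) 1 := by constructor <;> norm_num
          exact uIcc_subset_Icc h0 s.2 hr
        change F (t₀ + σ * r * (δ / 2), p, ψ (δ / 2, p) (timeProj (σ * r))) =
          F (t₀ + r * (δ / 2 * σ), p, ψ (δ / 2, p) (timeProj (σ * (timeProj r : ℝ))))
        rw [timeProj_coe hr']
        congr 2
        ring
    rw [← hγ]
    change ψ (δ / 2, p) (timeProj (σ * (timeProj 1 : ℝ))) = _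
    rw [h1I, mul_one]
  have hval : ∀ p ∈ Metric.ball p₀ δ, ∀ t ∈ Metric.ball t₀ (δ / 2),
      ψ (t - t₀, p) (timeProj 1) = e₀ + (δ / 2) • ∫ r in (0 : ℝ)..((t - t₀) / (δ / 2)),
        F (t₀ + r * (δ / 2), p, ψ (δ / 2, p) (timeProj r)) := by
    intro p hp t ht
    have hσ : (t - t₀) / (δ / 2) ∈ Icc (-1 : ℝ) 1 := by
      rw [mem_Icc, ← abs_le, abs_div, abs_of_pos (half_pos hδ), div_le_one (half_pos hδ)]
      exact (Real.dist_eq t t₀ ▸ Metric.mem_ball.1 ht).le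
    have h := hscale p hp _ hσ
    rw [div_mul_cancel₀ _ (half_pos hδ).ne'] at h
    rw [h, (picardDefect_eq_zero_iff _ _ _ _ _ _).1 (hz _ (hmem _ hδ2 p hp)).1, timeProj_coe hσ]
    rfl
  have hsub : Metric.ball p₀ (δ / 2) ⊆ Metric.ball p₀ δ := Metric.ball_subset_ball (by linarith)
  -- Evaluating at s = 1 for elapsed time t - t₀ gives the value at time `t`. Smoothness comes from
  -- `ψ`; the differential equation comes from `hscale`, which rewrites these values along the
  -- single curve `ψ (δ / 2, p)`.
  refine ⟨fun q => ψ (q.1 - t₀, q.2) (timeProj 1), δ / 2, half_pos hδ, ?_, ?_, ?_⟩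
  · refine (ContinuousMap.evalCLM ℝ (timeProj 1)).contDiff.comp_contDiffOn
      (hsm.comp (f := fun q : ℝ × P => (q.1 - t₀, q.2))
        (by fun_prop : ContDiff ℝ ∞ fun q : ℝ × P => (q.1 - t₀, q.2)).contDiffOn ?_)
    rintro ⟨t, p⟩ ⟨ht, hp⟩
    refine hmem _ ?_ p (hsub hp)
    have : |t - t₀| < δ / 2 := by simpa [Real.dist_eq] using ht
    linarith
  · intro p hp
    have h := hval p (hsub hp) t₀ (Metric.mem_ball_self (half_pos hδ))
    simpa using h
  · intro t ht p hp
    have hp' := hsub hp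
    let f : ℝ → E := fun r => F (t₀ + r * (δ / 2), p, ψ (δ / 2, p) (timeProj r))
    have hf : Continuous f := hF.continuous.comp
      ((by fun_prop : Continuous fun r : ℝ => t₀ + r * (δ / 2)).prodMk
        (continuous_const.prodMk ((ψ (δ / 2, p)).continuous.comp continuous_timeProj)))
    have hev : (fun s => ψ (s - t₀, p) (timeProj 1)) =ᶠ[𝓝 t]
        fun s => e₀ + (δ / 2) • ∫ r in (0 : ℝ)..((s - t₀) / (δ / 2)), f r := by
      filter_upwards [Metric.isOpen_ball.mem_nhds ht] with s hs using hval p hp' s hs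
    refine HasDerivAt.congr_of_eventuallyEq ?_ hev
    have hσ : (t - t₀) / (δ / 2) ∈ Icc (-1 : ℝ) 1 := by
      rw [mem_Icc, ← abs_le, abs_div, abs_of_pos (half_pos hδ), div_le_one (half_pos hδ)]
      exact (Real.dist_eq t t₀ ▸ Metric.mem_ball.1 ht).le
    have h1 : HasDerivAt (fun s : ℝ => (s - t₀) / (δ / 2)) (1 / (δ / 2)) t :=
      ((hasDerivAt_id t).sub_const t₀).div_const _
    have h2 := ((hf.integral_hasStrictDerivAt 0 ((t - t₀) / (δ / 2))).hasDerivAt.scomp t h1)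
    have h3 := (h2.const_smul (δ / 2)).const_add e₀
    refine h3.congr_deriv ?_
    rw [smul_smul, mul_one_div_cancel (half_pos hδ).ne', one_smul]
    have h4 := hscale p hp' _ hσ
    rw [div_mul_cancel₀ _ (half_pos hδ).ne'] at h4
    simp only [f]
    rw [div_mul_cancel₀ _ (half_pos hδ).ne', h4]
    congr 2
    ring

end Primitive

theorem minSmoothness_two_le_infty : minSmoothness ℝ 2 ≤ ∞ := by
  rw [minSmoothness_of_isRCLikeNormedField]
  exact WithTop.coe_le_coe.2 (le_top : (2 : ℕ∞) ≤ ⊤)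

/-! ### Differentials as continuous linear maps between model spaces -/

section Differential

variable (EX EY : Type*) {EZ : Type*} [NormedAddCommGroup EX] [NormedSpace ℝ EX]
  [NormedAddCommGroup EY] [NormedSpace ℝ EY] [NormedAddCommGroup EZ] [NormedSpace ℝ EZ]
  {X Y Z : Type*} [TopologicalSpace X] [ChartedSpace EX X] [TopologicalSpace Y]
  [ChartedSpace EY Y] [TopologicalSpace Z] [ChartedSpace EZ Z]

/-- The differential of a map between manifolds, as a map between the model spaces. -/
def mD (f : X → Y) (x : X) : EX →L[ℝ] EY := mfderiv 𝓘(ℝ, EX) 𝓘(ℝ, EY) f x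

variable {EX EY}

theorem mD_comp {g : Y → Z} {f : X → Y} {x : X} {y : Y}
    (hg : MDifferentiableAt 𝓘(ℝ, EY) 𝓘(ℝ, EZ) g y) (hf : MDifferentiableAt 𝓘(ℝ, EX) 𝓘(ℝ, EY) f x)
    (hy : f x = y) : mD EX EZ (fun s => g (f s)) x = (mD EY EZ g y).comp (mD EX EY f x) := by
  subst hy
  exact mfderiv_comp x hg hf

theorem mD_congr {f g : X → Y} {x : X} (h : f =ᶠ[𝓝 x] g) : mD EX EY f x = mD EX EY g x :=
  h.mfderiv_eq

theorem mD_const (y : Y) (x : X) : mD EX EY (fun _ => y) x = 0 := mfderiv_const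

theorem mD_id (x : X) : mD EX EX (fun s : X => s) x = ContinuousLinearMap.id ℝ EX := mfderiv_id

theorem mD_eq_fderiv (f : EX → EY) (x : EX) : mD EX EY f x = fderiv ℝ f x := mfderiv_eq_fderiv

theorem mdifferentiableAt_chartAt [IsManifold 𝓘(ℝ, EX) ∞ X] (x : X) {y : X}
    (hy : y ∈ (chartAt EX x).source) :
    MDifferentiableAt 𝓘(ℝ, EX) 𝓘(ℝ, EX) (chartAt EX x) y :=
  (contMDiffAt_of_mem_maximalAtlas (n := ∞) (IsManifold.chart_mem_maximalAtlas x)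
    hy).mdifferentiableAt (by simp)

theorem mdifferentiableAt_chartAt_symm [IsManifold 𝓘(ℝ, EX) ∞ X] (x : X) {y : EX}
    (hy : y ∈ (chartAt EX x).target) :
    MDifferentiableAt 𝓘(ℝ, EX) 𝓘(ℝ, EX) (chartAt EX x).symm y :=
  (contMDiffAt_symm_of_mem_maximalAtlas (n := ∞) (IsManifold.chart_mem_maximalAtlas x)
    hy).mdifferentiableAt (by simp)

/-- The tangent space at `x` is identified with the model space through the preferred chart at `x`
itself. -/
theorem mD_chartAt [IsManifold 𝓘(ℝ, EX) ∞ X] (x : X) :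
    mD EX EX (chartAt EX x) x = ContinuousLinearMap.id ℝ EX := by
  refine (mdifferentiableAt_chartAt (EX := EX) x (mem_chart_source EX x)).mfderiv.trans ?_
  simp only [mfld_simps]
  rw [fderivWithin_univ]
  refine (Filter.EventuallyEq.fderiv_eq (f₁ := fun y => _) ?_).trans fderiv_id
  filter_upwards [(chartAt EX x).open_target.mem_nhds (mem_chart_target EX x)] with y hy
  exact (chartAt EX x).right_inv hy

theorem mD_chartAt_symm [IsManifold 𝓘(ℝ, EX) ∞ X] (x : X) :
    mD EX EX (chartAt EX x).symm (chartAt EX x x) = ContinuousLinearMap.id ℝ EX := by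
  have h := mD_comp (mdifferentiableAt_chartAt_symm (EX := EX) x (mem_chart_target EX x))
    (mdifferentiableAt_chartAt (EX := EX) x (mem_chart_source EX x)) rfl
  rw [mD_chartAt, ContinuousLinearMap.comp_id] at h
  rw [← h, ← mD_id x]
  refine mD_congr ?_
  filter_upwards [(chartAt EX x).open_source.mem_nhds (mem_chart_source EX x)] with y hy
  exact (chartAt EX x).left_inv hy

end Differential

/-! ### The right logarithmic derivative -/

section LogDeriv

variable {EG : Type*} [NormedAddCommGroup EG] [NormedSpace ℝ EG]
  {G : Type*} [TopologicalSpace G] [ChartedSpace EG G] [Group G]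
  {E : Type*} [NormedAddCommGroup E] [NormedSpace ℝ E]

/-- The right logarithmic derivative `du u⁻¹` of a map `u` into a Lie group. -/
def rightLog (u : E → G) (q : E) : E →L[ℝ] EG := mD E EG (fun s => u s * (u q)⁻¹) q

theorem logDerivR_eq_rightLog (u : ℝ → G) (x : ℝ) :
    (logDerivR u x : EG) = rightLog u x 1 := rfl

variable [LieGroup 𝓘(ℝ, EG) ∞ G]

theorem contMDiffAt_chartAt_one : ∀ g ∈ (chartAt EG (1 : G)).source,
    ContMDiffAt 𝓘(ℝ, EG) 𝓘(ℝ, EG) ∞ (chartAt EG (1 : G)) g := fun _ hg =>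
  contMDiffAt_of_mem_maximalAtlas (IsManifold.chart_mem_maximalAtlas _) hg

theorem contMDiffAt_chartAt_one_symm : ∀ a ∈ (chartAt EG (1 : G)).target,
    ContMDiffAt 𝓘(ℝ, EG) 𝓘(ℝ, EG) ∞ (chartAt EG (1 : G)).symm a := fun _ hg =>
  contMDiffAt_symm_of_mem_maximalAtlas (IsManifold.chart_mem_maximalAtlas _) hg

/-- The translated map passes through 1, where the chart has identity differential. One fixed chart
thus computes the logarithmic derivative at all points, which makes its smoothness accessible. -/
theorem rightLog_eq_fderiv {u : E → G} {q : E} (hu : MDifferentiableAt 𝓘(ℝ, E) 𝓘(ℝ, EG) u q) :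
    rightLog u q = fderiv ℝ (fun s => chartAt EG (1 : G) (u s * (u q)⁻¹)) q := by
  have h1 : MDifferentiableAt 𝓘(ℝ, E) 𝓘(ℝ, EG) (fun s => u s * (u q)⁻¹) q :=
    (contMDiff_mul_right (I := 𝓘(ℝ, EG)) (n := ∞) (a := (u q)⁻¹)).mdifferentiableAt
      (by simp) |>.comp q hu
  rw [← mD_eq_fderiv, mD_comp (mdifferentiableAt_chartAt (EX := EG) (1 : G)
    (mem_chart_source EG 1)) h1 (mul_inv_cancel _), mD_chartAt, ContinuousLinearMap.id_comp]
  rfl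

theorem contDiff_rightLog {u : E → G} (hu : ContMDiff 𝓘(ℝ, E) 𝓘(ℝ, EG) ∞ u) :
    ContDiff ℝ ∞ (rightLog u : E → E →L[ℝ] EG) := by
  have h : (rightLog u : E → E →L[ℝ] EG) =
      fun q => fderiv ℝ (fun s => chartAt EG (1 : G) (u s * (u q)⁻¹)) q := by
    ext1 q
    exact rightLog_eq_fderiv (hu.mdifferentiable (by simp) q)
  rw [h, contDiff_iff_contDiffAt]
  intro q
  refine ContDiffAt.fderiv (n := ∞) (f := fun q s => chartAt EG (1 : G) (u s * (u q)⁻¹)) ?_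
    contDiffAt_id (by simp)
  rw [← contMDiffAt_iff_contDiffAt]
  have h1 : ContMDiffAt 𝓘(ℝ, E × E) 𝓘(ℝ, EG) ∞ (fun z : E × E => u z.2 * (u z.1)⁻¹) (q, q) :=
    ((hu.comp contDiff_snd.contMDiff).mul (hu.comp contDiff_fst.contMDiff).inv).contMDiffAt
  refine ContMDiffAt.comp (q, q) (contMDiffAt_chartAt_one _ ?_) h1
  rw [mul_inv_cancel]
  exact mem_chart_source EG 1

theorem rightLog_mul_const (u : E → G) (c : G) (q : E) :
    (rightLog (fun s => u s * c) q : E →L[ℝ] EG) = rightLog u q := by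
  unfold rightLog
  congr 1
  ext s
  group

theorem rightLog_comp {E' : Type*} [NormedAddCommGroup E'] [NormedSpace ℝ E'] {u : E → G}
    {f : E' → E} {q : E'} (hu : MDifferentiableAt 𝓘(ℝ, E) 𝓘(ℝ, EG) u (f q))
    (hf : DifferentiableAt ℝ f q) :
    (rightLog (fun s => u (f s)) q : E' →L[ℝ] EG) = (rightLog u (f q)).comp (fderiv ℝ f q) := by
  rw [← mD_eq_fderiv]
  exact mD_comp (g := fun s => u s * (u (f q))⁻¹)
    ((contMDiff_mul_right (I := 𝓘(ℝ, EG)) (n := ∞) (a := (u (f q))⁻¹)).mdifferentiableAt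
      (by simp) |>.comp _ hu) hf.mdifferentiableAt rfl

/-! ### The group law in the chart at the identity -/

variable (G) in
/-- The group law in the chart at `1`. -/
def chartMul (z : EG × EG) : EG :=
  chartAt EG (1 : G) ((chartAt EG (1 : G)).symm z.1 * (chartAt EG (1 : G)).symm z.2)

theorem contDiffAt_chartMul {a b : EG} (ha : a ∈ (chartAt EG (1 : G)).target)
    (hb : b ∈ (chartAt EG (1 : G)).target)
    (hab : (chartAt EG (1 : G)).symm a * (chartAt EG (1 : G)).symm b ∈
      (chartAt EG (1 : G)).source) : ContDiffAt ℝ ∞ (chartMul G) (a, b) := by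
  rw [← contMDiffAt_iff_contDiffAt]
  refine ContMDiffAt.comp (a, b) (contMDiffAt_chartAt_one _ hab) ?_
  exact ((contMDiffAt_chartAt_one_symm a ha).comp (a, b) contDiffAt_fst.contMDiffAt).mul
    ((contMDiffAt_chartAt_one_symm b hb).comp (a, b) contDiffAt_snd.contMDiffAt)

variable (EG G) in
/-- The coordinates of the identity. -/
def chartOne : EG := chartAt EG (1 : G) 1

theorem chartOne_mem : chartOne EG G ∈ (chartAt EG (1 : G)).target := mem_chart_target EG 1

theorem chartAt_symm_chartOne : (chartAt EG (1 : G)).symm (chartOne EG G) = 1 :=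
  (chartAt EG (1 : G)).left_inv (mem_chart_source EG 1)

theorem contDiffAt_chartMul_left {a : EG} (ha : a ∈ (chartAt EG (1 : G)).target) :
    ContDiffAt ℝ ∞ (chartMul G) (a, chartOne EG G) := by
  refine contDiffAt_chartMul ha chartOne_mem ?_
  rw [chartAt_symm_chartOne, mul_one]
  exact (chartAt EG (1 : G)).map_target ha

theorem contDiffAt_chartMul_right {a : EG} (ha : a ∈ (chartAt EG (1 : G)).target) :
    ContDiffAt ℝ ∞ (chartMul G) (chartOne EG G, a) := by
  refine contDiffAt_chartMul chartOne_mem ha ?_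
  rw [chartAt_symm_chartOne, one_mul]
  exact (chartAt EG (1 : G)).map_target ha

variable (G) in
/-- The differential at `1` of right translation by `a`, in the chart at `1`. -/
def chartR (a : EG) : EG →L[ℝ] EG := fderiv ℝ (fun s => chartMul G (s, a)) (chartOne EG G)

variable (G) in
/-- The differential at `1` of left translation by `a`, in the chart at `1`. -/
def chartL (a : EG) : EG →L[ℝ] EG := fderiv ℝ (fun s => chartMul G (a, s)) (chartOne EG G)

theorem chartR_apply {a : EG} (ha : a ∈ (chartAt EG (1 : G)).target) (x : EG) :
    chartR G a x = fderiv ℝ (chartMul G) (chartOne EG G, a) (x, 0) := by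
  have h := ((contDiffAt_chartMul_right ha).differentiableAt (by simp)).hasFDerivAt.comp
    (chartOne EG G) (hasFDerivAt_prodMk_left (𝕜 := ℝ) (chartOne EG G) a)
  unfold chartR
  rw [HasFDerivAt.fderiv (f := fun s => chartMul G (s, a)) h]
  simp

theorem chartL_apply {a : EG} (ha : a ∈ (chartAt EG (1 : G)).target) (x : EG) :
    chartL G a x = fderiv ℝ (chartMul G) (a, chartOne EG G) (0, x) := by
  have h := ((contDiffAt_chartMul_left ha).differentiableAt (by simp)).hasFDerivAt.comp
    (chartOne EG G) (hasFDerivAt_prodMk_right (𝕜 := ℝ) a (chartOne EG G))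
  unfold chartL
  rw [HasFDerivAt.fderiv (f := fun s => chartMul G (a, s)) h]
  simp

theorem contDiffAt_chartR {a : EG} (ha : a ∈ (chartAt EG (1 : G)).target) :
    ContDiffAt ℝ ∞ (chartR G) a := by
  refine ContDiffAt.fderiv (n := ∞) (f := fun a s => chartMul G (s, a)) ?_ contDiffAt_const
    (by simp)
  exact (contDiffAt_chartMul_right ha).comp (f := fun z : EG × EG => (z.2, z.1))
    (a, chartOne EG G) (by fun_prop)

theorem contDiffAt_chartL {a : EG} (ha : a ∈ (chartAt EG (1 : G)).target) :
    ContDiffAt ℝ ∞ (chartL G) a := by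
  refine ContDiffAt.fderiv (n := ∞) (f := fun a s => chartMul G (a, s)) ?_ contDiffAt_const
    (by simp)
  exact contDiffAt_chartMul_left ha

theorem chartR_chartOne : chartR G (chartOne EG G) = ContinuousLinearMap.id ℝ EG := by
  refine (Filter.EventuallyEq.fderiv_eq ?_).trans fderiv_id
  filter_upwards [(chartAt EG (1 : G)).open_target.mem_nhds chartOne_mem] with y hy
  simp only [chartMul, chartAt_symm_chartOne, mul_one]
  exact (chartAt EG (1 : G)).right_inv hy

theorem chartL_chartOne : chartL G (chartOne EG G) = ContinuousLinearMap.id ℝ EG := by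
  refine (Filter.EventuallyEq.fderiv_eq ?_).trans fderiv_id
  filter_upwards [(chartAt EG (1 : G)).open_target.mem_nhds chartOne_mem] with y hy
  simp only [chartMul, chartAt_symm_chartOne, one_mul]
  exact (chartAt EG (1 : G)).right_inv hy

/-- Both sides are the mixed second derivative of the group law at (1, 1), taken in the two orders.
-/
theorem fderiv_chartR_eq_fderiv_chartL (x y : EG) :
    fderiv ℝ (chartR G) (chartOne EG G) y x = fderiv ℝ (chartL G) (chartOne EG G) x y := by
  have hμ := contDiffAt_chartMul_left (chartOne_mem (EG := EG) (G := G))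
  have hμ1 : DifferentiableAt ℝ (fderiv ℝ (chartMul G)) (chartOne EG G, chartOne EG G) :=
    (hμ.fderiv_right (m := ∞) (by simp)).differentiableAt (by simp)
  have ht := (chartAt EG (1 : G)).open_target.mem_nhds (chartOne_mem (EG := EG) (G := G))
  have hR : fderiv ℝ (chartR G) (chartOne EG G) y x =
      fderiv ℝ (fderiv ℝ (chartMul G)) (chartOne EG G, chartOne EG G) (0, y) (x, 0) := by
    have h1 : (fun a => chartR G a x) =ᶠ[𝓝 (chartOne EG G)]
        fun a => fderiv ℝ (chartMul G) (chartOne EG G, a) (x, 0) := by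
      filter_upwards [ht] with a ha using chartR_apply ha x
    have h2 := (((contDiffAt_chartR (chartOne_mem (EG := EG) (G := G))).differentiableAt
      (by simp)).hasFDerivAt.clm_apply (hasFDerivAt_const x _)).fderiv
    have h3 := ((hμ1.hasFDerivAt.comp (f := fun a => (chartOne EG G, a)) (chartOne EG G)
      (hasFDerivAt_prodMk_right (𝕜 := ℝ) (chartOne EG G) (chartOne EG G))).clm_apply
        (hasFDerivAt_const ((x, 0) : EG × EG) _)).fderiv
    have h4 := congrArg (fun A : EG →L[ℝ] EG => A y) (h2.symm.trans (h1.fderiv_eq.trans h3))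
    simpa using h4
  have hL : fderiv ℝ (chartL G) (chartOne EG G) x y =
      fderiv ℝ (fderiv ℝ (chartMul G)) (chartOne EG G, chartOne EG G) (x, 0) (0, y) := by
    have h1 : (fun a => chartL G a y) =ᶠ[𝓝 (chartOne EG G)]
        fun a => fderiv ℝ (chartMul G) (a, chartOne EG G) (0, y) := by
      filter_upwards [ht] with a ha using chartL_apply ha y
    have h2 := (((contDiffAt_chartL (chartOne_mem (EG := EG) (G := G))).differentiableAt
      (by simp)).hasFDerivAt.clm_apply (hasFDerivAt_const y _)).fderiv
    have h3 := ((hμ1.hasFDerivAt.comp (f := fun a => (a, chartOne EG G)) (chartOne EG G)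
      (hasFDerivAt_prodMk_left (𝕜 := ℝ) (chartOne EG G) (chartOne EG G))).clm_apply
        (hasFDerivAt_const ((0, y) : EG × EG) _)).fderiv
    have h4 := congrArg (fun A : EG →L[ℝ] EG => A x) (h2.symm.trans (h1.fderiv_eq.trans h3))
    simpa using h4
  rw [hR, hL]
  exact (hμ.isSymmSndFDerivAt minSmoothness_two_le_infty).eq _ _

variable (G) in
/-- The Lie bracket, as a continuous bilinear map computed in the chart at `1`. -/
def chartBracket : EG →L[ℝ] EG →L[ℝ] EG :=
  fderiv ℝ (chartL G) (chartOne EG G) - (fderiv ℝ (chartL G) (chartOne EG G)).flip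

theorem chartBracket_apply (x y : EG) : chartBracket G x y =
    fderiv ℝ (chartL G) (chartOne EG G) x y - fderiv ℝ (chartL G) (chartOne EG G) y x := rfl

/-- Differentiate u(s) = (u(s) u(q)⁻¹) u(q). This serves the Maurer-Cartan equation and also turns
u' u⁻¹ = A into an equation in the chart. -/
theorem fderiv_chart_comp {u : E → G} {q : E} (hu : MDifferentiableAt 𝓘(ℝ, E) 𝓘(ℝ, EG) u q)
    (hq : u q ∈ (chartAt EG (1 : G)).source) :
    fderiv ℝ (fun s => chartAt EG (1 : G) (u s)) q =
      (chartR G (chartAt EG (1 : G) (u q))).comp (rightLog u q) := by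
  have ha := (chartAt EG (1 : G)).map_source hq
  have h1 : MDifferentiableAt 𝓘(ℝ, E) 𝓘(ℝ, EG) (fun s => u s * (u q)⁻¹) q :=
    (contMDiff_mul_right (I := 𝓘(ℝ, EG)) (n := ∞) (a := (u q)⁻¹)).mdifferentiableAt
      (by simp) |>.comp q hu
  have h2 : MDifferentiableAt 𝓘(ℝ, E) 𝓘(ℝ, EG)
      (fun s => chartAt EG (1 : G) (u s * (u q)⁻¹)) q := by
    refine MDifferentiableAt.comp q (mdifferentiableAt_chartAt (EX := EG) (1 : G) ?_) h1
    rw [mul_inv_cancel]; exact mem_chart_source EG 1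
  have h3 : DifferentiableAt ℝ (fun s => chartMul G (s, chartAt EG (1 : G) (u q)))
      (chartOne EG G) :=
    ((contDiffAt_chartMul_right ha).differentiableAt (by simp)).comp
      (f := fun s => (s, chartAt EG (1 : G) (u q))) (chartOne EG G) (by fun_prop)
  rw [rightLog_eq_fderiv hu]
  have h4 : chartAt EG (1 : G) (u q * (u q)⁻¹) = chartOne EG G := by rw [mul_inv_cancel]; rfl
  rw [← h4] at h3
  have h5 := fderiv_comp q h3 h2.differentiableAt
  unfold chartR
  rw [← h4, ← h5]
  refine Filter.EventuallyEq.fderiv_eq ?_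
  have h6 : ∀ᶠ s in 𝓝 q, u s * (u q)⁻¹ ∈ (chartAt EG (1 : G)).source := by
    refine h1.continuousAt ((chartAt EG (1 : G)).open_source.mem_nhds ?_)
    rw [mul_inv_cancel]; exact mem_chart_source EG 1
  filter_upwards [h6] with s hs
  simp [chartMul, (chartAt EG (1 : G)).left_inv hs, (chartAt EG (1 : G)).left_inv hq]

/-- The Maurer-Cartan equation. -/
theorem maurerCartan {u : E → G} (hu : ContMDiff 𝓘(ℝ, E) 𝓘(ℝ, EG) ∞ u) (q a b : E) :
    fderiv ℝ (rightLog u : E → E →L[ℝ] EG) q a b - fderiv ℝ (rightLog u : E → E →L[ℝ] EG) q b a =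
      chartBracket G (rightLog u q a) (rightLog u q b) := by
  -- Right translation leaves the logarithmic derivative unchanged and moves the point to 1, where
  -- the differential of right translation in the chart is the identity.
  let v : E → G := fun s => u s * (u q)⁻¹
  have hv : ContMDiff 𝓘(ℝ, E) 𝓘(ℝ, EG) ∞ v := hu.mul contMDiff_const
  have hvu : (rightLog u : E → E →L[ℝ] EG) = rightLog v := by
    ext1 s; exact (rightLog_mul_const u _ s).symm
  have hvq : v q = 1 := mul_inv_cancel _
  have hmem : v q ∈ (chartAt EG (1 : G)).source := by rw [hvq]; exact mem_chart_source EG 1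
  have hc : ContDiffAt ℝ ∞ (fun s => chartAt EG (1 : G) (v s)) q := by
    rw [← contMDiffAt_iff_contDiffAt]
    exact (contMDiffAt_chartAt_one _ hmem).comp q hv.contMDiffAt
  have hev : ∀ᶠ s in 𝓝 q, fderiv ℝ (fun s => chartAt EG (1 : G) (v s)) s =
      (chartR G (chartAt EG (1 : G) (v s))).comp (rightLog v s) := by
    filter_upwards [hv.continuous.continuousAt ((chartAt EG (1 : G)).open_source.mem_nhds hmem)]
      with s hs
    exact fderiv_chart_comp (hv.mdifferentiable (by simp) s) hs
  have hq1 : chartAt EG (1 : G) (v q) = chartOne EG G := by rw [hvq]; rfl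
  have hd1 : HasFDerivAt (fun s => chartAt EG (1 : G) (v s)) (rightLog v q) q := by
    have := hev.self_of_nhds
    rw [hq1, chartR_chartOne, ContinuousLinearMap.id_comp] at this
    rw [← this]
    exact (hc.differentiableAt (by simp)).hasFDerivAt
  have hR : HasFDerivAt (fun s => chartR G (chartAt EG (1 : G) (v s)))
      ((fderiv ℝ (chartR G) (chartOne EG G)).comp (rightLog v q)) q := by
    refine HasFDerivAt.comp (g := chartR G) q ?_ hd1
    rw [hq1]
    exact ((contDiffAt_chartR chartOne_mem).differentiableAt (by simp)).hasFDerivAt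
  have hlog : HasFDerivAt (rightLog v : E → E →L[ℝ] EG) (fderiv ℝ (rightLog v) q) q :=
    ((contDiff_rightLog hv).differentiable (by simp) q).hasFDerivAt
  -- Differentiating d(chart ∘ v) = R(v) · `rightLog v` once more; symmetry of the left side in `c`,
  -- `d` is the Maurer-Cartan equation.
  have hsecond : ∀ c d, fderiv ℝ (fderiv ℝ (fun s => chartAt EG (1 : G) (v s))) q c d =
      fderiv ℝ (chartR G) (chartOne EG G) (rightLog v q c) (rightLog v q d) +
        fderiv ℝ (rightLog v : E → E →L[ℝ] EG) q c d := by
    intro c d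
    rw [Filter.EventuallyEq.fderiv_eq hev, (hR.clm_comp hlog).fderiv, hq1, chartR_chartOne]
    simp [add_comm]
  have hsymm := (hc.isSymmSndFDerivAt minSmoothness_two_le_infty).eq a b
  rw [hsecond, hsecond] at hsymm
  rw [hvu, chartBracket_apply, ← fderiv_chartR_eq_fderiv_chartL, ← fderiv_chartR_eq_fderiv_chartL,
    sub_eq_sub_iff_add_eq_add, add_comm, hsymm, add_comm]

end LogDeriv

/-! ### The Lie bracket of left invariant fields in the chart at the identity -/

section LieBracket

variable {EG : Type*} [NormedAddCommGroup EG] [NormedSpace ℝ EG]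
  {G : Type*} [TopologicalSpace G] [ChartedSpace EG G] [Group G] [LieGroup 𝓘(ℝ, EG) ∞ G]

theorem mD_mul_left_comp_chart {a : EG} (ha : a ∈ (chartAt EG (1 : G)).target) :
    (mD EG EG (chartAt EG (1 : G)) ((chartAt EG (1 : G)).symm a)).comp
      (mD EG EG (fun b : G => (chartAt EG (1 : G)).symm a * b) 1) = chartL G a := by
  have h1 : MDifferentiableAt 𝓘(ℝ, EG) 𝓘(ℝ, EG)
      (fun b : G => (chartAt EG (1 : G)).symm a * b) 1 :=
    (contMDiff_mul_left (I := 𝓘(ℝ, EG)) (n := ∞)).mdifferentiableAt (by simp)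
  have h2 : MDifferentiableAt 𝓘(ℝ, EG) 𝓘(ℝ, EG) (chartAt EG (1 : G)).symm (chartOne EG G) :=
    mdifferentiableAt_chartAt_symm (EX := EG) (1 : G) chartOne_mem
  have h3 : MDifferentiableAt 𝓘(ℝ, EG) 𝓘(ℝ, EG) (chartAt EG (1 : G))
      ((chartAt EG (1 : G)).symm a) :=
    mdifferentiableAt_chartAt (EX := EG) (1 : G) ((chartAt EG (1 : G)).map_target ha)
  have h4 := mD_comp h1 h2 chartAt_symm_chartOne
  rw [show mD EG EG (chartAt EG (1 : G)).symm (chartOne EG G) = _ from mD_chartAt_symm (1 : G),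
    ContinuousLinearMap.comp_id] at h4
  have h5 : MDifferentiableAt 𝓘(ℝ, EG) 𝓘(ℝ, EG)
      (fun s => (chartAt EG (1 : G)).symm a * (chartAt EG (1 : G)).symm s) (chartOne EG G) :=
    MDifferentiableAt.comp (g := fun b : G => (chartAt EG (1 : G)).symm a * b) (chartOne EG G)
      ((contMDiff_mul_left (I := 𝓘(ℝ, EG)) (n := ∞)).mdifferentiableAt (by simp)) h2
  rw [← h4, ← mD_comp h3 h5 (by rw [chartAt_symm_chartOne, mul_one]), mD_eq_fderiv]
  rfl

/-- The inverse of the differential of the inverse chart is the differential of the chart, so the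
left invariant field read in the chart is `a ↦ chartL G a x`. -/
theorem mpullbackWithin_mulInvariantVectorField_chart {a : EG}
    (ha : a ∈ (chartAt EG (1 : G)).target) (x : EG) :
    (VectorField.mpullbackWithin 𝓘(ℝ, EG) 𝓘(ℝ, EG) (extChartAt 𝓘(ℝ, EG) (1 : G)).symm
      (mulInvariantVectorField (I := 𝓘(ℝ, EG)) (G := G) x) (range 𝓘(ℝ, EG)) a : EG) =
      chartL G a x := by
  have hs : ((chartAt EG (1 : G)).symm a) ∈ (chartAt EG (1 : G)).source :=
    (chartAt EG (1 : G)).map_target ha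
  have h2 := mdifferentiableAt_chartAt_symm (EX := EG) (1 : G) ha
  have h3 := mdifferentiableAt_chartAt (EX := EG) (1 : G) hs
  have h23 := mD_comp h2 h3 ((chartAt EG (1 : G)).right_inv ha)
  have h32 := mD_comp h3 h2 rfl
  have e1 : mD EG EG (fun s : G => (chartAt EG (1 : G)).symm (chartAt EG (1 : G) s))
      ((chartAt EG (1 : G)).symm a) = ContinuousLinearMap.id ℝ EG := by
    rw [← mD_id ((chartAt EG (1 : G)).symm a)]
    refine mD_congr ?_
    filter_upwards [(chartAt EG (1 : G)).open_source.mem_nhds hs] with s h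
      using (chartAt EG (1 : G)).left_inv h
  have e2 : mD EG EG (fun s : EG => chartAt EG (1 : G) ((chartAt EG (1 : G)).symm s)) a =
      ContinuousLinearMap.id ℝ EG := by
    rw [← mD_id a]
    refine mD_congr ?_
    filter_upwards [(chartAt EG (1 : G)).open_target.mem_nhds ha] with s h
      using (chartAt EG (1 : G)).right_inv h
  rw [e1] at h23
  rw [e2] at h32
  have hinv : (mD EG EG (chartAt EG (1 : G)).symm a).inverse =
      mD EG EG (chartAt EG (1 : G)) ((chartAt EG (1 : G)).symm a) :=
    ContinuousLinearMap.inverse_eq h23.symm h32.symm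
  rw [VectorField.mpullbackWithin_apply]
  have hmf : (mfderivWithin 𝓘(ℝ, EG) 𝓘(ℝ, EG) (extChartAt 𝓘(ℝ, EG) (1 : G)).symm
      (range 𝓘(ℝ, EG)) a : EG →L[ℝ] EG) = mD EG EG (chartAt EG (1 : G)).symm a := by
    simp only [mfld_simps]
    rfl
  change (ContinuousLinearMap.inverse (mfderivWithin 𝓘(ℝ, EG) 𝓘(ℝ, EG)
    (extChartAt 𝓘(ℝ, EG) (1 : G)).symm (range 𝓘(ℝ, EG)) a : EG →L[ℝ] EG) :
      EG →L[ℝ] EG) _ = _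
  rw [hmf, hinv, ← mD_mul_left_comp_chart ha]
  rfl

/-- The bracket of the fields `chartL G · x` and `chartL G · y` at 1 is dL(x)y - dL(y)x, because
`chartL` is the identity there. This fixes the sign with which the bracket enters the Maurer-Cartan
equation. -/
theorem lieBr_eq_chartBracket (x y : EG) : lieBr G x y = chartBracket G x y := by
  have hV : ∀ x : EG, (VectorField.mpullbackWithin 𝓘(ℝ, EG) 𝓘(ℝ, EG)
      (extChartAt 𝓘(ℝ, EG) (1 : G)).symm (mulInvariantVectorField (I := 𝓘(ℝ, EG)) (G := G) x)
      (range 𝓘(ℝ, EG)) : EG → EG) =ᶠ[𝓝 (chartOne EG G)] fun a => chartL G a x := by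
    intro x
    filter_upwards [(chartAt EG (1 : G)).open_target.mem_nhds chartOne_mem] with a ha
      using mpullbackWithin_mulInvariantVectorField_chart ha x
  have hd : ∀ x z : EG, fderiv ℝ (fun a => chartL G a x) (chartOne EG G) z =
      fderiv ℝ (chartL G) (chartOne EG G) z x := by
    intro x z
    have h2 := (((contDiffAt_chartL (chartOne_mem (EG := EG) (G := G))).differentiableAt
      (by simp)).hasFDerivAt.clm_apply (hasFDerivAt_const x _)).fderiv
    rw [h2]
    simp
  have h1 : lieBr G x y = (ContinuousLinearMap.inverse (mD EG EG (extChartAt 𝓘(ℝ, EG) (1 : G)) 1))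
      (VectorField.lieBracketWithin ℝ
        (VectorField.mpullbackWithin 𝓘(ℝ, EG) 𝓘(ℝ, EG)
          (extChartAt 𝓘(ℝ, EG) (1 : G)).symm
          (mulInvariantVectorField (I := 𝓘(ℝ, EG)) (G := G) x) (range 𝓘(ℝ, EG)) : EG → EG)
        (VectorField.mpullbackWithin 𝓘(ℝ, EG) 𝓘(ℝ, EG)
          (extChartAt 𝓘(ℝ, EG) (1 : G)).symm
          (mulInvariantVectorField (I := 𝓘(ℝ, EG)) (G := G) y) (range 𝓘(ℝ, EG)) : EG → EG)
        ((extChartAt 𝓘(ℝ, EG) (1 : G)).symm ⁻¹' univ ∩ range 𝓘(ℝ, EG))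
        (extChartAt 𝓘(ℝ, EG) (1 : G) 1)) := rfl
  have h2 : mD EG EG (extChartAt 𝓘(ℝ, EG) (1 : G)) 1 = ContinuousLinearMap.id ℝ EG := by
    rw [← mD_chartAt (1 : G)]
    simp only [mfld_simps]
  have h3 : ((extChartAt 𝓘(ℝ, EG) (1 : G)).symm ⁻¹' univ ∩ range 𝓘(ℝ, EG)) = univ := by simp
  have h4 : extChartAt 𝓘(ℝ, EG) (1 : G) 1 = chartOne EG G := by simp [chartOne]
  have key : ∀ V W : EG → EG, (V =ᶠ[𝓝 (chartOne EG G)] fun a => chartL G a x) →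
      (W =ᶠ[𝓝 (chartOne EG G)] fun a => chartL G a y) →
      VectorField.lieBracketWithin ℝ V W univ (chartOne EG G) = chartBracket G x y := by
    intro V W hVx hWy
    rw [VectorField.lieBracketWithin_univ, VectorField.lieBracket_eq]
    simp only [hVx.fderiv_eq, hWy.fderiv_eq, hVx.eq_of_nhds, hWy.eq_of_nhds, hd]
    simp [chartL_chartOne, chartBracket_apply]
  rw [h1, h2, h3, h4, ContinuousLinearMap.inverse_id]
  exact key _ _ (hV x) (hV y)

end LieBracket

/-! ### The differential equation u' u⁻¹ = A in a Lie group -/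

section GroupODE

variable {EG : Type*} [NormedAddCommGroup EG] [NormedSpace ℝ EG]
  {G : Type*} [TopologicalSpace G] [ChartedSpace EG G] [Group G] [LieGroup 𝓘(ℝ, EG) ∞ G]

/-! ### Uniqueness -/

theorem mdifferentiableAt_mul_right {E : Type*} [NormedAddCommGroup E] [NormedSpace ℝ E]
    {u : E → G} {q : E} (hu : MDifferentiableAt 𝓘(ℝ, E) 𝓘(ℝ, EG) u q) (c : G) :
    MDifferentiableAt 𝓘(ℝ, E) 𝓘(ℝ, EG) (fun s => u s * c) q :=
  (contMDiff_mul_right (I := 𝓘(ℝ, EG)) (n := ∞) (a := c)).mdifferentiableAt (by simp) |>.comp q hu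

theorem contDiffAt_chart_inv_mul :
    ContDiffAt ℝ ∞ (fun z : EG × EG => chartAt EG (1 : G)
      (((chartAt EG (1 : G)).symm z.1)⁻¹ * (chartAt EG (1 : G)).symm z.2))
      (chartOne EG G, chartOne EG G) := by
  rw [← contMDiffAt_iff_contDiffAt]
  refine ContMDiffAt.comp (g := chartAt EG (1 : G)) (chartOne EG G, chartOne EG G)
    (contMDiffAt_chartAt_one _ ?_) ?_
  · simp only [chartAt_symm_chartOne, inv_one, one_mul]
    exact mem_chart_source EG 1
  · exact (((contMDiffAt_chartAt_one_symm _ chartOne_mem).comp (chartOne EG G, chartOne EG G)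
      contDiffAt_fst.contMDiffAt).inv).mul
      ((contMDiffAt_chartAt_one_symm _ chartOne_mem).comp (chartOne EG G, chartOne EG G)
        contDiffAt_snd.contMDiffAt)

/-- If `u` and `v` pass through `1` at `q` with the same differential, then the quotient has
vanishing differential. -/
theorem hasFDerivAt_chart_inv_mul {E : Type*} [NormedAddCommGroup E] [NormedSpace ℝ E]
    {u v : E → G} {q : E} (hu : MDifferentiableAt 𝓘(ℝ, E) 𝓘(ℝ, EG) u q)
    (hv : MDifferentiableAt 𝓘(ℝ, E) 𝓘(ℝ, EG) v q) (hu1 : u q = 1) (hv1 : v q = 1)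
    (h : fderiv ℝ (fun s => chartAt EG (1 : G) (u s)) q =
      fderiv ℝ (fun s => chartAt EG (1 : G) (v s)) q) :
    HasFDerivAt (fun s => chartAt EG (1 : G) ((v s)⁻¹ * u s)) (0 : E →L[ℝ] EG) q := by
  have hsrc : ∀ {w : E → G}, w q = 1 → w q ∈ (chartAt EG (1 : G)).source := by
    intro w hw; rw [hw]; exact mem_chart_source EG 1
  have hdiff : ∀ {w : E → G}, MDifferentiableAt 𝓘(ℝ, E) 𝓘(ℝ, EG) w q → w q = 1 →
      HasFDerivAt (fun s => chartAt EG (1 : G) (w s))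
        (fderiv ℝ (fun s => chartAt EG (1 : G) (w s)) q) q := by
    intro w hw hw1
    exact (MDifferentiableAt.comp q (mdifferentiableAt_chartAt (EX := EG) (1 : G) (hsrc hw1))
      hw).differentiableAt.hasFDerivAt
  have hk := (contDiffAt_chart_inv_mul (EG := EG) (G := G)).differentiableAt (by simp)
  -- Since a⁻¹a is constant, the differential of (a, b) ↦ a⁻¹b at (1, 1) vanishes on the diagonal,
  -- where the common differential of `v` and `u` takes its values.
  have hdiag : (fderiv ℝ (fun z : EG × EG => chartAt EG (1 : G)
      (((chartAt EG (1 : G)).symm z.1)⁻¹ * (chartAt EG (1 : G)).symm z.2))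
      (chartOne EG G, chartOne EG G)).comp ((ContinuousLinearMap.id ℝ EG).prod
        (ContinuousLinearMap.id ℝ EG)) = 0 := by
    have h1 := hk.hasFDerivAt.comp (f := fun a => (a, a)) (chartOne EG G)
      ((hasFDerivAt_id (𝕜 := ℝ) (chartOne EG G)).prodMk (hasFDerivAt_id (chartOne EG G)))
    refine h1.unique ?_
    refine (hasFDerivAt_const (𝕜 := ℝ) (chartAt EG (1 : G) 1) (chartOne EG G)).congr_of_eventuallyEq
      (Filter.Eventually.of_forall fun a => ?_)
    simp
  have e1 : ∀ {w : E → G}, w q = 1 → chartAt EG (1 : G) (w q) = chartOne EG G := by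
    intro w hw; rw [hw]; rfl
  have h2 : HasFDerivAt (fun s => (chartAt EG (1 : G) (v s), chartAt EG (1 : G) (u s)))
      ((fderiv ℝ (fun s => chartAt EG (1 : G) (v s)) q).prod
        (fderiv ℝ (fun s => chartAt EG (1 : G) (v s)) q)) q := by
    have := (hdiff hv hv1).prodMk (hdiff hu hu1)
    rwa [h] at this
  have hk' := hk.hasFDerivAt
  have e2 : (chartOne EG G, chartOne EG G) =
      (chartAt EG (1 : G) (v q), chartAt EG (1 : G) (u q)) := by rw [e1 hv1, e1 hu1]
  rw [e2] at hk' hdiag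
  have h3 := HasFDerivAt.comp (f := fun s => (chartAt EG (1 : G) (v s), chartAt EG (1 : G) (u s)))
    q hk' h2
  have h4 : (fderiv ℝ (fun z : EG × EG => chartAt EG (1 : G)
      (((chartAt EG (1 : G)).symm z.1)⁻¹ * (chartAt EG (1 : G)).symm z.2))
      (chartAt EG (1 : G) (v q), chartAt EG (1 : G) (u q))).comp
        ((fderiv ℝ (fun s => chartAt EG (1 : G) (v s)) q).prod
        (fderiv ℝ (fun s => chartAt EG (1 : G) (v s)) q)) = 0 := by
    ext x
    exact congrArg (fun A : EG →L[ℝ] EG => A (fderiv ℝ (fun s => chartAt EG (1 : G) (v s)) q x))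
      hdiag
  rw [h4] at h3
  refine h3.congr_of_eventuallyEq ?_
  filter_upwards [hu.continuousAt ((chartAt EG (1 : G)).open_source.mem_nhds (hsrc hu1)),
    hv.continuousAt ((chartAt EG (1 : G)).open_source.mem_nhds (hsrc hv1))] with s hs hs'
  simp [(chartAt EG (1 : G)).left_inv hs, (chartAt EG (1 : G)).left_inv hs']

/-- Mean value inequality in the chart at `c t`; connectedness later makes the conclusion global. -/
theorem eventually_eq_of_mD_eq_zero {c : ℝ → G} {t : ℝ}
    (hc : ∀ᶠ s in 𝓝 t, MDifferentiableAt 𝓘(ℝ, ℝ) 𝓘(ℝ, EG) c s ∧ mD ℝ EG c s = 0) :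
    ∀ᶠ s in 𝓝 t, c t = c s := by
  have hcont : ContinuousAt c t := hc.self_of_nhds.1.continuousAt
  have hsrc := hcont ((chartAt EG (c t)).open_source.mem_nhds (mem_chart_source EG (c t)))
  obtain ⟨δ, hδ, hb⟩ := Metric.eventually_nhds_iff_ball.1 (hc.and hsrc)
  filter_upwards [Metric.ball_mem_nhds t hδ] with s hs
  have hder : ∀ r ∈ Metric.ball t δ,
      HasFDerivWithinAt (fun r => chartAt EG (c t) (c r)) (0 : ℝ →L[ℝ] EG) (Metric.ball t δ) r := by
    intro r hr
    obtain ⟨⟨h1, h2⟩, h3⟩ := hb r hr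
    have h4 := mdifferentiableAt_chartAt (EX := EG) (c t) h3
    have h5 : DifferentiableAt ℝ (fun r => chartAt EG (c t) (c r)) r :=
      (MDifferentiableAt.comp r h4 h1).differentiableAt
    have h6 := mD_comp h4 h1 rfl
    rw [h2, ContinuousLinearMap.comp_zero, mD_eq_fderiv] at h6
    have := h5.hasFDerivAt.hasFDerivWithinAt (s := Metric.ball t δ)
    rwa [h6] at this
  have h7 := (convex_ball t δ).norm_image_sub_le_of_norm_hasFDerivWithin_le hder
    (C := 0) (fun _ _ => by simp) (Metric.mem_ball_self hδ) hs
  rw [zero_mul, norm_le_zero_iff, sub_eq_zero] at h7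
  exact ((chartAt EG (c t)).injOn (hb s hs).2 (hb t (Metric.mem_ball_self hδ)).2 h7).symm

/-- The derivative of v⁻¹u is v⁻¹(u'u⁻¹ - v'v⁻¹)u = 0, so v⁻¹u is constant on the interval. -/
theorem eq_of_logDerivR_eq {u v : ℝ → G} {I : Set ℝ} (hI : IsOpen I) (hIc : IsPreconnected I)
    (hu : ∀ t ∈ I, MDifferentiableAt 𝓘(ℝ, ℝ) 𝓘(ℝ, EG) u t)
    (hv : ∀ t ∈ I, MDifferentiableAt 𝓘(ℝ, ℝ) 𝓘(ℝ, EG) v t)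
    (h : ∀ t ∈ I, (logDerivR u t : EG) = logDerivR v t) {t₀ t : ℝ} (ht₀ : t₀ ∈ I) (ht : t ∈ I)
    (h0 : u t₀ = v t₀) : u t = v t := by
  have hmul : ∀ a b : G, ContMDiff 𝓘(ℝ, EG) 𝓘(ℝ, EG) ∞ fun g : G => a * g * b := fun a b =>
    (contMDiff_const.mul contMDiff_id).mul contMDiff_const
  have key : ∀ t ∈ I, MDifferentiableAt 𝓘(ℝ, ℝ) 𝓘(ℝ, EG) (fun s => (v s)⁻¹ * u s) t ∧
      mD ℝ EG (fun s => (v s)⁻¹ * u s) t = 0 := by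
    intro t ht
    have hu' := mdifferentiableAt_mul_right (hu t ht) (u t)⁻¹
    have hv' := mdifferentiableAt_mul_right (hv t ht) (v t)⁻¹
    have hlog : rightLog u t = (rightLog v t : ℝ →L[ℝ] EG) := by
      ext
      exact h t ht
    have h1 : HasFDerivAt (fun s => chartAt EG (1 : G) ((v s * (v t)⁻¹)⁻¹ * (u s * (u t)⁻¹)))
        (0 : ℝ →L[ℝ] EG) t := by
      refine hasFDerivAt_chart_inv_mul hu' hv' (mul_inv_cancel _) (mul_inv_cancel _) ?_
      rw [← rightLog_eq_fderiv (hu t ht), ← rightLog_eq_fderiv (hv t ht), hlog]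
    -- Both factors are translated to pass through 1 at `t`; the quotient v⁻¹u is recovered as
    -- v(t)⁻¹ w u(t).
    let w : ℝ → G := fun s => (v s * (v t)⁻¹)⁻¹ * (u s * (u t)⁻¹)
    have hw : MDifferentiableAt 𝓘(ℝ, ℝ) 𝓘(ℝ, EG) w t := by
      have hi : MDifferentiableAt 𝓘(ℝ, ℝ) 𝓘(ℝ, EG) (fun s => (v s * (v t)⁻¹)⁻¹) t :=
        MDifferentiableAt.comp t ((contMDiff_inv 𝓘(ℝ, EG) ∞).mdifferentiableAt (by simp)) hv'
      exact MDifferentiableAt.comp t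
        ((contMDiff_mul 𝓘(ℝ, EG) ∞).mdifferentiableAt (by simp)) (hi.prodMk hu')
    have hw1 : w t = 1 := by simp [w]
    have hw0 : mD ℝ EG w t = 0 := by
      have h2 := mD_comp (mdifferentiableAt_chartAt (EX := EG) (1 : G) (mem_chart_source EG 1)) hw
        hw1
      rw [mD_chartAt, ContinuousLinearMap.id_comp, mD_eq_fderiv] at h2
      rw [← h2]
      exact h1.fderiv
    have he : (fun s => (v s)⁻¹ * u s) = fun s => (v t)⁻¹ * w s * u t := by
      ext s
      simp only [w]
      group
    rw [he]
    have hm := (hmul (v t)⁻¹ (u t)).mdifferentiableAt (x := w t) (by simp)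
    refine ⟨hm.comp t hw, ?_⟩
    rw [mD_comp hm hw rfl, hw0, ContinuousLinearMap.comp_zero]
  have hconst : (v t₀)⁻¹ * u t₀ = (v t)⁻¹ * u t := by
    refine hIc.induction₂ (fun x y => (v x)⁻¹ * u x = (v y)⁻¹ * u y) ?_ ?_ ?_ ht₀ ht
    · intro x hx
      refine nhdsWithin_le_nhds (eventually_eq_of_mD_eq_zero (EG := EG)
        (c := fun s => (v s)⁻¹ * u s) ?_)
      filter_upwards [hI.mem_nhds hx] with s hs using key s hs
    · intro x y z _ _ _ h1 h2; exact h1.trans h2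
    · intro x y _ _ h1; exact h1.symm
  rw [h0, inv_mul_cancel] at hconst
  exact (inv_mul_eq_one.1 hconst.symm).symm

/-! ### Existence -/

variable {P : Type} [NormedAddCommGroup P] [NormedSpace ℝ P]

/-- `u` is a smooth solution on `I × U` of `∂ₜu u⁻¹ = A`. -/
structure IsSolOn (A : ℝ × P → EG) (I : Set ℝ) (U : Set P) (u : ℝ × P → G) : Prop where
  smooth : ContMDiffOn 𝓘(ℝ, ℝ × P) 𝓘(ℝ, EG) ∞ u (I ×ˢ U)
  eqn : ∀ t ∈ I, ∀ p ∈ U, (logDerivR (fun s => u (s, p)) t : EG) = A (t, p)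

theorem mdifferentiableAt_slice {u : ℝ × P → G} {t : ℝ} {p : P}
    (h : ContMDiffAt 𝓘(ℝ, ℝ × P) 𝓘(ℝ, EG) ∞ u (t, p)) :
    MDifferentiableAt 𝓘(ℝ, ℝ) 𝓘(ℝ, EG) (fun s => u (s, p)) t :=
  MDifferentiableAt.comp (g := u) (f := fun s => (s, p)) t (h.mdifferentiableAt (by simp))
    (by fun_prop : DifferentiableAt ℝ (fun s : ℝ => (s, p)) t).mdifferentiableAt

theorem IsSolOn.contMDiffAt {A : ℝ × P → EG} {I : Set ℝ} {U : Set P} {u : ℝ × P → G}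
    (h : IsSolOn A I U u) (hI : IsOpen I) (hU : IsOpen U) {t : ℝ} {p : P} (ht : t ∈ I)
    (hp : p ∈ U) : ContMDiffAt 𝓘(ℝ, ℝ × P) 𝓘(ℝ, EG) ∞ u (t, p) :=
  h.smooth.contMDiffAt ((hI.prod hU).mem_nhds ⟨ht, hp⟩)

theorem logDerivR_congr {u v : ℝ → G} {t : ℝ} (h : u =ᶠ[𝓝 t] v) :
    (logDerivR u t : EG) = logDerivR v t := by
  have h1 : (fun s => u s * (u t)⁻¹) =ᶠ[𝓝 t] fun s => v s * (v t)⁻¹ := by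
    filter_upwards [h] with s hs
    rw [hs, h.eq_of_nhds]
  exact congrArg (fun A : ℝ →L[ℝ] EG => A 1) (mD_congr h1)

theorem logDerivR_mul_const (u : ℝ → G) (c : G) (t : ℝ) :
    (logDerivR (fun s => u s * c) t : EG) = logDerivR u t :=
  congrArg (fun A : ℝ →L[ℝ] EG => A 1) (rightLog_mul_const u c t)

/-- A right factor independent of `t` cancels in u'u⁻¹. Such factors are the freedom used to match
solutions and to impose initial values. -/
theorem IsSolOn.normalize {A : ℝ × P → EG} {I : Set ℝ} {U : Set P} {u : ℝ × P → G}
    (h : IsSolOn A I U u) {c : P → G} (hc : ContMDiffOn 𝓘(ℝ, P) 𝓘(ℝ, EG) ∞ c U) :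
    IsSolOn A I U fun z => u z * c z.2 where
  smooth := h.smooth.mul (hc.comp (f := Prod.snd) contDiff_snd.contMDiff.contMDiffOn fun z hz => hz.2)
  eqn t ht p hp := by
    rw [← h.eqn t ht p hp]
    exact logDerivR_mul_const (fun s => u (s, p)) (c p) t

theorem IsSolOn.contMDiffOn_slice {A : ℝ × P → EG} {I : Set ℝ} {U : Set P} {u : ℝ × P → G}
    (h : IsSolOn A I U u) {t : ℝ} (ht : t ∈ I) :
    ContMDiffOn 𝓘(ℝ, P) 𝓘(ℝ, EG) ∞ (fun p => u (t, p)) U :=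
  h.smooth.comp (f := fun p => (t, p))
    (by fun_prop : ContDiff ℝ ∞ fun p : P => (t, p)).contMDiff.contMDiffOn fun _ hp => ⟨ht, hp⟩

theorem IsSolOn.eq_of_eq {A : ℝ × P → EG} {I J : Set ℝ} {U V : Set P} {u v : ℝ × P → G}
    (hu : IsSolOn A I U u) (hv : IsSolOn A J V v) (hI : IsOpen I) (hJ : IsOpen J)
    (hU : IsOpen U) (hV : IsOpen V) (hIc : I.OrdConnected) (hJc : J.OrdConnected)
    {t₀ t : ℝ} {p : P} (ht₀ : t₀ ∈ I ∩ J) (ht : t ∈ I ∩ J) (hp : p ∈ U ∩ V)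
    (h0 : u (t₀, p) = v (t₀, p)) : u (t, p) = v (t, p) :=
  eq_of_logDerivR_eq (EG := EG) (u := fun s => u (s, p)) (v := fun s => v (s, p)) (hI.inter hJ)
    (hIc.inter hJc).isPreconnected
    (fun _ hs => mdifferentiableAt_slice (hu.contMDiffAt hI hU hs.1 hp.1))
    (fun _ hs => mdifferentiableAt_slice (hv.contMDiffAt hJ hV hs.2 hp.2))
    (fun s hs => (hu.eqn s hs.1 p hp.1).trans (hv.eqn s hs.2 p hp.2).symm) ht₀ ht h0

/-- Correct `v` on the right so that it agrees with `u` at `t₀`; the overlap of the two intervals is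
an interval, so uniqueness makes them agree on all of it. -/
theorem IsSolOn.glue {A : ℝ × P → EG} {I J : Set ℝ} {U V : Set P} {u v : ℝ × P → G}
    (hu : IsSolOn A I U u) (hv : IsSolOn A J V v) (hI : IsOpen I) (hJ : IsOpen J)
    (hU : IsOpen U) (hV : IsOpen V) (hIc : I.OrdConnected) (hJc : J.OrdConnected)
    {t₀ : ℝ} (ht₀ : t₀ ∈ I ∩ J) :
    ∃ w : ℝ × P → G, IsSolOn A (I ∪ J) (U ∩ V) w := by
  classical
  let v' : ℝ × P → G := fun z => v z * ((v (t₀, z.2))⁻¹ * u (t₀, z.2))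
  have hv' : IsSolOn A J (U ∩ V) v' :=
    IsSolOn.normalize (c := fun p => (v (t₀, p))⁻¹ * u (t₀, p))
      ⟨hv.smooth.mono (prod_mono_right inter_subset_right), fun t ht p hp => hv.eqn t ht p hp.2⟩
      (((hv.contMDiffOn_slice ht₀.2).inv.mono inter_subset_right).mul
        ((hu.contMDiffOn_slice ht₀.1).mono inter_subset_left))
  let w : ℝ × P → G := fun z => if z.1 ∈ I then u z else v' z
  have hwI : ∀ t ∈ I, ∀ p, w (t, p) = u (t, p) := fun t ht p => if_pos ht
  have hwJ : ∀ t ∈ J, ∀ p ∈ U ∩ V, w (t, p) = v' (t, p) := by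
    intro t ht p hp
    by_cases htI : t ∈ I
    · rw [hwI t htI]
      refine hu.eq_of_eq hv' hI hJ hU (hU.inter hV) hIc hJc ht₀ ⟨htI, ht⟩ ⟨hp.1, hp⟩ ?_
      simp [v']
    · exact if_neg htI
  refine ⟨w, ?_, ?_⟩
  · rintro ⟨t, p⟩ ⟨ht | ht, hp⟩
    · refine ((hu.contMDiffAt hI hU ht hp.1).congr_of_eventuallyEq ?_).contMDiffWithinAt
      filter_upwards [(hI.prod isOpen_univ).mem_nhds (show (t, p) ∈ I ×ˢ univ from ⟨ht, trivial⟩)]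
        with z hz using hwI z.1 hz.1 z.2
    · refine ((hv'.contMDiffAt hJ (hU.inter hV) ht hp).congr_of_eventuallyEq ?_).contMDiffWithinAt
      filter_upwards [(hJ.prod (hU.inter hV)).mem_nhds
        (show (t, p) ∈ J ×ˢ (U ∩ V) from ⟨ht, hp⟩)] with z hz using hwJ z.1 hz.1 z.2 hz.2
  · rintro t (ht | ht) p hp
    · rw [← hu.eqn t ht p hp.1]
      refine logDerivR_congr ?_
      filter_upwards [hI.mem_nhds ht] with s hs using hwI s hs p
    · rw [← hv'.eqn t ht p hp]
      refine logDerivR_congr ?_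
      filter_upwards [hJ.mem_nhds ht] with s hs using hwJ s hs p hp

/-- In the chart at 1 the equation reads φ' = R(φ)A. A bump function extends the right side to a
globally smooth field, and a short-time solution stays where the bump equals 1. -/
theorem exists_local_isSolOn [FiniteDimensional ℝ EG] [CompleteSpace P] (A : ℝ × P → EG)
    (hA : ContDiff ℝ ∞ A) (t₀ : ℝ) (p₀ : P) :
    ∃ u : ℝ × P → G, ∃ δ > 0, IsSolOn A (Metric.ball t₀ δ) (Metric.ball p₀ δ) u := by
  have : CompleteSpace EG := FiniteDimensional.complete ℝ EG
  obtain ⟨r, hr, hrb⟩ := Metric.mem_nhds_iff.1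
    ((chartAt EG (1 : G)).open_target.mem_nhds (chartOne_mem (EG := EG) (G := G)))
  -- The bump is 1 on the ball of radius r/4 and is supported in the ball of radius r/2, inside the
  -- chart target.
  let χ : ContDiffBump (chartOne EG G) := ⟨r / 4, r / 2, by positivity, by linarith⟩
  have hχt : tsupport χ ⊆ (chartAt EG (1 : G)).target := by
    rw [χ.tsupport_eq]
    exact (Metric.closedBall_subset_ball (by change r / 2 < r; linarith)).trans hrb
  have hχR : ContDiff ℝ ∞ fun a => χ a • chartR G a := by
    rw [contDiff_iff_contDiffAt]
    intro a
    by_cases ha : a ∈ tsupport χ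
    · exact χ.contDiff.contDiffAt.smul (contDiffAt_chartR (hχt ha))
    · refine (contDiffAt_const (c := (0 : EG →L[ℝ] EG))).congr_of_eventuallyEq ?_
      filter_upwards [notMem_tsupport_iff_eventuallyEq.1 ha] with b hb
      simp [hb]
  obtain ⟨φ, δ, hδ, hsm, hinit, hode⟩ := exists_smooth_local_solution
    (fun z : ℝ × P × EG => (χ z.2.2 • chartR G z.2.2) (A (z.1, z.2.1)))
    ((hχR.comp (contDiff_snd.snd)).clm_apply (hA.comp (by fun_prop))) t₀ p₀ (chartOne EG G)
  have hball : ∀ {ε : ℝ}, 0 < ε → (t₀, p₀) ∈ Metric.ball t₀ ε ×ˢ Metric.ball p₀ ε := fun hε =>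
    ⟨Metric.mem_ball_self hε, Metric.mem_ball_self hε⟩
  have hφc : ContinuousAt φ (t₀, p₀) :=
    hsm.continuousOn.continuousAt
      ((Metric.isOpen_ball.prod Metric.isOpen_ball).mem_nhds (hball hδ))
  have hφ0 : φ (t₀, p₀) = chartOne EG G := hinit p₀ (Metric.mem_ball_self hδ)
  -- `A` is read off from the chart equation by cancelling R(φ), which is invertible near the
  -- identity.
  have hunit : ∀ᶠ a in 𝓝 (chartOne EG G), IsUnit (chartR G a) := by
    have hc : ContinuousAt (chartR G) (chartOne EG G) :=
      (contDiffAt_chartR chartOne_mem).continuousAt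
    refine hc (Units.isOpen.mem_nhds ?_)
    rw [chartR_chartOne]
    exact isUnit_one
  have hev : ∀ᶠ z in 𝓝 (t₀, p₀), IsUnit (chartR G (φ z)) ∧
      φ z ∈ Metric.ball (chartOne EG G) (r / 4) := by
    have : ∀ᶠ a in 𝓝 (chartOne EG G), IsUnit (chartR G a) ∧
        a ∈ Metric.ball (chartOne EG G) (r / 4) :=
      hunit.and (Metric.ball_mem_nhds _ (by positivity))
    have h := hφc.tendsto
    rw [hφ0] at h
    exact h.eventually this
  obtain ⟨ε, hε, hεb⟩ := Metric.eventually_nhds_iff_ball.1 hev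
  have hmin : 0 < min δ ε := lt_min hδ hε
  have hδs : ∀ {t p}, t ∈ Metric.ball t₀ (min δ ε) → p ∈ Metric.ball p₀ (min δ ε) →
      (t ∈ Metric.ball t₀ δ ∧ p ∈ Metric.ball p₀ δ) ∧ (t, p) ∈ Metric.ball (t₀, p₀) ε := by
    intro t p ht hp
    refine ⟨⟨Metric.ball_subset_ball (min_le_left _ _) ht,
      Metric.ball_subset_ball (min_le_left _ _) hp⟩, ?_⟩
    rw [← ball_prod_same]
    exact ⟨Metric.ball_subset_ball (min_le_right _ _) ht,
      Metric.ball_subset_ball (min_le_right _ _) hp⟩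
  have htgt : ∀ {z}, z ∈ Metric.ball (t₀, p₀) ε → φ z ∈ (chartAt EG (1 : G)).target := fun hz =>
    hrb (Metric.ball_subset_ball (by linarith) (hεb _ hz).2)
  have hsmooth : ContMDiffOn 𝓘(ℝ, ℝ × P) 𝓘(ℝ, EG) ∞ (fun z => (chartAt EG (1 : G)).symm (φ z))
      (Metric.ball t₀ (min δ ε) ×ˢ Metric.ball p₀ (min δ ε)) := by
    rintro ⟨t, p⟩ ⟨ht, hp⟩
    have h1 : ContDiffAt ℝ ∞ φ (t, p) := hsm.contDiffAt
      ((Metric.isOpen_ball.prod Metric.isOpen_ball).mem_nhds (hδs ht hp).1)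
    exact ((contMDiffAt_chartAt_one_symm _ (htgt (hδs ht hp).2)).comp (t, p)
      h1.contMDiffAt).contMDiffWithinAt
  refine ⟨fun z => (chartAt EG (1 : G)).symm (φ z), min δ ε, hmin, hsmooth, ?_⟩
  intro t ht p hp
  obtain ⟨⟨ht', hp'⟩, hz⟩ := hδs ht hp
  have hu : MDifferentiableAt 𝓘(ℝ, ℝ) 𝓘(ℝ, EG) (fun s => (chartAt EG (1 : G)).symm (φ (s, p))) t :=
    mdifferentiableAt_slice (hsmooth.contMDiffAt
      ((Metric.isOpen_ball.prod Metric.isOpen_ball).mem_nhds ⟨ht, hp⟩))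
  have h1 := fderiv_chart_comp hu ((chartAt EG (1 : G)).map_target (htgt hz))
  have h2 : (fun s => chartAt EG (1 : G) ((chartAt EG (1 : G)).symm (φ (s, p)))) =ᶠ[𝓝 t]
      fun s => φ (s, p) := by
    filter_upwards [Metric.isOpen_ball.mem_nhds ht] with s hs
    exact (chartAt EG (1 : G)).right_inv (htgt (hδs hs hp).2)
  rw [h2.fderiv_eq, (chartAt EG (1 : G)).right_inv (htgt hz)] at h1
  have h3 := congrArg (fun B : ℝ →L[ℝ] EG => B 1) h1
  have hχ1 : χ (φ (t, p)) = 1 := χ.one_of_mem_closedBall (Metric.ball_subset_closedBall (hεb _ hz).2)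
  simp only [(hode t ht' p hp').hasFDerivAt.fderiv, ContinuousLinearMap.comp_apply, hχ1,
    one_smul] at h3
  obtain ⟨R, hR⟩ := (hεb _ hz).1
  have hinj : Function.Injective (chartR G (φ (t, p))) := by
    intro x y hxy
    have := congrArg (fun z => (↑R⁻¹ : EG →L[ℝ] EG) z) hxy
    simp only [← hR] at this
    change ((↑R⁻¹ : EG →L[ℝ] EG) * (↑R : EG →L[ℝ] EG)) x =
      ((↑R⁻¹ : EG →L[ℝ] EG) * (↑R : EG →L[ℝ] EG)) y at this
    simpa using this
  rw [logDerivR_eq_rightLog]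
  refine (hinj ?_).symm
  rw [← h3]
  simp

/-- Existence of the smooth global solution of `∂ₜu u⁻¹ = A`, `u(t₀, p) = 1`. -/
theorem exists_global_solution [FiniteDimensional ℝ EG] [CompleteSpace P] (A : ℝ × P → EG)
    (hA : ContDiff ℝ ∞ A) (t₀ : ℝ) :
    ∃ u : ℝ × P → G, ContMDiff 𝓘(ℝ, ℝ × P) 𝓘(ℝ, EG) ∞ u ∧
      (∀ t p, (logDerivR (fun s => u (s, p)) t : EG) = A (t, p)) ∧ ∀ p, u (t₀, p) = 1 := by
  -- "Some solution lives on an interval containing `s` and `t`, near `p`" is a symmetric relation,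
  -- transitive by gluing and true locally; connectedness of ℝ makes it hold for all pairs. Only
  -- finitely many shrinkings of the neighbourhood of `p` occur.
  have hR : ∀ (p : P) (s t : ℝ), ∃ (I : Set ℝ) (U : Set P) (u : ℝ × P → G), IsOpen I ∧
      I.OrdConnected ∧ s ∈ I ∧ t ∈ I ∧ IsOpen U ∧ p ∈ U ∧ IsSolOn A I U u := by
    intro p s t
    refine isPreconnected_univ.induction₂ (fun s t => ∃ (I : Set ℝ) (U : Set P) (u : ℝ × P → G),
      IsOpen I ∧ I.OrdConnected ∧ s ∈ I ∧ t ∈ I ∧ IsOpen U ∧ p ∈ U ∧ IsSolOn A I U u) ?_ ?_ ?_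
      (mem_univ s) (mem_univ t)
    · intro x _
      obtain ⟨u, δ, hδ, hu⟩ := exists_local_isSolOn (G := G) A hA x p
      filter_upwards [nhdsWithin_le_nhds (Metric.ball_mem_nhds x hδ)] with y hy
      exact ⟨Metric.ball x δ, Metric.ball p δ, u, Metric.isOpen_ball,
        (convex_ball x δ).ordConnected, Metric.mem_ball_self hδ, hy, Metric.isOpen_ball,
        Metric.mem_ball_self hδ, hu⟩
    · rintro x y z - - - ⟨I, U, u, hI, hIc, hx, hy, hU, hp, hu⟩ ⟨J, V, v, hJ, hJc, hy', hz, hV, hp', hv⟩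
      obtain ⟨w, hw⟩ := hu.glue hv hI hJ hU hV hIc hJc ⟨hy, hy'⟩
      refine ⟨I ∪ J, U ∩ V, w, hI.union hJ, ?_, .inl hx, .inr hz, hU.inter hV, ⟨hp, hp'⟩, hw⟩
      rw [← isPreconnected_iff_ordConnected] at *
      exact hIc.union y hy hy' hJc
    · rintro x y - - ⟨I, U, u, hI, hIc, hx, hy, hU, hp, hu⟩
      exact ⟨I, U, u, hI, hIc, hy, hx, hU, hp, hu⟩
  choose I U w hI hIc ht₀ ht hU hp hw using fun z : ℝ × P => hR z.2 t₀ z.1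
  let n : ℝ × P → ℝ × P → G := fun z y => w z y * (w z (t₀, y.2))⁻¹
  have hn : ∀ z, IsSolOn A (I z) (U z) (n z) := fun z =>
    (hw z).normalize (c := fun p => (w z (t₀, p))⁻¹) ((hw z).contMDiffOn_slice (ht₀ z)).inv
  have hn0 : ∀ z p, n z (t₀, p) = 1 := fun z p => mul_inv_cancel _
  -- All normalised solutions equal 1 at `t₀`, so any two agree wherever both live. The diagonal
  -- choice `n z z` is therefore locally a single smooth solution.
  have hloc : ∀ z, ∀ y ∈ I z ×ˢ U z, n y y = n z y := by
    rintro z ⟨t, p⟩ ⟨hyt, hyp⟩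
    exact (hn (t, p)).eq_of_eq (hn z) (hI _) (hI _) (hU _) (hU _) (hIc _) (hIc _) ⟨ht₀ _, ht₀ _⟩
      ⟨ht (t, p), hyt⟩ ⟨hp (t, p), hyp⟩ ((hn0 _ _).trans (hn0 _ _).symm)
  have hmem : ∀ z : ℝ × P, z ∈ I z ×ˢ U z := fun z => ⟨ht z, hp z⟩
  refine ⟨fun z => n z z, ?_, ?_, fun p => hn0 _ p⟩
  · intro z
    refine ((hn z).contMDiffAt (hI z) (hU z) (ht z) (hp z)).congr_of_eventuallyEq ?_
    filter_upwards [((hI z).prod (hU z)).mem_nhds (hmem z)] with y hy using hloc z y hy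
  · intro t p
    rw [← (hn (t, p)).eqn t (ht (t, p)) p (hp (t, p))]
    refine logDerivR_congr ?_
    filter_upwards [(hI (t, p)).mem_nhds (ht (t, p))] with s hs
    exact hloc (t, p) (s, p) ⟨hs, hp (t, p)⟩

end GroupODE

/-! ### Differential calculus of the crossed module action -/

section CrossedModule

variable {EG : Type*} [NormedAddCommGroup EG] [NormedSpace ℝ EG]
  {G : Type*} [TopologicalSpace G] [ChartedSpace EG G] [Group G] [LieGroup 𝓘(ℝ, EG) ∞ G]
  {EH : Type*} [NormedAddCommGroup EH] [NormedSpace ℝ EH]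
  {H : Type*} [TopologicalSpace H] [ChartedSpace EH H] [Group H] [LieGroup 𝓘(ℝ, EH) ∞ H]
  {E : Type*} [NormedAddCommGroup E] [NormedSpace ℝ E]

namespace LieCrossedModule

variable (X : LieCrossedModule EG G EH H)

/-- `ṁ(a)` as a continuous linear map. -/
def mDotL (a : G) : EH →L[ℝ] EH := mD EH EH (X.m a) 1

/-- The derived action as a continuous bilinear map. -/
def mHatL : EG →L[ℝ] EH →L[ℝ] EH := mD EG (EH →L[ℝ] EH) X.mDotL 1

/-- `ṫ` as a continuous linear map. -/
def tDotL : EH →L[ℝ] EG := mD EH EG X.t 1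

theorem mDot_eq (a : G) (x : EH) : X.mDot a x = X.mDotL a x := rfl

theorem contMDiff_m (a : G) : ContMDiff 𝓘(ℝ, EH) 𝓘(ℝ, EH) ∞ (X.m a) :=
  X.smooth_m.comp (contMDiff_const.prodMk contMDiff_id)

theorem mdifferentiable_m (a : G) : MDifferentiable 𝓘(ℝ, EH) 𝓘(ℝ, EH) (X.m a) :=
  (X.contMDiff_m a).mdifferentiable (by simp)

theorem mDotL_one : X.mDotL 1 = ContinuousLinearMap.id ℝ EH := by
  unfold mDotL
  rw [map_one]
  exact mD_id _

theorem mDotL_mul (a b : G) : X.mDotL (a * b) = (X.mDotL a).comp (X.mDotL b) := by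
  unfold mDotL
  rw [map_mul]
  exact mD_comp (X.mdifferentiable_m a 1) (X.mdifferentiable_m b 1) (map_one (X.m b))

theorem mDotL_inv_apply_apply (a : G) (x : EH) : X.mDotL a⁻¹ (X.mDotL a x) = x := by
  rw [← ContinuousLinearMap.comp_apply, ← mDotL_mul, inv_mul_cancel, mDotL_one]
  rfl

theorem mDotL_eq_fderiv (a : G) : X.mDotL a =
    fderiv ℝ (fun h => chartAt EH (1 : H) (X.m a ((chartAt EH (1 : H)).symm h)))
      (chartOne EH H) := by
  have h1 : MDifferentiableAt 𝓘(ℝ, EH) 𝓘(ℝ, EH) (chartAt EH (1 : H)).symm (chartOne EH H) :=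
    mdifferentiableAt_chartAt_symm (EX := EH) (1 : H) chartOne_mem
  have h2 : MDifferentiableAt 𝓘(ℝ, EH) 𝓘(ℝ, EH) (fun h => X.m a ((chartAt EH (1 : H)).symm h))
      (chartOne EH H) := MDifferentiableAt.comp (chartOne EH H) (X.mdifferentiable_m a _) h1
  have h3 := mdifferentiableAt_chartAt (EX := EH) (1 : H) (mem_chart_source EH 1)
  rw [← mD_eq_fderiv, mD_comp (y := (1 : H)) h3 h2 (by rw [chartAt_symm_chartOne, map_one]),
    mD_chartAt,
    ContinuousLinearMap.id_comp, mD_comp (X.mdifferentiable_m a 1) h1 chartAt_symm_chartOne,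
    show mD EH EH (chartAt EH (1 : H)).symm (chartOne EH H) = _ from mD_chartAt_symm (1 : H),
    ContinuousLinearMap.comp_id]
  rfl

theorem contDiffAt_mDotL {u : E → G} {q : E} (hu : ContMDiffAt 𝓘(ℝ, E) 𝓘(ℝ, EG) ∞ u q) :
    ContDiffAt ℝ ∞ (fun s => X.mDotL (u s)) q := by
  simp only [mDotL_eq_fderiv]
  refine ContDiffAt.fderiv (n := ∞)
    (f := fun s h => chartAt EH (1 : H) (X.m (u s) ((chartAt EH (1 : H)).symm h))) ?_
    contDiffAt_const (by simp)
  rw [← contMDiffAt_iff_contDiffAt]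
  have h1 : ContMDiffAt 𝓘(ℝ, E × EH) 𝓘(ℝ, EG) ∞ (fun z : E × EH => u z.1) (q, chartOne EH H) :=
    hu.comp (f := Prod.fst) (q, chartOne EH H) contDiffAt_fst.contMDiffAt
  have h2 : ContMDiffAt 𝓘(ℝ, E × EH) 𝓘(ℝ, EH) ∞
      (fun z : E × EH => (chartAt EH (1 : H)).symm z.2) (q, chartOne EH H) :=
    (contMDiffAt_chartAt_one_symm _ chartOne_mem).comp (f := Prod.snd) (q, chartOne EH H)
      contDiffAt_snd.contMDiffAt
  refine ContMDiffAt.comp (g := chartAt EH (1 : H)) (q, chartOne EH H)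
    (contMDiffAt_chartAt_one _ ?_) (X.smooth_m.contMDiffAt.comp (q, chartOne EH H)
      (h1.prodMk h2))
  simp only [chartAt_symm_chartOne, map_one]
  exact mem_chart_source EH 1

theorem mdifferentiableAt_mDotL :
    MDifferentiableAt 𝓘(ℝ, EG) 𝓘(ℝ, EH →L[ℝ] EH) X.mDotL 1 := by
  have h1 : ContDiffAt ℝ ∞ (fun s => X.mDotL ((chartAt EG (1 : G)).symm s)) (chartOne EG G) :=
    X.contDiffAt_mDotL (contMDiffAt_chartAt_one_symm _ chartOne_mem)
  have h2 : MDifferentiableAt 𝓘(ℝ, EG) 𝓘(ℝ, EH →L[ℝ] EH)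
      (fun a : G => X.mDotL ((chartAt EG (1 : G)).symm (chartAt EG (1 : G) a))) 1 :=
    MDifferentiableAt.comp (g := fun s => X.mDotL ((chartAt EG (1 : G)).symm s)) (1 : G)
      (h1.differentiableAt (by simp)).mdifferentiableAt
      (mdifferentiableAt_chartAt (EX := EG) (1 : G) (mem_chart_source EG 1))
  refine h2.congr_of_eventuallyEq ?_
  filter_upwards [(chartAt EG (1 : G)).open_source.mem_nhds (mem_chart_source EG 1)] with a ha
  rw [(chartAt EG (1 : G)).left_inv ha]

theorem mHat_eq (x : EG) (y : EH) : X.mHat x y = X.mHatL x y := by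
  have h := mD_comp (g := ContinuousLinearMap.apply ℝ EH y)
    (ContinuousLinearMap.differentiableAt _).mdifferentiableAt X.mdifferentiableAt_mDotL rfl
  rw [mD_eq_fderiv, ContinuousLinearMap.fderiv] at h
  exact congrArg (fun A : EG →L[ℝ] EH => A x) h

/-- Write m(u(s)) = m(u(s) u(q)⁻¹) m(u(q)) and differentiate the first factor at 1. -/
theorem hasFDerivAt_mDotL {u : E → G} {q : E} (hu : MDifferentiableAt 𝓘(ℝ, E) 𝓘(ℝ, EG) u q) :
    HasFDerivAt (fun s => X.mDotL (u s))
      ((((ContinuousLinearMap.compL ℝ EH EH EH).flip (X.mDotL (u q))).comp X.mHatL).comp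
        (rightLog u q)) q := by
  have h1 := mdifferentiableAt_mul_right hu (u q)⁻¹
  have h2 : MDifferentiableAt 𝓘(ℝ, E) 𝓘(ℝ, EH →L[ℝ] EH)
      (fun s => X.mDotL (u s * (u q)⁻¹)) q :=
    MDifferentiableAt.comp q (by rw [mul_inv_cancel]; exact X.mdifferentiableAt_mDotL) h1
  have h3 : HasFDerivAt (fun s => X.mDotL (u s * (u q)⁻¹)) (X.mHatL.comp (rightLog u q)) q := by
    have := mD_comp X.mdifferentiableAt_mDotL h1 (mul_inv_cancel _)
    rw [mD_eq_fderiv] at this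
    have h4 := h2.differentiableAt.hasFDerivAt
    rwa [this] at h4
  have h5 := ((ContinuousLinearMap.compL ℝ EH EH EH).flip (X.mDotL (u q))).hasFDerivAt.comp q h3
  refine h5.congr_of_eventuallyEq (Filter.Eventually.of_forall fun s => ?_)
  change X.mDotL (u s) = (X.mDotL (u s * (u q)⁻¹)).comp (X.mDotL (u q))
  rw [← mDotL_mul, inv_mul_cancel_right]

/-- Obtained by differentiating ṁ(u) ṁ(u⁻¹) = 1. -/
theorem hasFDerivAt_mDotL_inv {u : E → G} {q : E}
    (hu : MDifferentiableAt 𝓘(ℝ, E) 𝓘(ℝ, EG) u q) :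
    HasFDerivAt (fun s => X.mDotL (u s)⁻¹)
      (-(((ContinuousLinearMap.compL ℝ EH EH EH) (X.mDotL (u q)⁻¹)).comp X.mHatL).comp
        (rightLog u q)) q := by
  have h1 : MDifferentiableAt 𝓘(ℝ, E) 𝓘(ℝ, EG) (fun s => (u s)⁻¹) q :=
    MDifferentiableAt.comp q ((contMDiff_inv 𝓘(ℝ, EG) ∞).mdifferentiableAt (by simp)) hu
  have h2 := X.hasFDerivAt_mDotL h1
  have h3 := X.hasFDerivAt_mDotL hu
  have h4 := h3.clm_comp h2
  have h5 := h4.unique ((hasFDerivAt_const (ContinuousLinearMap.id ℝ EH) q).congr_of_eventuallyEq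
    (Filter.Eventually.of_forall fun s => by
      change (X.mDotL (u s)).comp (X.mDotL (u s)⁻¹) = _
      rw [← mDotL_mul, mul_inv_cancel, mDotL_one]))
  refine h2.congr_fderiv ?_
  ext v x
  have h6 := congrArg (fun A : E →L[ℝ] EH →L[ℝ] EH => X.mDotL (u q)⁻¹ (A v x)) h5
  simp only [add_apply, ContinuousLinearMap.comp_apply,
    ContinuousLinearMap.compL_apply, ContinuousLinearMap.flip_apply, map_add,
    mDotL_inv_apply_apply, zero_apply, map_zero] at h6
  have h7 : X.mDotL (u q) (X.mDotL (u q)⁻¹ x) = x := by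
    simpa using X.mDotL_inv_apply_apply (u q)⁻¹ x
  rw [h7] at h6
  simpa [add_eq_zero_iff_eq_neg] using h6

/-- The covariant derivative in a gauge: where the logarithmic derivative of `u` along `v` is -a,
the bracket on the right becomes the derivative of `ξ` plus the action of a on `ξ`. -/
theorem fderiv_mDotL_inv_apply {u : E → G} {ξ : E → EH} {q : E}
    (hu : MDifferentiableAt 𝓘(ℝ, E) 𝓘(ℝ, EG) u q) (hξ : DifferentiableAt ℝ ξ q) (v : E) :
    fderiv ℝ (fun s => X.mDotL (u s)⁻¹ (ξ s)) q v =
      X.mDotL (u q)⁻¹ (fderiv ℝ ξ q v - X.mHatL (rightLog u q v) (ξ q)) := by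
  rw [((X.hasFDerivAt_mDotL_inv hu).clm_apply hξ.hasFDerivAt).fderiv]
  simp [sub_eq_add_neg, add_comm]

end LieCrossedModule

/-! ### The adjoint action -/

variable (EG G) in
/-- The Lie group `G` acting on itself by conjugation. -/
def conjModule : LieCrossedModule EG G EG G where
  t := MonoidHom.id G
  m := MulAut.conj
  smooth_t := contMDiff_id
  smooth_m := (contMDiff_fst.mul contMDiff_snd).mul contMDiff_fst.inv
  equivariant _ _ := rfl
  peiffer _ _ := rfl

variable (EG) in
/-- The adjoint action. -/
def adjointL (a : G) : EG →L[ℝ] EG := (conjModule EG G).mDotL a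

/-- Differentiate gs = (gsg⁻¹)g. -/
theorem chartL_eq_comp_adjointL {a : EG} (ha : a ∈ (chartAt EG (1 : G)).target) :
    chartL G a = (chartR G a).comp (adjointL EG ((chartAt EG (1 : G)).symm a)) := by
  let g := (chartAt EG (1 : G)).symm a
  have hc : ContMDiffAt 𝓘(ℝ, EG) 𝓘(ℝ, EG) ∞
      (fun s => MulAut.conj g ((chartAt EG (1 : G)).symm s)) (chartOne EG G) :=
    ((conjModule EG G).contMDiff_m g).contMDiffAt.comp (chartOne EG G)
      (contMDiffAt_chartAt_one_symm _ chartOne_mem)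
  have hc1 : MulAut.conj g ((chartAt EG (1 : G)).symm (chartOne EG G)) = 1 := by
    rw [chartAt_symm_chartOne, map_one]
  have hsrc : MulAut.conj g ((chartAt EG (1 : G)).symm (chartOne EG G)) ∈
      (chartAt EG (1 : G)).source := by rw [hc1]; exact mem_chart_source EG 1
  have hd : DifferentiableAt ℝ (fun s => chartAt EG (1 : G)
      (MulAut.conj g ((chartAt EG (1 : G)).symm s))) (chartOne EG G) := by
    have : ContMDiffAt 𝓘(ℝ, EG) 𝓘(ℝ, EG) ∞ (fun s => chartAt EG (1 : G)
      (MulAut.conj g ((chartAt EG (1 : G)).symm s))) (chartOne EG G) :=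
      (contMDiffAt_chartAt_one _ hsrc).comp (chartOne EG G) hc
    exact (contMDiffAt_iff_contDiffAt.1 this).differentiableAt (by simp)
  have h0 : chartAt EG (1 : G) (MulAut.conj g ((chartAt EG (1 : G)).symm (chartOne EG G))) =
      chartOne EG G := by rw [hc1]; rfl
  have hR : DifferentiableAt ℝ (fun s => chartMul G (s, a)) (chartOne EG G) :=
    ((contDiffAt_chartMul_right ha).differentiableAt (by simp)).comp
      (f := fun s => (s, a)) (chartOne EG G) (by fun_prop)
  rw [← h0] at hR
  have h1 := fderiv_comp (chartOne EG G) hR hd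
  rw [h0] at h1
  unfold adjointL
  rw [LieCrossedModule.mDotL_eq_fderiv]
  refine Eq.trans ?_ h1
  refine Filter.EventuallyEq.fderiv_eq ?_
  filter_upwards [hc.continuousAt ((chartAt EG (1 : G)).open_source.mem_nhds hsrc)] with s hs
  simp only [Function.comp_apply, chartMul]
  rw [(chartAt EG (1 : G)).left_inv hs]
  change _ = chartAt EG (1 : G) (g * (chartAt EG (1 : G)).symm s * g⁻¹ * g)
  rw [inv_mul_cancel_right]

/-- Differentiating L = R ∘ Ad at 1 gives dL(x)y = dR(x)y + dAd(x)y, and dR(x)y = dL(y)x; hence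
dAd(x)y = [x, y]. -/
theorem mHatL_conjModule : (conjModule EG G).mHatL = chartBracket G := by
  have h1 : HasFDerivAt (fun a => adjointL EG ((chartAt EG (1 : G)).symm a))
      (conjModule EG G).mHatL (chartOne EG G) := by
    have hs := mdifferentiableAt_chartAt_symm (EX := EG) (1 : G) (chartOne_mem (EG := EG))
    have h2 := mD_comp (conjModule EG G).mdifferentiableAt_mDotL hs chartAt_symm_chartOne
    have h3 : DifferentiableAt ℝ (fun a => adjointL EG ((chartAt EG (1 : G)).symm a))
        (chartOne EG G) :=
      ((conjModule EG G).contDiffAt_mDotL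
        (contMDiffAt_chartAt_one_symm _ chartOne_mem)).differentiableAt (by simp)
    rw [show mD EG EG (chartAt EG (1 : G)).symm (chartOne EG G) = _ from mD_chartAt_symm (1 : G),
      ContinuousLinearMap.comp_id, mD_eq_fderiv] at h2
    have h4 := h3.hasFDerivAt
    exact h4.congr_fderiv h2
  have hR := ((contDiffAt_chartR (chartOne_mem (EG := EG) (G := G))).differentiableAt
    (by simp)).hasFDerivAt
  have hL := ((contDiffAt_chartL (chartOne_mem (EG := EG) (G := G))).differentiableAt
    (by simp)).hasFDerivAt
  have h2 := (hR.clm_comp h1).congr_of_eventuallyEq (f₁ := chartL G) (by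
    filter_upwards [(chartAt EG (1 : G)).open_target.mem_nhds chartOne_mem] with a ha
      using chartL_eq_comp_adjointL ha)
  have h3 := hL.unique h2
  ext x y
  have h4 := congrArg (fun A : EG →L[ℝ] EG →L[ℝ] EG => A x y) h3
  have h5 : adjointL EG (1 : G) = ContinuousLinearMap.id ℝ EG :=
    (conjModule EG G).mDotL_one
  rw [chartR_chartOne, chartAt_symm_chartOne, h5] at h4
  rw [chartBracket_apply, h4, ← fderiv_chartR_eq_fderiv_chartL]
  simp

theorem fderiv_adjointL_inv_apply {u : E → G} {ξ : E → EG} {q : E}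
    (hu : MDifferentiableAt 𝓘(ℝ, E) 𝓘(ℝ, EG) u q) (hξ : DifferentiableAt ℝ ξ q) (v : E) :
    fderiv ℝ (fun s => adjointL EG (u s)⁻¹ (ξ s)) q v =
      adjointL EG (u q)⁻¹ (fderiv ℝ ξ q v - chartBracket G (rightLog u q v) (ξ q)) := by
  rw [← mHatL_conjModule]
  exact (conjModule EG G).fderiv_mDotL_inv_apply hu hξ v

namespace LieCrossedModule

variable (X : LieCrossedModule EG G EH H)

/-- The derivative at b = 1 of m(aba⁻¹) = m(a) m(b) m(a)⁻¹. -/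
theorem mHatL_adjointL (a : G) (x : EG) (y : EH) :
    X.mHatL (adjointL EG a x) (X.mDotL a y) = X.mDotL a (X.mHatL x y) := by
  have h1 : MDifferentiableAt 𝓘(ℝ, EG) 𝓘(ℝ, EG) (MulAut.conj a) (1 : G) :=
    (conjModule EG G).mdifferentiable_m a 1
  have h2 := mD_comp X.mdifferentiableAt_mDotL h1 (map_one _)
  have h3 : (fun b => X.mDotL (MulAut.conj a b)) = fun b =>
      ((ContinuousLinearMap.compL ℝ EH EH EH (X.mDotL a)).comp
        ((ContinuousLinearMap.compL ℝ EH EH EH).flip (X.mDotL a⁻¹))) (X.mDotL b) := by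
    ext1 b
    rw [MulAut.conj_apply, mDotL_mul, mDotL_mul]
    rfl
  have h4 := mD_comp (g := ((ContinuousLinearMap.compL ℝ EH EH EH (X.mDotL a)).comp
        ((ContinuousLinearMap.compL ℝ EH EH EH).flip (X.mDotL a⁻¹))))
    (ContinuousLinearMap.differentiableAt _).mdifferentiableAt X.mdifferentiableAt_mDotL rfl
  rw [mD_eq_fderiv, ContinuousLinearMap.fderiv, ← h3, h2] at h4
  have h5 := congrArg (fun A : EG →L[ℝ] EH →L[ℝ] EH => A x (X.mDotL a y)) h4
  change X.mHatL (adjointL EG a x) (X.mDotL a y) =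
    X.mDotL a (X.mHatL x (X.mDotL a⁻¹ (X.mDotL a y))) at h5
  rwa [mDotL_inv_apply_apply] at h5

theorem tDotL_mDotL (a : G) (x : EH) : X.tDotL (X.mDotL a x) = adjointL EG a (X.tDotL x) := by
  have ht : ∀ A, MDifferentiableAt 𝓘(ℝ, EH) 𝓘(ℝ, EG) X.t A :=
    fun A => X.smooth_t.mdifferentiable (by simp) A
  have h1 := mD_comp (ht 1) (X.mdifferentiable_m a 1) (map_one _)
  have h2 := mD_comp ((conjModule EG G).mdifferentiable_m a 1) (ht 1) (map_one _)
  have h3 : (fun s => (conjModule EG G).m a (X.t s)) = fun s => X.t (X.m a s) := by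
    ext1 A
    exact (X.equivariant a A).symm
  rw [h3, h1] at h2
  exact congrArg (fun A : EH →L[ℝ] EG => A x) h2

/-- Infinitesimal Peiffer identity: m ∘ t is conjugation in `H`, whose derived action is the bracket
of 𝔥. -/
theorem mHatL_tDotL (x : EH) : X.mHatL (X.tDotL x) = chartBracket H x := by
  have ht : MDifferentiableAt 𝓘(ℝ, EH) 𝓘(ℝ, EG) X.t 1 :=
    X.smooth_t.mdifferentiable (by simp) 1
  have h1 := mD_comp X.mdifferentiableAt_mDotL ht (map_one _)
  have h2 : (fun A => X.mDotL (X.t A)) = (conjModule EH H).mDotL := by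
    ext1 A
    have : X.m (X.t A) = MulAut.conj A := by
      ext B
      exact X.peiffer A B
    unfold mDotL
    rw [this]
    rfl
  rw [h2] at h1
  rw [← mHatL_conjModule]
  exact congrArg (fun A : EH →L[ℝ] EH →L[ℝ] EH => A x) h1.symm

end LieCrossedModule

end CrossedModule

/-! ### Pull-backs of differential forms -/

section PullbackForms

variable {EM : Type*} [NormedAddCommGroup EM] [NormedSpace ℝ EM]
  {M : Type*} [TopologicalSpace M] [ChartedSpace EM M] [IsManifold 𝓘(ℝ, EM) ∞ M]
  {V : Type*} [NormedAddCommGroup V] [NormedSpace ℝ V]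
  {F : Type*} [NormedAddCommGroup F] [NormedSpace ℝ F] {k : ℕ}

theorem pullback_apply (η : ∀ p : M, TangentSpace 𝓘(ℝ, EM) p [⋀^Fin k]→L[ℝ] V) (Φ : F → M)
    (q : F) (v : Fin k → F) :
    pullback η Φ q v = η (Φ q) (fun i => mD F EM Φ q (v i)) := rfl

theorem fderiv_chartAt_comp {Φ : F → M} {p : M} {q : F}
    (hΦ : MDifferentiableAt 𝓘(ℝ, F) 𝓘(ℝ, EM) Φ q) (hq : Φ q ∈ (chartAt EM p).source) :
    fderiv ℝ (fun s => chartAt EM p (Φ s)) q =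
      (mD EM EM (chartAt EM p) (Φ q)).comp (mD F EM Φ q) := by
  rw [← mD_eq_fderiv]
  exact mD_comp (mdifferentiableAt_chartAt (EX := EM) p hq) hΦ rfl

/-- Near `q`, `Φ` factors through the chart, so the chain rule splits its differential; the fixed
chart replaces the varying tangent spaces by one model space. -/
theorem pullback_eq_localRep (η : ∀ p : M, TangentSpace 𝓘(ℝ, EM) p [⋀^Fin k]→L[ℝ] V)
    {Φ : F → M} {p : M} {q : F} (hΦ : MDifferentiableAt 𝓘(ℝ, F) 𝓘(ℝ, EM) Φ q)
    (hq : Φ q ∈ (chartAt EM p).source) :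
    pullback η Φ q = (localRep η p (chartAt EM p (Φ q))).compContinuousLinearMap
      (fderiv ℝ (fun s => chartAt EM p (Φ s)) q) := by
  have ha := (chartAt EM p).map_source hq
  have hs := mdifferentiableAt_chartAt_symm (EX := EM) p ha
  have hc : MDifferentiableAt 𝓘(ℝ, F) 𝓘(ℝ, EM) (fun s => chartAt EM p (Φ s)) q :=
    (mdifferentiableAt_chartAt (EX := EM) p hq).comp q hΦ
  have h1 := mD_comp hs hc rfl
  have h2 : mD F EM (fun s => (chartAt EM p).symm (chartAt EM p (Φ s))) q = mD F EM Φ q := by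
    refine mD_congr ?_
    filter_upwards [hΦ.continuousAt ((chartAt EM p).open_source.mem_nhds hq)] with s hs
    exact (chartAt EM p).left_inv hs
  rw [h2, mD_eq_fderiv] at h1
  ext v
  -- The type of `η p` depends on `p`, so the equality of base points is used through a general
  -- `p'`.
  have h3 : ∀ p' : M, p' = Φ q → ∀ w : Fin k → EM, (η p' w : V) = η (Φ q) w := by
    rintro p' rfl w; rfl
  change η (Φ q) (fun i => mD F EM Φ q (v i)) = η ((chartAt EM p).symm (chartAt EM p (Φ q)))
    (fun i => mD EM EM (chartAt EM p).symm (chartAt EM p (Φ q))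
      (fderiv ℝ (fun s => chartAt EM p (Φ s)) q (v i)))
  rw [h3 _ ((chartAt EM p).left_inv hq), h1]
  rfl

theorem contDiffAt_chartAt_comp {Φ : F → M} {p : M} {q : F}
    (hΦ : ContMDiffAt 𝓘(ℝ, F) 𝓘(ℝ, EM) ∞ Φ q) (hq : Φ q ∈ (chartAt EM p).source) :
    ContDiffAt ℝ ∞ (fun s => chartAt EM p (Φ s)) q := by
  rw [← contMDiffAt_iff_contDiffAt]
  exact (contMDiffAt_of_mem_maximalAtlas (n := ∞) (IsManifold.chart_mem_maximalAtlas p) hq).comp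
    q hΦ

theorem pullback_eventuallyEq (η : DiffForm EM M V k) {Φ : F → M}
    (hΦ : ContMDiff 𝓘(ℝ, F) 𝓘(ℝ, EM) ∞ Φ) (q₀ : F) :
    pullback η.toFun Φ =ᶠ[𝓝 q₀] fun q =>
      (localRep η.toFun (Φ q₀) (chartAt EM (Φ q₀) (Φ q))).compContinuousLinearMap
        (fderiv ℝ (fun s => chartAt EM (Φ q₀) (Φ s)) q) := by
  filter_upwards [hΦ.continuous.continuousAt ((chartAt EM (Φ q₀)).open_source.mem_nhds
    (mem_chart_source EM (Φ q₀)))] with q hq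
  exact pullback_eq_localRep _ (hΦ.mdifferentiable (by simp) q) hq

theorem contDiffAt_localRep (η : DiffForm EM M V k) (p : M) :
    ContDiffAt ℝ ∞ (localRep η.toFun p) (chartAt EM p p) :=
  (η.smooth p).contDiffAt ((chartAt EM p).open_target.mem_nhds (mem_chart_target EM p))

theorem differentiableAt_pullback (η : DiffForm EM M V k) {Φ : F → M}
    (hΦ : ContMDiff 𝓘(ℝ, F) 𝓘(ℝ, EM) ∞ Φ) (q : F) :
    DifferentiableAt ℝ (pullback η.toFun Φ) q := by
  have hψ := contDiffAt_chartAt_comp hΦ.contMDiffAt (mem_chart_source EM (Φ q))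
  refine DifferentiableAt.congr_of_eventuallyEq ?_ (pullback_eventuallyEq η hΦ q)
  refine DifferentiableAt.continuousAlternatingMapCompContinuousLinearMap ?_ ?_
  · exact DifferentiableAt.comp (g := localRep η.toFun (Φ q)) q
      ((contDiffAt_localRep η (Φ q)).differentiableAt (by simp)) (hψ.differentiableAt (by simp))
  · exact (hψ.fderiv_right (m := ∞) (by simp)).differentiableAt (by simp)

theorem contDiff_pullback_apply (η : DiffForm EM M V k) {Φ : F → M}
    (hΦ : ContMDiff 𝓘(ℝ, F) 𝓘(ℝ, EM) ∞ Φ) (v : Fin k → F) :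
    ContDiff ℝ ∞ (fun q => pullback η.toFun Φ q v) := by
  rw [contDiff_iff_contDiffAt]
  intro q₀
  have hψ := contDiffAt_chartAt_comp hΦ.contMDiffAt (mem_chart_source EM (Φ q₀))
  have h1 : ContDiffAt ℝ ∞ (fun q => localRep η.toFun (Φ q₀) (chartAt EM (Φ q₀) (Φ q))) q₀ :=
    ContDiffAt.comp (g := localRep η.toFun (Φ q₀)) q₀ (contDiffAt_localRep η (Φ q₀)) hψ
  have h2 : ContDiffAt ℝ ∞
      (fun q => fun i => fderiv ℝ (fun s => chartAt EM (Φ q₀) (Φ s)) q (v i)) q₀ :=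
    contDiffAt_pi.2 fun i => (hψ.fderiv_right (m := ∞) (by simp)).clm_apply contDiffAt_const
  -- Evaluation is linear in the form and multilinear in the vectors, hence smooth in both together.
  have h3 : ContDiff ℝ ∞ fun z : (EM [⋀^Fin k]→L[ℝ] V) × (Fin k → EM) => z.1 z.2 :=
    ((ContinuousAlternatingMap.toContinuousMultilinearMapCLM ℝ :
      (EM [⋀^Fin k]→L[ℝ] V) →L[ℝ] _).analyticOnNhd_uncurry_of_multilinear (s := univ)).contDiff
  refine (h3.contDiffAt.comp q₀ (h1.prodMk h2)).congr_of_eventuallyEq ?_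
  filter_upwards [pullback_eventuallyEq η hΦ q₀] with q hq
  rw [hq]
  rfl

/-- In the preferred chart at `Φ q`, the one that defines `DiffForm.d` there, this is naturality of
the exterior derivative between normed spaces. -/
theorem extDeriv_pullback_apply (η : DiffForm EM M V k) {Φ : F → M}
    (hΦ : ContMDiff 𝓘(ℝ, F) 𝓘(ℝ, EM) ∞ Φ) (q : F) (v : Fin (k + 1) → F) :
    extDeriv (pullback η.toFun Φ) q v = η.d (Φ q) (fun i => mD F EM Φ q (v i)) := by
  have hψ := contDiffAt_chartAt_comp hΦ.contMDiffAt (mem_chart_source EM (Φ q))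
  have hr : DifferentiableAt ℝ (localRep η.toFun (Φ q)) (chartAt EM (Φ q) (Φ q)) :=
    (contDiffAt_localRep η (Φ q)).differentiableAt (by simp)
  rw [(pullback_eventuallyEq η hΦ q).extDeriv_eq,
    extDeriv_pullback (f := fun s => chartAt EM (Φ q) (Φ s)) hr hψ minSmoothness_two_le_infty,
    fderiv_chartAt_comp (hΦ.mdifferentiable (by simp) q) (mem_chart_source EM (Φ q))]
  rfl

theorem extDeriv_one_apply {a : F → F [⋀^Fin 1]→L[ℝ] V} {q : F} (ha : DifferentiableAt ℝ a q)
    (v w : F) : extDeriv a q ![v, w] =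
      fderiv ℝ (fun s => a s ![w]) q v - fderiv ℝ (fun s => a s ![v]) q w := by
  rw [extDeriv_apply ha, Fin.sum_univ_two]
  have h0 : Fin.removeNth 0 ![v, w] = ![w] := by ext i; fin_cases i; rfl
  have h1 : Fin.removeNth 1 ![v, w] = ![v] := by ext i; fin_cases i; rfl
  rw [h0, h1]
  simp [sub_eq_add_neg]

theorem extDeriv_two_apply {B : F → F [⋀^Fin 2]→L[ℝ] V} {q : F} (hB : DifferentiableAt ℝ B q)
    (u v w : F) : extDeriv B q ![u, v, w] =
      fderiv ℝ (fun s => B s ![v, w]) q u - fderiv ℝ (fun s => B s ![u, w]) q v +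
        fderiv ℝ (fun s => B s ![u, v]) q w := by
  rw [extDeriv_apply hB, Fin.sum_univ_three]
  have h0 : Fin.removeNth 0 ![u, v, w] = ![v, w] := by ext i; fin_cases i <;> rfl
  have h1 : Fin.removeNth 1 ![u, v, w] = ![u, w] := by ext i; fin_cases i <;> rfl
  have h2 : Fin.removeNth 2 ![u, v, w] = ![u, v] := by ext i; fin_cases i <;> rfl
  rw [h0, h1, h2]
  simp [sub_eq_add_neg]

theorem pullback_comp_apply (η : ∀ p : M, TangentSpace 𝓘(ℝ, EM) p [⋀^Fin k]→L[ℝ] V)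
    {F' : Type*} [NormedAddCommGroup F'] [NormedSpace ℝ F'] {Φ : F → M} {f : F' → F} {q : F'}
    (hΦ : MDifferentiableAt 𝓘(ℝ, F) 𝓘(ℝ, EM) Φ (f q)) (hf : DifferentiableAt ℝ f q)
    (v : Fin k → F') :
    pullback η (fun s => Φ (f s)) q v = pullback η Φ (f q) (fun i => fderiv ℝ f q (v i)) := by
  rw [pullback_apply, pullback_apply, mD_comp hΦ hf.mdifferentiableAt rfl, mD_eq_fderiv]
  rfl

end PullbackForms

/-! ### Linearly dependent vectors -/

section Dependent

theorem not_linearIndependent_of_rank_lt {E E' : Type*} [AddCommGroup E] [Module ℝ E]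
    [AddCommGroup E'] [Module ℝ E'] (f : E →ₗ[ℝ] E') {n : ℕ} (hf : f.rank < n) (v : Fin n → E) :
    ¬ LinearIndependent ℝ fun i => f (v i) := by
  intro h
  have h1 : LinearIndependent ℝ fun i => f.rangeRestrict (v i) :=
    LinearIndependent.of_comp (LinearMap.range f).subtype h
  have h2 := h1.cardinal_lift_le_rank
  simp only [Cardinal.mk_fin, Cardinal.lift_natCast, Cardinal.nat_le_lift_iff] at h2
  exact absurd hf (not_lt.2 h2)

variable {U A B : Type*} [AddCommGroup U] [Module ℝ U] [AddCommGroup A] [Module ℝ A]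
  [AddCommGroup B] [Module ℝ B]

/-- The expression is the wedge product of `t` and `b`, an alternating trilinear form. One of the
vectors is a combination of the other two, and substituting it cancels everything. -/
theorem wedge_eq_zero_of_not_linearIndependent (t : U →ₗ[ℝ] A) (b : U →ₗ[ℝ] U →ₗ[ℝ] B)
    (hb : ∀ v, b v v = 0) (m : A →ₗ[ℝ] B →ₗ[ℝ] B) {x : Fin 3 → U}
    (hx : ¬ LinearIndependent ℝ x) :
    m (t (x 0)) (b (x 1) (x 2)) - m (t (x 1)) (b (x 0) (x 2)) + m (t (x 2)) (b (x 0) (x 1)) = 0 := by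
  have hsymm : ∀ v w, b v w = - b w v := by
    intro v w
    have := hb (v + w)
    simp only [map_add, LinearMap.add_apply, hb, zero_add, add_zero] at this
    exact eq_neg_of_add_eq_zero_right this
  obtain ⟨g, hg, i, hi⟩ := Fintype.not_linearIndependent_iff.1 hx
  rw [Fin.sum_univ_three] at hg
  have hsolve : ∀ {c₁ c₂ c₃ : ℝ} {v₁ v₂ v₃ : U}, c₁ ≠ 0 → c₁ • v₁ + c₂ • v₂ + c₃ • v₃ = 0 →
      ∃ α β : ℝ, v₁ = α • v₂ + β • v₃ := by
    intro c₁ c₂ c₃ v₁ v₂ v₃ hc h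
    refine ⟨-(c₁⁻¹ * c₂), -(c₁⁻¹ * c₃), ?_⟩
    have h1 := congrArg (fun z => c₁⁻¹ • z) h
    simp only [smul_add, smul_smul, inv_mul_cancel₀ hc, one_smul, smul_zero] at h1
    rw [neg_smul, neg_smul, ← sub_eq_zero, ← h1]
    abel
  have hcases : (∃ α β : ℝ, x 0 = α • x 1 + β • x 2) ∨ (∃ α β : ℝ, x 1 = α • x 0 + β • x 2) ∨
      ∃ α β : ℝ, x 2 = α • x 0 + β • x 1 := by
    fin_cases i
    · exact Or.inl (hsolve hi hg)
    · exact Or.inr (Or.inl (hsolve (c₂ := g 0) (c₃ := g 2) hi (by rw [← hg]; simp; abel)))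
    · exact Or.inr (Or.inr (hsolve (c₂ := g 0) (c₃ := g 1) hi (by rw [← hg]; simp; abel)))
  generalize x 0 = u, x 1 = v, x 2 = w at hcases
  rcases hcases with ⟨α, β, rfl⟩ | ⟨α, β, rfl⟩ | ⟨α, β, rfl⟩
  · simp only [map_add, map_smul, LinearMap.add_apply, LinearMap.smul_apply, hb, smul_zero,
      add_zero, zero_add, hsymm w v, map_neg, smul_neg]
    module
  · simp only [map_add, map_smul, LinearMap.add_apply, LinearMap.smul_apply, hb, smul_zero,
      add_zero, zero_add]
    module
  · simp only [map_add, map_smul, LinearMap.add_apply, LinearMap.smul_apply, hb, smul_zero,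
      add_zero, zero_add, hsymm v u, map_neg, smul_neg]
    module

end Dependent

/-! ### Pull-backs of connection doublets -/

section PullbackDoublet

variable {EG : Type*} [NormedAddCommGroup EG] [NormedSpace ℝ EG]
  {G : Type*} [TopologicalSpace G] [ChartedSpace EG G] [Group G] [LieGroup 𝓘(ℝ, EG) ∞ G]
  {EH : Type*} [NormedAddCommGroup EH] [NormedSpace ℝ EH]
  {H : Type*} [TopologicalSpace H] [ChartedSpace EH H] [Group H] [LieGroup 𝓘(ℝ, EH) ∞ H]
  {EM : Type*} [NormedAddCommGroup EM] [NormedSpace ℝ EM]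
  {M : Type*} [TopologicalSpace M] [ChartedSpace EM M] [IsManifold 𝓘(ℝ, EM) ∞ M]
  {F : Type*} [NormedAddCommGroup F] [NormedSpace ℝ F]
  {X : LieCrossedModule EG G EH H} (D : ConnDoublet EM M X) {Φ : F → M}

theorem vec_map_one {A B : Type*} (f : A → B) (v : A) : (fun i => f (![v] i)) = ![f v] := by
  ext1 i; fin_cases i; rfl

theorem vec_map_two {A B : Type*} (f : A → B) (v w : A) :
    (fun i => f (![v, w] i)) = ![f v, f w] := by
  ext1 i; fin_cases i <;> rfl

theorem vec_map_three {A B : Type*} (f : A → B) (u v w : A) :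
    (fun i => f (![u, v, w] i)) = ![f u, f v, f w] := by
  ext1 i; fin_cases i <;> rfl

theorem ConnDoublet.fakeFlat_pullback (hΦ : ContMDiff 𝓘(ℝ, F) 𝓘(ℝ, EM) ∞ Φ) (q v w : F) :
    fderiv ℝ (fun s => pullback D.θ.toFun Φ s ![w]) q v -
      fderiv ℝ (fun s => pullback D.θ.toFun Φ s ![v]) q w +
      chartBracket G (pullback D.θ.toFun Φ q ![v]) (pullback D.θ.toFun Φ q ![w]) =
      X.tDotL (pullback D.Υ.toFun Φ q ![v, w]) := by
  rw [← extDeriv_one_apply (differentiableAt_pullback D.θ hΦ q), extDeriv_pullback_apply D.θ hΦ]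
  simp only [pullback_apply, vec_map_one, vec_map_two]
  rw [← lieBr_eq_chartBracket]
  exact sub_eq_zero.1 (D.fakeFlat (Φ q) (mD F EM Φ q v) (mD F EM Φ q w))

/-- The contraction of the curvature 3-form vanishes on `u, v, w`. -/
def ConnDoublet.CurvatureVanishes (p : M) (u v w : EM) : Prop :=
    D.Υ.d p ![u, v, w]
      + (X.mHatL (D.θ.toFun p ![u]) (D.Υ.toFun p ![v, w])
        - X.mHatL (D.θ.toFun p ![v]) (D.Υ.toFun p ![u, w])
        + X.mHatL (D.θ.toFun p ![w]) (D.Υ.toFun p ![u, v])) = 0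

theorem ConnDoublet.IsFlat.curvatureVanishes {D : ConnDoublet EM M X} (h : D.IsFlat) (p : M)
    (u v w : EM) : D.CurvatureVanishes p u v w := by
  have h1 := h p u v w
  simp only [X.mHat_eq] at h1
  exact h1

/-- This is where thinness replaces flatness: dΥ and [θ, Υ] are 3-forms, so each vanishes separately
on dependent vectors. -/
theorem ConnDoublet.curvatureVanishes_of_not_linearIndependent (p : M) (u v w : EM)
    (h : ¬ LinearIndependent ℝ ![u, v, w]) : D.CurvatureVanishes p u v w := by
  let θ : EM [⋀^Fin 1]→L[ℝ] EG := D.θ.toFun p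
  let Υ : EM [⋀^Fin 2]→L[ℝ] EH := D.Υ.toFun p
  let dΥ : EM [⋀^Fin 3]→L[ℝ] EH := D.Υ.d p
  let t : EM →ₗ[ℝ] EG :=
    { toFun := fun v => θ.toAlternatingMap.curryLeft v ![]
      map_add' := fun v w => by simp only [map_add, AlternatingMap.add_apply]
      map_smul' := fun c v => by
        simp only [map_smul, AlternatingMap.smul_apply, RingHom.id_apply] }
  let b : EM →ₗ[ℝ] EM →ₗ[ℝ] EH := LinearMap.mk₂ ℝ
    (fun v w => (Υ.toAlternatingMap.curryLeft v).curryLeft w ![])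
    (fun v v' w => by
      simp only [map_add, AlternatingMap.curryLeft_add, AlternatingMap.add_apply,
        LinearMap.add_apply])
    (fun c v w => by
      simp only [map_smul, AlternatingMap.curryLeft_smul, AlternatingMap.smul_apply,
        LinearMap.smul_apply])
    (fun v w w' => by simp only [map_add, AlternatingMap.add_apply])
    (fun c v w => by simp only [map_smul, AlternatingMap.smul_apply])
  have ht : ∀ v, t v = θ ![v] := fun v => rfl
  have hb : ∀ v w, b v w = Υ ![v, w] := fun v w => rfl
  have hbb : ∀ v, b v v = 0 := fun v =>
    Υ.map_eq_zero_of_eq ![v, v] (i := 0) (j := 1) rfl (by simp)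
  have h1 := wedge_eq_zero_of_not_linearIndependent t b hbb
    ((ContinuousLinearMap.coeLM ℝ).comp (X.mHatL : EG →ₗ[ℝ] EH →L[ℝ] EH)) h
  have h2 : dΥ ![u, v, w] = 0 := dΥ.toAlternatingMap.map_linearDependent _ h
  have h3 : dΥ ![u, v, w] + (X.mHatL (θ ![u]) (Υ ![v, w]) - X.mHatL (θ ![v]) (Υ ![u, w])
      + X.mHatL (θ ![w]) (Υ ![u, v])) = 0 := by
    rw [h2, zero_add]
    exact h1
  exact h3

theorem ConnDoublet.curvature_pullback (hΦ : ContMDiff 𝓘(ℝ, F) 𝓘(ℝ, EM) ∞ Φ) (q u v w : F)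
    (h : D.CurvatureVanishes (Φ q) (mD F EM Φ q u) (mD F EM Φ q v) (mD F EM Φ q w)) :
    fderiv ℝ (fun s => pullback D.Υ.toFun Φ s ![v, w]) q u -
      fderiv ℝ (fun s => pullback D.Υ.toFun Φ s ![u, w]) q v +
      fderiv ℝ (fun s => pullback D.Υ.toFun Φ s ![u, v]) q w +
      (X.mHatL (pullback D.θ.toFun Φ q ![u]) (pullback D.Υ.toFun Φ q ![v, w]) -
        X.mHatL (pullback D.θ.toFun Φ q ![v]) (pullback D.Υ.toFun Φ q ![u, w]) +
        X.mHatL (pullback D.θ.toFun Φ q ![w]) (pullback D.Υ.toFun Φ q ![u, v])) = 0 := by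
  rw [← extDeriv_two_apply (differentiableAt_pullback D.Υ hΦ q), extDeriv_pullback_apply D.Υ hΦ]
  simp only [pullback_apply, vec_map_one, vec_map_two, vec_map_three]
  exact h

theorem pullback_two_eq_zero (η : ∀ p : M, TangentSpace 𝓘(ℝ, EM) p [⋀^Fin 2]→L[ℝ] EH) {q : F}
    (v w : F) (h : ¬ LinearIndependent ℝ fun i => mD F EM Φ q (![v, w] i)) :
    pullback η Φ q ![v, w] = 0 :=
  (η (Φ q)).toAlternatingMap.map_linearDependent _ h

end PullbackDoublet

/-! ### Calculus on the cube -/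

section Lines

variable {V : Type*} [NormedAddCommGroup V] [NormedSpace ℝ V]
  {E : Type*} [NormedAddCommGroup E] [NormedSpace ℝ E]

/-- The first coordinate vector of `ℝ³`. -/
def e₁ : ℝ × ℝ × ℝ := (1, 0, 0)

/-- The second coordinate vector of `ℝ³`. -/
def e₂ : ℝ × ℝ × ℝ := (0, 1, 0)

/-- The third coordinate vector of `ℝ³`. -/
def e₃ : ℝ × ℝ × ℝ := (0, 0, 1)

theorem hasDerivAt_line₁ (x y z : ℝ) : HasDerivAt (fun s : ℝ => (s, y, z)) e₁ x :=
  (hasDerivAt_id x).prodMk (hasDerivAt_const x (y, z))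

theorem hasDerivAt_line₂ (x y z : ℝ) : HasDerivAt (fun s : ℝ => (x, s, z)) e₂ y :=
  (hasDerivAt_const y x).prodMk ((hasDerivAt_id y).prodMk (hasDerivAt_const y z))

theorem hasDerivAt_line₃ (x y z : ℝ) : HasDerivAt (fun s : ℝ => (x, y, s)) e₃ z :=
  (hasDerivAt_const z x).prodMk ((hasDerivAt_const z y).prodMk (hasDerivAt_id z))

theorem fderiv_eq_of_hasDerivAt_comp {φ : E → V} {c : ℝ → E} {t : ℝ} {v : E} {d : V}
    (hc : HasDerivAt c v t) (hφ : DifferentiableAt ℝ φ (c t))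
    (hd : HasDerivAt (fun s => φ (c s)) d t) : fderiv ℝ φ (c t) v = d :=
  (hφ.hasFDerivAt.comp_hasDerivAt t hc).unique hd

theorem eq_of_fderiv_line_eq_zero {φ : ℝ × ℝ × ℝ → V} (hφ : ContDiff ℝ ∞ φ) {y z : ℝ}
    (h : ∀ x, fderiv ℝ φ (x, y, z) e₁ = 0) (x x' : ℝ) : φ (x, y, z) = φ (x', y, z) := by
  have hd : ∀ s, HasDerivAt (fun s => φ (s, y, z)) (0 : V) s := fun s => by
    rw [← h s]
    exact ((hφ.differentiable (by simp)) (s, y, z)).hasFDerivAt.comp_hasDerivAt s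
      (hasDerivAt_line₁ s y z)
  exact is_const_of_deriv_eq_zero (f := fun s => φ (s, y, z)) (fun s => (hd s).differentiableAt)
    (fun s => (hd s).deriv) x x'

theorem contDiff_fderiv_apply_const {φ : E → V} (hφ : ContDiff ℝ ∞ φ) (v : E) :
    ContDiff ℝ ∞ fun s => fderiv ℝ φ s v :=
  (hφ.fderiv_right (m := ∞) (by simp)).clm_apply contDiff_const

theorem fderiv_fderiv_apply_comm {φ : E → V} (hφ : ContDiff ℝ ∞ φ) (q v w : E) :
    fderiv ℝ (fun s => fderiv ℝ φ s w) q v = fderiv ℝ (fun s => fderiv ℝ φ s v) q w := by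
  have hd : DifferentiableAt ℝ (fderiv ℝ φ) q :=
    (hφ.fderiv_right (m := ∞) (by simp)).differentiable (by simp) q
  rw [fderiv_clm_apply hd (differentiableAt_const w), fderiv_clm_apply hd (differentiableAt_const v)]
  have hs := (hφ.contDiffAt (x := q)).isSymmSndFDerivAt minSmoothness_two_le_infty
  simpa using hs v w

/-- A solution of a linear differential equation vanishing at one point vanishes. -/
theorem eq_zero_of_linear_ode (A : ℝ → V →L[ℝ] V) (hA : Continuous A) {s : ℝ → V}
    (hs : ∀ t, HasDerivAt s (A t (s t)) t) (h0 : s 0 = 0) : s 1 = 0 := by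
  obtain ⟨C, hC⟩ := (isCompact_Icc (a := (0 : ℝ)) (b := 1)).exists_bound_of_continuousOn
    hA.continuousOn
  have := norm_le_gronwallBound_of_norm_deriv_right_le (f := s) (f' := fun t => A t (s t))
    (δ := 0) (K := C) (ε := 0) (a := 0) (b := 1)
    (fun t _ => (hs t).continuousAt.continuousWithinAt) (fun t _ => (hs t).hasDerivWithinAt)
    (by simp [h0]) (fun t ht => by
      rw [add_zero]
      exact ((A t).le_opNorm _).trans
        (mul_le_mul_of_nonneg_right (hC t ⟨ht.1, ht.2.le⟩) (norm_nonneg _)))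
    1 (right_mem_Icc.2 zero_le_one)
  simpa [gronwallBound_ε0_δ0] using this

end Lines

/-! ### Gauge transformations along a direction -/

section Gauge

variable {EG : Type*} [NormedAddCommGroup EG] [NormedSpace ℝ EG]
  {G : Type*} [TopologicalSpace G] [ChartedSpace EG G] [Group G] [LieGroup 𝓘(ℝ, EG) ∞ G]
  {E : Type*} [NormedAddCommGroup E] [NormedSpace ℝ E]

theorem logDerivR_const (g : G) (t : ℝ) : (logDerivR (fun _ => g) t : EG) = 0 := by
  rw [logDerivR_eq_rightLog]
  unfold rightLog
  rw [mD_const]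
  rfl

theorem logDerivR_comp {u : E → G} {c : ℝ → E} {t : ℝ} {v : E}
    (hu : MDifferentiableAt 𝓘(ℝ, E) 𝓘(ℝ, EG) u (c t)) (hc : HasDerivAt c v t) :
    (logDerivR (fun s => u (c s)) t : EG) = rightLog u (c t) v := by
  rw [logDerivR_eq_rightLog, rightLog_comp hu hc.differentiableAt]
  simp [hc.hasFDerivAt.fderiv]

theorem rightLog_eq_zero_of_const {u : E → G} {c : ℝ → E} {t : ℝ} {v : E} {g : G}
    (hu : MDifferentiableAt 𝓘(ℝ, E) 𝓘(ℝ, EG) u (c t)) (hc : HasDerivAt c v t)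
    (h : ∀ s, u (c s) = g) : rightLog u (c t) v = (0 : EG) := by
  rw [← logDerivR_comp hu hc]
  simp only [h]
  exact logDerivR_const g t

/-- A smooth map into a Lie group with vanishing logarithmic derivative along a curve is constant
along it. -/
theorem eq_of_rightLog_eq_zero {u : E → G} (hu : MDifferentiable 𝓘(ℝ, E) 𝓘(ℝ, EG) u) {c : ℝ → E}
    {v : E} (hc : ∀ t, HasDerivAt c v t) (h : ∀ t, rightLog u (c t) v = (0 : EG)) (t t' : ℝ) :
    u (c t) = u (c t') := by
  have hd : ∀ s, MDifferentiableAt 𝓘(ℝ, ℝ) 𝓘(ℝ, EG) (fun s => u (c s)) s := fun s =>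
    (hu (c s)).comp s (hc s).differentiableAt.mdifferentiableAt
  refine eq_of_logDerivR_eq (EG := EG) (u := fun s => u (c s)) (v := fun _ => u (c t'))
    isOpen_univ isPreconnected_univ (fun s _ => hd s) (fun s _ => mdifferentiableAt_const) ?_
    (mem_univ t') (mem_univ t) rfl
  intro s _
  rw [logDerivR_comp (hu (c s)) (hc s), h s]
  exact (logDerivR_const _ s).symm

theorem contDiff_rightLog_apply {u : E → G} (hu : ContMDiff 𝓘(ℝ, E) 𝓘(ℝ, EG) ∞ u) (v : E) :
    ContDiff ℝ ∞ fun s => (rightLog u s v : EG) :=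
  (contDiff_rightLog hu).clm_apply contDiff_const

theorem fderiv_rightLog_apply {u : E → G} (hu : ContMDiff 𝓘(ℝ, E) 𝓘(ℝ, EG) ∞ u) (q v w : E) :
    fderiv ℝ (fun s => (rightLog u s w : EG)) q v - fderiv ℝ (fun s => (rightLog u s v : EG)) q w =
      chartBracket G (rightLog u q v) (rightLog u q w) := by
  have hd : DifferentiableAt ℝ (rightLog u : E → E →L[ℝ] EG) q :=
    (contDiff_rightLog hu).differentiable (by simp) q
  rw [← maurerCartan hu, fderiv_clm_apply hd (differentiableAt_const w),
    fderiv_clm_apply hd (differentiableAt_const v)]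
  simp

theorem contDiff_adjointL_inv {u : E → G} (hu : ContMDiff 𝓘(ℝ, E) 𝓘(ℝ, EG) ∞ u) {ξ : E → EG}
    (hξ : ContDiff ℝ ∞ ξ) : ContDiff ℝ ∞ fun s => adjointL EG (u s)⁻¹ (ξ s) := by
  rw [contDiff_iff_contDiffAt]
  intro q
  exact ((conjModule EG G).contDiffAt_mDotL (hu.inv.contMDiffAt (x := q))).clm_apply hξ.contDiffAt

/-- In a gauge killing the component of a connection along `v`, the derivative along `v` of the
other components is the curvature. -/
theorem fderiv_gauge {u : E → G} (hu : ContMDiff 𝓘(ℝ, E) 𝓘(ℝ, EG) ∞ u) {a b : E → EG}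
    (hb : ContDiff ℝ ∞ b) {v : E} (huv : ∀ q, rightLog u q v = -a q) (w q : E) :
    fderiv ℝ (fun s => adjointL EG (u s)⁻¹ (b s + rightLog u s w)) q v =
      adjointL EG (u q)⁻¹ (fderiv ℝ b q v - fderiv ℝ a q w + chartBracket G (a q) (b q)) := by
  have hr := contDiff_rightLog_apply hu w
  rw [fderiv_adjointL_inv_apply (hu.mdifferentiable (by simp) q)
    ((hb.add hr).differentiable (by simp) q)]
  have h1 : fderiv ℝ (fun s => b s + rightLog u s w) q v =
      fderiv ℝ b q v + fderiv ℝ (fun s => (rightLog u s w : EG)) q v := by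
    rw [fderiv_fun_add (hb.differentiable (by simp) q) (hr.differentiable (by simp) q)]
    rfl
  have h2 := fderiv_rightLog_apply hu q v w
  have h3 : fderiv ℝ (fun s => (rightLog u s v : EG)) q w = - fderiv ℝ a q w := by
    simp only [huv]
    rw [fderiv_fun_neg]
    rfl
  rw [h3, huv] at h2
  -- Maurer-Cartan with the `v`-component equal to -a. The bracket of a with `rightLog u q w`
  -- produced here cancels the one from differentiating the adjoint action.
  have h4 : fderiv ℝ (fun s => (rightLog u s w : EG)) q v =
      chartBracket G (-a q) (rightLog u q w) - fderiv ℝ a q w := by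
    rw [← h2]
    abel
  rw [h1, h4, huv]
  congr 1
  simp only [map_add, map_neg, neg_apply]
  abel

end Gauge

/-! ### Independence of z for doublets on ℝ³ -/

section Cube

variable {EG : Type*} [NormedAddCommGroup EG] [NormedSpace ℝ EG]
  {G : Type*} [TopologicalSpace G] [ChartedSpace EG G] [Group G] [LieGroup 𝓘(ℝ, EG) ∞ G]
  {EH : Type*} [NormedAddCommGroup EH] [NormedSpace ℝ EH]
  {H : Type*} [TopologicalSpace H] [ChartedSpace EH H] [Group H] [LieGroup 𝓘(ℝ, EH) ∞ H]

variable (EG EH) in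
/-- The components of a doublet on `ℝ³`. -/
structure CubeDoublet where
  /-- the components of the 1-form -/
  (a₁ a₂ a₃ : ℝ × ℝ × ℝ → EG)
  /-- the components of the 2-form -/
  (B₁₂ B₁₃ B₂₃ : ℝ × ℝ × ℝ → EH)
  smooth_a₁ : ContDiff ℝ ∞ a₁
  smooth_a₂ : ContDiff ℝ ∞ a₂
  smooth_a₃ : ContDiff ℝ ∞ a₃
  smooth_B₁₂ : ContDiff ℝ ∞ B₁₂
  smooth_B₁₃ : ContDiff ℝ ∞ B₁₃
  smooth_B₂₃ : ContDiff ℝ ∞ B₂₃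

namespace CubeDoublet

/-- A fake flat doublet on `ℝ³` whose forms vanish on the faces `x = 0` and `x = 1`, and with
`B₁₃ = 0` on the faces `y = 0` and `y = 1`. -/
structure IsFramed (C : CubeDoublet EG EH) (X : LieCrossedModule EG G EH H) : Prop where
  fake₁₂ : ∀ q, fderiv ℝ C.a₂ q e₁ - fderiv ℝ C.a₁ q e₂ + chartBracket G (C.a₁ q) (C.a₂ q) =
    X.tDotL (C.B₁₂ q)
  fake₁₃ : ∀ q, fderiv ℝ C.a₃ q e₁ - fderiv ℝ C.a₁ q e₃ + chartBracket G (C.a₁ q) (C.a₃ q) =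
    X.tDotL (C.B₁₃ q)
  a₂_right : ∀ y z, C.a₂ (1, y, z) = 0
  a₃_left : ∀ y z, C.a₃ (0, y, z) = 0
  a₃_right : ∀ y z, C.a₃ (1, y, z) = 0
  B₂₃_left : ∀ y z, C.B₂₃ (0, y, z) = 0
  B₂₃_right : ∀ y z, C.B₂₃ (1, y, z) = 0
  B₁₃_bot : ∀ x z, C.B₁₃ (x, 0, z) = 0
  B₁₃_top : ∀ x z, C.B₁₃ (x, 1, z) = 0

/-- Vanishing of the 3-form curvature. -/
def IsFlat (C : CubeDoublet EG EH) (X : LieCrossedModule EG G EH H) : Prop := ∀ q,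
  fderiv ℝ C.B₂₃ q e₁ - fderiv ℝ C.B₁₃ q e₂ + fderiv ℝ C.B₁₂ q e₃ +
    (X.mHatL (C.a₁ q) (C.B₂₃ q) - X.mHatL (C.a₂ q) (C.B₁₃ q) + X.mHatL (C.a₃ q) (C.B₁₂ q)) = 0

theorem adjointL_inv_injective (a : G) {x : EG} (h : adjointL EG a⁻¹ x = 0) : x = 0 := by
  have h1 := (conjModule EG G).mDotL_inv_apply_apply a⁻¹ x
  rw [← h1]
  change (conjModule EG G).mDotL a⁻¹⁻¹ (adjointL EG a⁻¹ x) = 0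
  rw [h, map_zero]

variable {C : CubeDoublet EG EH} {X : LieCrossedModule EG G EH H}

/-- The 1-transport from `x = 0` to `x = 1` does not depend on `z` on a face where `B₁₃` vanishes. -/
theorem IsFramed.transport_eq (h : C.IsFramed X) {f : ℝ × ℝ × ℝ → G}
    (hf : ContMDiff 𝓘(ℝ, ℝ × ℝ × ℝ) 𝓘(ℝ, EG) ∞ f) (hf1 : ∀ q, rightLog f q e₁ = -C.a₁ q)
    (hf0 : ∀ y z, f (0, y, z) = 1) {y : ℝ} (hB : ∀ x z, C.B₁₃ (x, y, z) = 0) (z z' : ℝ) :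
    f (1, y, z) = f (1, y, z') := by
  have hfd := hf.mdifferentiable (by simp)
  refine eq_of_rightLog_eq_zero hfd (c := fun s => (1, y, s)) (v := e₃)
    (fun t => hasDerivAt_line₃ 1 y t) (fun t => ?_) z z'
  -- On this face the transformed third component is constant in x, its x-derivative being ṫ(B₁₃) =
  -- 0 up to the adjoint action. It vanishes at x = 0, since f = 1 and a₃ = 0 there.
  have h1 := eq_of_fderiv_line_eq_zero (y := y) (z := t)
    (contDiff_adjointL_inv hf (C.smooth_a₃.add (contDiff_rightLog_apply hf e₃)))
    (fun x => by rw [fderiv_gauge hf C.smooth_a₃ hf1, h.fake₁₃, hB, map_zero, map_zero]) 1 0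
  have h2 : rightLog f (0, y, t) e₃ = (0 : EG) :=
    rightLog_eq_zero_of_const (c := fun s => (0, y, s)) (hfd _) (hasDerivAt_line₃ 0 y t)
      (fun s => hf0 y s)
  rw [h.a₃_left, h2, add_zero, map_zero] at h1
  have h3 := adjointL_inv_injective _ h1
  rwa [h.a₃_right, zero_add] at h3

/-- The data of a horizontal gauge on `ℝ³`: `u` is the transport along `x` from `x = 1`, and `w₂`
is the primitive of the gauge transformed curvature. -/
structure IsGauge (C : CubeDoublet EG EH) (X : LieCrossedModule EG G EH H) (u : ℝ × ℝ × ℝ → G)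
    (w₂ w₃ : ℝ × ℝ × ℝ → EH) : Prop where
  smooth_u : ContMDiff 𝓘(ℝ, ℝ × ℝ × ℝ) 𝓘(ℝ, EG) ∞ u
  smooth_w₂ : ContDiff ℝ ∞ w₂
  smooth_w₃ : ContDiff ℝ ∞ w₃
  eqn_u : ∀ q, rightLog u q e₁ = -C.a₁ q
  init_u : ∀ y z, u (1, y, z) = 1
  eqn_w₂ : ∀ q, fderiv ℝ w₂ q e₁ = -X.mDotL (u q)⁻¹ (C.B₁₂ q)
  eqn_w₃ : ∀ q, fderiv ℝ w₃ q e₁ = -X.mDotL (u q)⁻¹ (C.B₁₃ q)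
  init_w₂ : ∀ y z, w₂ (1, y, z) = 0
  init_w₃ : ∀ y z, w₃ (1, y, z) = 0

variable {u : ℝ × ℝ × ℝ → G} {w₂ w₃ : ℝ × ℝ × ℝ → EH}

theorem contDiff_mDotL_inv (X : LieCrossedModule EG G EH H)
    (hu : ContMDiff 𝓘(ℝ, ℝ × ℝ × ℝ) 𝓘(ℝ, EG) ∞ u) {ξ : ℝ × ℝ × ℝ → EH}
    (hξ : ContDiff ℝ ∞ ξ) : ContDiff ℝ ∞ fun s => X.mDotL (u s)⁻¹ (ξ s) := by
  rw [contDiff_iff_contDiffAt]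
  intro q
  exact (X.contDiffAt_mDotL (hu.inv.contMDiffAt (x := q))).clm_apply hξ.contDiffAt

/-- By fake flatness and equivariance of ṫ, the sum of the transformed component and ṫ(w) has zero
x-derivative; it vanishes at x = 1. -/
theorem tDotL_gauge_eq (X : LieCrossedModule EG G EH H)
    (hu : ContMDiff 𝓘(ℝ, ℝ × ℝ × ℝ) 𝓘(ℝ, EG) ∞ u)
    {a b : ℝ × ℝ × ℝ → EG} {B w : ℝ × ℝ × ℝ → EH} (hb : ContDiff ℝ ∞ b) (hw : ContDiff ℝ ∞ w)
    {v : ℝ × ℝ × ℝ} (hau : ∀ q, rightLog u q e₁ = -a q)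
    (hB : ∀ q, fderiv ℝ b q e₁ - fderiv ℝ a q v + chartBracket G (a q) (b q) = X.tDotL (B q))
    (hwB : ∀ q, fderiv ℝ w q e₁ = -X.mDotL (u q)⁻¹ (B q))
    (h1 : ∀ y z, b (1, y, z) + rightLog u (1, y, z) v = 0) (hw1 : ∀ y z, w (1, y, z) = 0)
    (q : ℝ × ℝ × ℝ) :
    adjointL EG (u q)⁻¹ (b q + rightLog u q v) = -X.tDotL (w q) := by
  obtain ⟨x, y, z⟩ := q
  have hs1 := contDiff_adjointL_inv hu (hb.add (contDiff_rightLog_apply hu v))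
  have hs2 : ContDiff ℝ ∞ fun s => X.tDotL (w s) := X.tDotL.contDiff.comp hw
  have h2 := eq_of_fderiv_line_eq_zero (y := y) (z := z) (hs1.add hs2) (fun x => by
    rw [fderiv_fun_add (hs1.differentiable (by simp) _) (hs2.differentiable (by simp) _),
      add_apply, fderiv_gauge hu hb hau, hB]
    have h3 : fderiv ℝ (fun s => X.tDotL (w s)) (x, y, z) =
        X.tDotL.comp (fderiv ℝ w (x, y, z)) :=
      (X.tDotL.hasFDerivAt.comp (x, y, z) (hw.differentiable (by simp) _).hasFDerivAt).fderiv
    rw [h3, ContinuousLinearMap.comp_apply, hwB, map_neg, X.tDotL_mDotL, add_neg_cancel]) x 1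
  rw [h1, hw1, map_zero, map_zero, add_zero] at h2
  exact eq_neg_of_add_eq_zero_left h2

namespace IsGauge

theorem rightLog_right (g : C.IsGauge X u w₂ w₃) (y z : ℝ) :
    rightLog u (1, y, z) e₂ = (0 : EG) ∧ rightLog u (1, y, z) e₃ = (0 : EG) := by
  have hud := g.smooth_u.mdifferentiable (by simp)
  exact ⟨rightLog_eq_zero_of_const (c := fun s => (1, s, z)) (hud _) (hasDerivAt_line₂ 1 y z)
    fun s => g.init_u s z, rightLog_eq_zero_of_const (c := fun s => (1, y, s)) (hud _)
    (hasDerivAt_line₃ 1 y z) fun s => g.init_u y s⟩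

theorem tDotL_w₂ (g : C.IsGauge X u w₂ w₃) (h : C.IsFramed X) (q : ℝ × ℝ × ℝ) :
    adjointL EG (u q)⁻¹ (C.a₂ q + rightLog u q e₂) = -X.tDotL (w₂ q) :=
  tDotL_gauge_eq X g.smooth_u C.smooth_a₂ g.smooth_w₂ g.eqn_u h.fake₁₂ g.eqn_w₂
    (fun y z => by rw [h.a₂_right, (g.rightLog_right y z).1, add_zero]) g.init_w₂ q

theorem tDotL_w₃ (g : C.IsGauge X u w₂ w₃) (h : C.IsFramed X) (q : ℝ × ℝ × ℝ) :
    adjointL EG (u q)⁻¹ (C.a₃ q + rightLog u q e₃) = -X.tDotL (w₃ q) :=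
  tDotL_gauge_eq X g.smooth_u C.smooth_a₃ g.smooth_w₃ g.eqn_u h.fake₁₃ g.eqn_w₃
    (fun y z => by rw [h.a₃_right, (g.rightLog_right y z).2, add_zero]) g.init_w₃ q

/-- Once a transformed component has the form -ṫ(w), the Peiffer identity replaces its action on 𝔥
by a bracket in 𝔥. -/
theorem mHatL_gauge (X : LieCrossedModule EG G EH H) {a : G} {c : EG} {w : EH}
    (h : adjointL EG a⁻¹ c = -X.tDotL w) (B : EH) :
    X.mDotL a⁻¹ (X.mHatL c B) = -chartBracket H w (X.mDotL a⁻¹ B) := by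
  rw [← X.mHatL_adjointL, h, map_neg, neg_apply, X.mHatL_tDotL]

/-- The Bianchi identity in the horizontal gauge. -/
theorem bianchi (g : C.IsGauge X u w₂ w₃) (h : C.IsFramed X) (hC : C.IsFlat X) (q : ℝ × ℝ × ℝ) :
    fderiv ℝ (fun s => X.mDotL (u s)⁻¹ (C.B₂₃ s)) q e₁
      - fderiv ℝ (fun s => X.mDotL (u s)⁻¹ (C.B₁₃ s)) q e₂
      + fderiv ℝ (fun s => X.mDotL (u s)⁻¹ (C.B₁₂ s)) q e₃ =
    chartBracket H (w₃ q) (X.mDotL (u q)⁻¹ (C.B₁₂ q))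
      - chartBracket H (w₂ q) (X.mDotL (u q)⁻¹ (C.B₁₃ q)) := by
  have hud := g.smooth_u.mdifferentiable (by simp)
  rw [X.fderiv_mDotL_inv_apply (hud q) (C.smooth_B₂₃.differentiable (by simp) q),
    X.fderiv_mDotL_inv_apply (hud q) (C.smooth_B₁₃.differentiable (by simp) q),
    X.fderiv_mDotL_inv_apply (hud q) (C.smooth_B₁₂.differentiable (by simp) q), g.eqn_u q]
  -- The a₂ and a₃ terms of flatness combine with the `rightLog` terms along `e₂` and `e₃` into the
  -- transformed components; the a₁ term cancels since `rightLog u q e₁ = -a₁`.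
  have h2 := mHatL_gauge X (g.tDotL_w₂ h q) (C.B₁₃ q)
  have h3 := mHatL_gauge X (g.tDotL_w₃ h q) (C.B₁₂ q)
  have h4 := congrArg (X.mDotL (u q)⁻¹) (hC q)
  simp only [map_add, map_sub, map_neg, map_zero, add_apply,
    neg_apply] at h2 h3 h4 ⊢
  linear_combination (norm := module) h4 - h3 + h2

/-- The pair `(w₂, w₃)` has curvature `-B'₂₃`; in particular it is flat on the face `x = 0`. -/
theorem curvature_left (g : C.IsGauge X u w₂ w₃) (h : C.IsFramed X) (hC : C.IsFlat X) (y z : ℝ) :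
    fderiv ℝ w₃ (0, y, z) e₂ - fderiv ℝ w₂ (0, y, z) e₃ =
      chartBracket H (w₂ (0, y, z)) (w₃ (0, y, z)) := by
  have s₂ := contDiff_fderiv_apply_const g.smooth_w₃ e₂
  have s₃ := contDiff_fderiv_apply_const g.smooth_w₂ e₃
  have sb : ContDiff ℝ ∞ fun s => chartBracket H (w₂ s) (w₃ s) :=
    (contDiff_const.clm_apply g.smooth_w₂).clm_apply g.smooth_w₃
  have sB := contDiff_mDotL_inv X g.smooth_u C.smooth_B₂₃
  have hb : ∀ q, fderiv ℝ (fun s => chartBracket H (w₂ s) (w₃ s)) q e₁ =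
      chartBracket H (fderiv ℝ w₂ q e₁) (w₃ q) + chartBracket H (w₂ q) (fderiv ℝ w₃ q e₁) := by
    intro q
    have hd₂ := (g.smooth_w₂.differentiable (by simp) q).hasFDerivAt
    have hd₃ := (g.smooth_w₃.differentiable (by simp) q).hasFDerivAt
    have h1 := (((chartBracket H).hasFDerivAt.comp q hd₂).clm_apply hd₃).fderiv
    have h2 : fderiv ℝ (fun s => chartBracket H (w₂ s) (w₃ s)) q = _ := h1
    rw [h2]
    simp [add_comm]
  -- The quantity ∂_y w₃ - ∂_z w₂ - [w₂, w₃] + B'₂₃ is constant in x by the Bianchi identity. At x =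
  -- 1 all its terms vanish; at x = 0 only B'₂₃ drops out.
  have h1 := eq_of_fderiv_line_eq_zero (y := y) (z := z) (((s₂.sub s₃).sub sb).add sB) (fun x => by
    rw [fderiv_fun_add (((s₂.sub s₃).sub sb).differentiable (by simp) _)
        (sB.differentiable (by simp) _),
      fderiv_fun_sub ((s₂.sub s₃).differentiable (by simp) _) (sb.differentiable (by simp) _),
      fderiv_fun_sub (s₂.differentiable (by simp) _) (s₃.differentiable (by simp) _)]
    simp only [add_apply, sub_apply]
    have h2 := g.bianchi h hC (x, y, z)
    have ha : ∀ B w : EH, chartBracket H B w = -chartBracket H w B := fun B w => by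
      rw [chartBracket_apply, chartBracket_apply, neg_sub]
    rw [fderiv_fderiv_apply_comm g.smooth_w₃, fderiv_fderiv_apply_comm g.smooth_w₂, hb]
    simp only [g.eqn_w₂, g.eqn_w₃]
    rw [fderiv_fun_neg, fderiv_fun_neg]
    simp only [map_neg, neg_apply]
    rw [ha _ (w₃ (x, y, z))]
    linear_combination (norm := module) h2) 0 1
  have hw₂ : fderiv ℝ w₂ (1, y, z) e₃ = 0 :=
    fderiv_eq_of_hasDerivAt_comp (c := fun s => (1, y, s)) (hasDerivAt_line₃ 1 y z)
      (g.smooth_w₂.differentiable (by simp) _) (by simp only [g.init_w₂]; exact hasDerivAt_const _ _)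
  have hw₃ : fderiv ℝ w₃ (1, y, z) e₂ = 0 :=
    fderiv_eq_of_hasDerivAt_comp (c := fun s => (1, s, z)) (hasDerivAt_line₂ 1 y z)
      (g.smooth_w₃.differentiable (by simp) _) (by simp only [g.init_w₃]; exact hasDerivAt_const _ _)
  simp only [h.B₂₃_left, h.B₂₃_right, hw₂, hw₃, g.init_w₂, map_zero, sub_zero, add_zero,
    zero_apply] at h1
  exact sub_eq_zero.1 h1

theorem w₃_eq_zero (g : C.IsGauge X u w₂ w₃) {y : ℝ} (hB : ∀ x z, C.B₁₃ (x, y, z) = 0) (x z : ℝ) :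
    w₃ (x, y, z) = 0 := by
  rw [← g.init_w₃ y z]
  exact eq_of_fderiv_line_eq_zero g.smooth_w₃
    (fun x => by rw [g.eqn_w₃, hB, map_zero, neg_zero]) x 1

/-- The surface transport does not depend on `z`. -/
theorem surface_transport_eq (g : C.IsGauge X u w₂ w₃) (h : C.IsFramed X) (hC : C.IsFlat X)
    {W : ℝ × ℝ × ℝ → H} (hW : ContMDiff 𝓘(ℝ, ℝ × ℝ × ℝ) 𝓘(ℝ, EH) ∞ W)
    (hW2 : ∀ q, rightLog W q e₂ = w₂ q) (hW0 : ∀ x z, W (x, 0, z) = 1) (z z' : ℝ) :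
    W (0, 1, z) = W (0, 1, z') := by
  have hWd := hW.mdifferentiable (by simp)
  refine eq_of_rightLog_eq_zero hWd (c := fun s => (0, 1, s)) (v := e₃)
    (fun t => hasDerivAt_line₃ 0 1 t) (fun t => ?_) z z'
  have hr : ContDiff ℝ ∞ fun s => (rightLog W s e₃ : EH) := contDiff_rightLog_apply hW e₃
  -- Both `rightLog W · e₃` and `w₃` complete `w₂` to a flat pair on the face x = 0, so their
  -- difference satisfies ∂_y s = [w₂, s].
  have hs : ∀ y, HasDerivAt (fun y => rightLog W (0, y, t) e₃ - w₃ (0, y, t))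
      (chartBracket H (w₂ (0, y, t)) (rightLog W (0, y, t) e₃ - w₃ (0, y, t))) y := by
    intro y
    have h1 := (hr.sub g.smooth_w₃).differentiable (by simp) (0, y, t)
    have h2 := h1.hasFDerivAt.comp_hasDerivAt y (hasDerivAt_line₂ 0 y t)
    refine h2.congr_deriv ?_
    rw [fderiv_fun_sub (hr.differentiable (by simp) _) (g.smooth_w₃.differentiable (by simp) _)]
    have h3 := fderiv_rightLog_apply hW (0, y, t) e₂ e₃
    have h4 := g.curvature_left h hC y t
    simp only [hW2] at h3
    rw [sub_apply, map_sub, ← h3, ← h4]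
    abel
  have h0 : rightLog W (0, 0, t) e₃ - w₃ (0, 0, t) = 0 := by
    rw [g.w₃_eq_zero h.B₁₃_bot, sub_zero]
    exact rightLog_eq_zero_of_const (c := fun s => (0, 0, s)) (hWd _) (hasDerivAt_line₃ 0 0 t)
      fun s => hW0 0 s
  have hA : Continuous fun y => chartBracket H (w₂ (0, y, t)) :=
    (chartBracket H).continuous.comp (g.smooth_w₂.continuous.comp (by fun_prop))
  have h1 := eq_zero_of_linear_ode _ hA hs h0
  simpa only [g.w₃_eq_zero h.B₁₃_top, sub_zero] using h1

end IsGauge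

end CubeDoublet

end Cube

/-! ### Existence and uniqueness of the cocycle -/

section Cocycle

variable {EG : Type*} [NormedAddCommGroup EG] [NormedSpace ℝ EG] [FiniteDimensional ℝ EG]
  {G : Type*} [TopologicalSpace G] [ChartedSpace EG G] [Group G] [LieGroup 𝓘(ℝ, EG) ∞ G]
  {EH : Type*} [NormedAddCommGroup EH] [NormedSpace ℝ EH] [FiniteDimensional ℝ EH]
  {H : Type*} [TopologicalSpace H] [ChartedSpace EH H] [Group H] [LieGroup 𝓘(ℝ, EH) ∞ H]
  {X : LieCrossedModule EG G EH H}
  {a : ℝ × ℝ → (ℝ × ℝ) [⋀^Fin 1]→L[ℝ] EG} {B : ℝ × ℝ → (ℝ × ℝ) [⋀^Fin 2]→L[ℝ] EH}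

theorem mdifferentiableAt_horizontal {u : ℝ × ℝ → G} (hu : ContMDiff 𝓘(ℝ, ℝ × ℝ) 𝓘(ℝ, EG) ∞ u)
    (x y : ℝ) : MDifferentiableAt 𝓘(ℝ, ℝ) 𝓘(ℝ, EG) (fun s => u (s, y)) x :=
  mdifferentiableAt_slice hu.contMDiffAt

theorem hasDerivAt_vertical (x y : ℝ) :
    HasDerivAt (fun s : ℝ => (x, s)) ((0 : ℝ), (1 : ℝ)) y :=
  (hasDerivAt_const y x).prodMk (hasDerivAt_id y)

theorem hasDerivAt_horizontal (x y : ℝ) :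
    HasDerivAt (fun s : ℝ => (s, y)) ((1 : ℝ), (0 : ℝ)) x :=
  (hasDerivAt_id x).prodMk (hasDerivAt_const x y)

theorem mdifferentiableAt_vertical {u : ℝ × ℝ → G} (hu : ContMDiff 𝓘(ℝ, ℝ × ℝ) 𝓘(ℝ, EG) ∞ u)
    (x y : ℝ) : MDifferentiableAt 𝓘(ℝ, ℝ) 𝓘(ℝ, EG) (fun s => u (x, s)) y :=
  MDifferentiableAt.comp (g := u) (f := fun s => (x, s)) y (hu.mdifferentiable (by simp) _)
    (hasDerivAt_vertical x y).differentiableAt.mdifferentiableAt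

theorem eq_one_of_logDerivR_eq_zero {u : ℝ → G}
    (hu : ∀ t, MDifferentiableAt 𝓘(ℝ, ℝ) 𝓘(ℝ, EG) u t) (h : ∀ t, (logDerivR u t : EG) = 0)
    {t₀ : ℝ} (h0 : u t₀ = 1) (t : ℝ) : u t = 1 :=
  eq_of_logDerivR_eq (EG := EG) (v := fun _ => 1) isOpen_univ isPreconnected_univ
    (fun s _ => hu s) (fun _ _ => mdifferentiableAt_const)
    (fun s _ => (h s).trans (logDerivR_const 1 s).symm) (mem_univ t₀) (mem_univ t) h0

theorem IsSolF.unique {x₀ : ℝ} {u v : ℝ × ℝ → G} (hu : IsSolF a x₀ u) (hv : IsSolF a x₀ v) :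
    u = v := by
  ext1 ⟨x, y⟩
  exact eq_of_logDerivR_eq (EG := EG) (u := fun s => u (s, y)) (v := fun s => v (s, y))
    isOpen_univ isPreconnected_univ (fun s _ => mdifferentiableAt_horizontal hu.smooth s y)
    (fun s _ => mdifferentiableAt_horizontal hv.smooth s y)
    (fun s _ => (hu.eqn s y).trans (hv.eqn s y).symm) (mem_univ x₀) (mem_univ x)
    ((hu.init y).trans (hv.init y).symm)

theorem IsSolG.unique {y₀ : ℝ} {u v : ℝ × ℝ → G} (hu : IsSolG a y₀ u) (hv : IsSolG a y₀ v) :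
    u = v := by
  ext1 ⟨x, y⟩
  exact eq_of_logDerivR_eq (EG := EG) (u := fun s => u (x, s)) (v := fun s => v (x, s))
    isOpen_univ isPreconnected_univ (fun s _ => mdifferentiableAt_vertical hu.smooth x s)
    (fun s _ => mdifferentiableAt_vertical hv.smooth x s)
    (fun s _ => (hu.eqn x s).trans (hv.eqn x s).symm) (mem_univ y₀) (mem_univ y)
    ((hu.init x).trans (hv.init x).symm)

/-- Uniqueness forces the choice made by `Classical.epsilon`. -/
theorem IsSolF.cocycleF_eq {x₀ : ℝ} {u : ℝ × ℝ → G} (hu : IsSolF a x₀ u) (x y : ℝ) :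
    cocycleF a x x₀ y = u (x, y) :=
  congrFun (IsSolF.unique (Classical.epsilon_spec (p := fun u => IsSolF a x₀ u) ⟨u, hu⟩) hu) (x, y)

theorem IsSolG.cocycleG_eq {y₀ : ℝ} {v : ℝ × ℝ → G} (hv : IsSolG a y₀ v) (x y : ℝ) :
    cocycleG a x y y₀ = v (x, y) :=
  congrFun (IsSolG.unique (Classical.epsilon_spec (p := fun v => IsSolG a y₀ v) ⟨v, hv⟩) hv) (x, y)

theorem IsSolW.unique {x₀ y₀ : ℝ} {E E' : ℝ × ℝ → H} (hE : IsSolW X a B x₀ y₀ E)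
    (hE' : IsSolW X a B x₀ y₀ E') : E = E' := by
  have hd : ∀ {u : ℝ × ℝ → H}, ContMDiff 𝓘(ℝ, ℝ × ℝ) 𝓘(ℝ, EH) ∞ u → ∀ y,
      Differentiable ℝ fun s => (logDerivR (fun r => u (s, r)) y : EH) := by
    intro u hu y
    have h1 : (fun s => (logDerivR (fun r => u (s, r)) y : EH)) =
        fun s => rightLog u (s, y) ((0 : ℝ), (1 : ℝ)) := by
      ext1 s
      exact logDerivR_comp (c := fun r => (s, r)) (hu.mdifferentiable (by simp) _)
        (hasDerivAt_vertical s y)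
    rw [h1]
    exact ((contDiff_rightLog_apply hu _).differentiable (by simp)).comp
      (by fun_prop : Differentiable ℝ fun s : ℝ => (s, y))
  -- The two logarithmic derivatives in y have the same x-derivative and both vanish at `x₀`, where
  -- the solutions are constantly 1.
  have hl : ∀ x y, (logDerivR (fun r => E (x, r)) y : EH) = logDerivR (fun r => E' (x, r)) y := by
    intro x y
    have h1 := is_const_of_deriv_eq_zero
      (f := fun s => (logDerivR (fun r => E (s, r)) y : EH) - logDerivR (fun r => E' (s, r)) y)
      ((hd hE.smooth y).sub (hd hE'.smooth y)) (fun s => by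
        rw [deriv_fun_sub (hd hE.smooth y s) (hd hE'.smooth y s), hE.eqn, hE'.eqn, sub_self]) x x₀
    simp only [hE.init_x, hE'.init_x, sub_self] at h1
    exact sub_eq_zero.1 h1
  ext1 ⟨x, y⟩
  exact eq_of_logDerivR_eq (EG := EH) (u := fun s => E (x, s)) (v := fun s => E' (x, s))
    isOpen_univ isPreconnected_univ (fun s _ => mdifferentiableAt_vertical hE.smooth x s)
    (fun s _ => mdifferentiableAt_vertical hE'.smooth x s)
    (fun s _ => hl x s) (mem_univ y₀) (mem_univ y)
    ((hE.init_y x).trans (hE'.init_y x).symm)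

theorem IsSolW.cocycleW_eq {x₀ y₀ : ℝ} {E : ℝ × ℝ → H} (hE : IsSolW X a B x₀ y₀ E) (x y : ℝ) :
    cocycleW X a B x x₀ y y₀ = E (x, y) :=
  congrFun (IsSolW.unique
    (Classical.epsilon_spec (p := fun E => IsSolW X a B x₀ y₀ E) ⟨E, hE⟩) hE) (x, y)

theorem exists_isSolF (ha : ContDiff ℝ ∞ fun q => a q ![((1 : ℝ), (0 : ℝ))]) (x₀ : ℝ) :
    ∃ u : ℝ × ℝ → G, IsSolF a x₀ u := by
  obtain ⟨u, hu, h1, h2⟩ := exists_global_solution (G := G) _ ha.neg x₀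
  exact ⟨u, hu, h1, h2⟩

/-- Existence of the smooth solution of `∂ᵧv v⁻¹ = A`, `v(x, y₀) = 1`. -/
theorem exists_vertical_solution {A : ℝ × ℝ → EG} (hA : ContDiff ℝ ∞ A) (y₀ : ℝ) :
    ∃ v : ℝ × ℝ → G, ContMDiff 𝓘(ℝ, ℝ × ℝ) 𝓘(ℝ, EG) ∞ v ∧
      (∀ x y, (logDerivR (fun s => v (x, s)) y : EG) = A (x, y)) ∧ ∀ x, v (x, y₀) = 1 := by
  have hs : ContDiff ℝ ∞ fun q : ℝ × ℝ => (q.2, q.1) := by fun_prop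
  obtain ⟨u, hu, h1, h2⟩ := exists_global_solution (G := G) (fun q : ℝ × ℝ => A (q.2, q.1))
    (hA.comp hs) y₀
  exact ⟨fun q => u (q.2, q.1), hu.comp hs.contMDiff, fun x y => h1 y x, h2⟩

theorem exists_isSolG (ha : ContDiff ℝ ∞ fun q => a q ![((0 : ℝ), (1 : ℝ))]) (y₀ : ℝ) :
    ∃ v : ℝ × ℝ → G, IsSolG a y₀ v := by
  obtain ⟨v, hv, h1, h2⟩ := exists_vertical_solution (G := G) ha.neg y₀
  exact ⟨v, hv, h1, h2⟩

/-- Two successive problems: an x-primitive `w` vanishing at `x₀`, then ∂_y E E⁻¹ = w with E = 1 at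
`y₀`. The condition at `x₀` is automatic since w = 0 there. -/
theorem exists_isSolW (ha₁ : ContDiff ℝ ∞ fun q => a q ![((1 : ℝ), (0 : ℝ))])
    (ha₂ : ContDiff ℝ ∞ fun q => a q ![((0 : ℝ), (1 : ℝ))])
    (hB : ContDiff ℝ ∞ fun q => B q ![((1 : ℝ), (0 : ℝ)), ((0 : ℝ), (1 : ℝ))]) (x₀ y₀ : ℝ) :
    ∃ E : ℝ × ℝ → H, IsSolW X a B x₀ y₀ E := by
  have : CompleteSpace EH := FiniteDimensional.complete ℝ EH
  obtain ⟨f, hf⟩ := exists_isSolF (G := G) ha₁ x₀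
  obtain ⟨g, hg⟩ := exists_isSolG (G := G) ha₂ y₀
  have hk : ContMDiff 𝓘(ℝ, ℝ × ℝ) 𝓘(ℝ, EG) ∞ fun q : ℝ × ℝ => (g (x₀, q.2))⁻¹ * (f q)⁻¹ :=
    (hg.smooth.comp (by fun_prop : ContDiff ℝ ∞ fun q : ℝ × ℝ => (x₀, q.2)).contMDiff).inv.mul
      hf.smooth.inv
  have hN : ContDiff ℝ ∞ fun q : ℝ × ℝ => -X.mDotL ((g (x₀, q.2))⁻¹ * (f q)⁻¹)
      (B q ![((1 : ℝ), (0 : ℝ)), ((0 : ℝ), (1 : ℝ))]) := by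
    refine (contDiff_iff_contDiffAt.2 fun q => ?_).neg
    exact (X.contDiffAt_mDotL (hk.contMDiffAt (x := q))).clm_apply hB.contDiffAt
  obtain ⟨w, hw, hw1, hw0⟩ := exists_primitive _ hN x₀
  obtain ⟨E, hE, hE1, hE0⟩ := exists_vertical_solution (G := H) hw y₀
  refine ⟨E, hE, fun x y => ?_, fun y => ?_, hE0⟩
  · simp only [hE1]
    rw [(hw1 x y).deriv, hg.cocycleG_eq, hf.cocycleF_eq]
    rfl
  · exact eq_one_of_logDerivR_eq_zero (EG := EH) (u := fun s => E (x₀, s))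
      (fun t => mdifferentiableAt_vertical hE x₀ t) (fun t => by rw [hE1, hw0]) (hE0 x₀) y

theorem hasCocycle (ha₁ : ContDiff ℝ ∞ fun q => a q ![((1 : ℝ), (0 : ℝ))])
    (ha₂ : ContDiff ℝ ∞ fun q => a q ![((0 : ℝ), (1 : ℝ))])
    (hB : ContDiff ℝ ∞ fun q => B q ![((1 : ℝ), (0 : ℝ)), ((0 : ℝ), (1 : ℝ))]) :
    HasCocycle X a B :=
  ⟨fun x₀ => existsUnique_of_exists_of_unique (exists_isSolF ha₁ x₀) fun _ _ h h' => h.unique h',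
    fun y₀ => existsUnique_of_exists_of_unique (exists_isSolG ha₂ y₀) fun _ _ h h' => h.unique h',
    fun x₀ y₀ => existsUnique_of_exists_of_unique (exists_isSolW ha₁ ha₂ hB x₀ y₀)
      fun _ _ h h' => h.unique h'⟩

end Cocycle

/-! ### Homotopies -/

section Homotopy

variable {EG : Type*} [NormedAddCommGroup EG] [NormedSpace ℝ EG] [FiniteDimensional ℝ EG]
  {G : Type*} [TopologicalSpace G] [ChartedSpace EG G] [Group G] [LieGroup 𝓘(ℝ, EG) ∞ G]
  {EH : Type*} [NormedAddCommGroup EH] [NormedSpace ℝ EH] [FiniteDimensional ℝ EH]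
  {H : Type*} [TopologicalSpace H] [ChartedSpace EH H] [Group H] [LieGroup 𝓘(ℝ, EH) ∞ H]
  {EM : Type*} [NormedAddCommGroup EM] [NormedSpace ℝ EM]
  {M : Type*} [TopologicalSpace M] [ChartedSpace EM M] [IsManifold 𝓘(ℝ, EM) ∞ M]
  {X : LieCrossedModule EG G EH H} (D : ConnDoublet EM M X)

theorem ConnDoublet.hasCocycle {S : ℝ × ℝ → M} (hS : ContMDiff 𝓘(ℝ, ℝ × ℝ) 𝓘(ℝ, EM) ∞ S) :
    HasCocycle X (pullback D.θ.toFun S) (pullback D.Υ.toFun S) :=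
  HigherTransport.hasCocycle (contDiff_pullback_apply D.θ hS _) (contDiff_pullback_apply D.θ hS _)
    (contDiff_pullback_apply D.Υ hS _)

theorem pullback_curve {V : Type*} [NormedAddCommGroup V] [NormedSpace ℝ V]
    (η : ∀ p : M, TangentSpace 𝓘(ℝ, EM) p [⋀^Fin 1]→L[ℝ] V)
    {F : Type*} [NormedAddCommGroup F] [NormedSpace ℝ F] {Φ : F → M} {c : ℝ → F} {t : ℝ} {v : F}
    (hΦ : MDifferentiableAt 𝓘(ℝ, F) 𝓘(ℝ, EM) Φ (c t)) (hc : HasDerivAt c v t) :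
    pullback η (fun s => Φ (c s)) t ![(1 : ℝ)] = pullback η Φ (c t) ![v] := by
  rw [pullback_comp_apply η hΦ hc.differentiableAt]
  have h : (fun i => fderiv ℝ c t (![(1 : ℝ)] i)) = ![v] := by
    rw [vec_map_one (fun s => fderiv ℝ c t s), hc.hasFDerivAt.fderiv]
    simp
  rw [h]

/-- The 1-transport depends only on the curve along which it is taken. -/
theorem transport_eq_of_curve_eq {S S' : ℝ × ℝ → M} (hS : ContMDiff 𝓘(ℝ, ℝ × ℝ) 𝓘(ℝ, EM) ∞ S)
    (hS' : ContMDiff 𝓘(ℝ, ℝ × ℝ) 𝓘(ℝ, EM) ∞ S') {y y' : ℝ} (h : ∀ x, S (x, y) = S' (x, y'))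
    (x x₀ : ℝ) : (cocycleF (pullback D.θ.toFun S) x x₀ y : G) =
      cocycleF (pullback D.θ.toFun S') x x₀ y' := by
  obtain ⟨u, hu⟩ := exists_isSolF (G := G) (contDiff_pullback_apply D.θ hS ![(1, 0)]) x₀
  obtain ⟨v, hv⟩ := exists_isSolF (G := G) (contDiff_pullback_apply D.θ hS' ![(1, 0)]) x₀
  rw [hu.cocycleF_eq, hv.cocycleF_eq]
  refine eq_of_logDerivR_eq (EG := EG) (u := fun s => u (s, y)) (v := fun s => v (s, y'))
    isOpen_univ isPreconnected_univ (fun s _ => mdifferentiableAt_horizontal hu.smooth s y)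
    (fun s _ => mdifferentiableAt_horizontal hv.smooth s y') (fun s _ => ?_) (mem_univ x₀)
    (mem_univ x) ((hu.init y).trans (hv.init y').symm)
  rw [hu.eqn, hv.eqn, ← pullback_curve (c := fun s => (s, y)) D.θ.toFun
      (hS.mdifferentiable (by simp) _) (hasDerivAt_horizontal s y),
    ← pullback_curve (c := fun s => (s, y')) D.θ.toFun
      (hS'.mdifferentiable (by simp) _) (hasDerivAt_horizontal s y')]
  simp only [h]

/-- The components of the pull-back of a connection doublet to `ℝ³`. -/
def ConnDoublet.cube {K : ℝ × ℝ × ℝ → M} (hK : ContMDiff 𝓘(ℝ, ℝ × ℝ × ℝ) 𝓘(ℝ, EM) ∞ K) :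
    CubeDoublet EG EH where
  a₁ q := pullback D.θ.toFun K q ![e₁]
  a₂ q := pullback D.θ.toFun K q ![e₂]
  a₃ q := pullback D.θ.toFun K q ![e₃]
  B₁₂ q := pullback D.Υ.toFun K q ![e₁, e₂]
  B₁₃ q := pullback D.Υ.toFun K q ![e₁, e₃]
  B₂₃ q := pullback D.Υ.toFun K q ![e₂, e₃]
  smooth_a₁ := contDiff_pullback_apply D.θ hK _
  smooth_a₂ := contDiff_pullback_apply D.θ hK _
  smooth_a₃ := contDiff_pullback_apply D.θ hK _
  smooth_B₁₂ := contDiff_pullback_apply D.Υ hK _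
  smooth_B₁₃ := contDiff_pullback_apply D.Υ hK _
  smooth_B₂₃ := contDiff_pullback_apply D.Υ hK _

theorem pullback_eq_zero_of_eventuallyEq_const {V : Type*} [NormedAddCommGroup V] [NormedSpace ℝ V]
    {k : ℕ} (η : ∀ p : M, TangentSpace 𝓘(ℝ, EM) p [⋀^Fin (k + 1)]→L[ℝ] V)
    {F : Type*} [NormedAddCommGroup F] [NormedSpace ℝ F] {Φ : F → M} {q : F} {p : M}
    (h : Φ =ᶠ[𝓝 q] fun _ => p) (v : Fin (k + 1) → F) : pullback η Φ q v = 0 := by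
  have h0 : mD F EM Φ q = 0 := (mD_congr h).trans (mD_const p q)
  rw [pullback_apply, h0]
  exact (η (Φ q)).map_coord_zero (0 : Fin (k + 1)) rfl

variable {D} {p₀ p₁ : M} {S₀ S₁ : ℝ × ℝ → M} {K : ℝ × ℝ × ℝ → M}

theorem IsHomotopy.eventuallyEq_left (h : IsHomotopy EM p₀ p₁ S₀ S₁ K) (y z : ℝ) :
    K =ᶠ[𝓝 (0, y, z)] fun _ => p₀ := by
  obtain ⟨-, ⟨ε, hε, h0, -⟩, -⟩ := h
  filter_upwards [(isOpen_Iio.preimage continuous_fst).mem_nhds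
    (show ((0 : ℝ), y, z) ∈ Prod.fst ⁻¹' Iio ε from hε)] with q hq
  exact h0 q.1 q.2.1 q.2.2 hq

theorem IsHomotopy.eventuallyEq_right (h : IsHomotopy EM p₀ p₁ S₀ S₁ K) (y z : ℝ) :
    K =ᶠ[𝓝 (1, y, z)] fun _ => p₁ := by
  obtain ⟨-, ⟨ε, hε, -, h1, -⟩, -⟩ := h
  filter_upwards [(isOpen_Ioi.preimage continuous_fst).mem_nhds
    (show ((1 : ℝ), y, z) ∈ Prod.fst ⁻¹' Ioi (1 - ε) by simpa using hε)] with q hq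
  exact h1 q.1 q.2.1 q.2.2 hq

theorem pullback_two_eq_zero_of_rankAt_le {q : ℝ × ℝ × ℝ} (h : rankAt EM K q ≤ 1)
    (v w : ℝ × ℝ × ℝ) : pullback D.Υ.toFun K q ![v, w] = 0 := by
  refine pullback_two_eq_zero _ v w (not_linearIndependent_of_rank_lt
    (mD (ℝ × ℝ × ℝ) EM K q : (ℝ × ℝ × ℝ) →ₗ[ℝ] EM) (n := 2) ?_ ![v, w])
  exact lt_of_le_of_lt h (by exact_mod_cast one_lt_two)

/-- Sitting instants make `K` locally constant at x = 0 and x = 1, so pulled-back forms of positive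
degree vanish; the rank condition at y = 0 and y = 1 kills 2-forms. -/
theorem IsHomotopy.isFramed (h : IsHomotopy EM p₀ p₁ S₀ S₁ K) : (D.cube h.1).IsFramed X where
  fake₁₂ q := D.fakeFlat_pullback h.1 q e₁ e₂
  fake₁₃ q := D.fakeFlat_pullback h.1 q e₁ e₃
  a₂_right y z := pullback_eq_zero_of_eventuallyEq_const _ (h.eventuallyEq_right y z) _
  a₃_left y z := pullback_eq_zero_of_eventuallyEq_const _ (h.eventuallyEq_left y z) _
  a₃_right y z := pullback_eq_zero_of_eventuallyEq_const _ (h.eventuallyEq_right y z) _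
  B₂₃_left y z := pullback_eq_zero_of_eventuallyEq_const _ (h.eventuallyEq_left y z) _
  B₂₃_right y z := pullback_eq_zero_of_eventuallyEq_const _ (h.eventuallyEq_right y z) _
  B₁₃_bot x z := pullback_two_eq_zero_of_rankAt_le (h.2.2.1 x z) _ _
  B₁₃_top x z := pullback_two_eq_zero_of_rankAt_le (h.2.2.2 x z) _ _

theorem ConnDoublet.IsFlat.cube (hD : D.IsFlat)
    (hK : ContMDiff 𝓘(ℝ, ℝ × ℝ × ℝ) 𝓘(ℝ, EM) ∞ K) : (D.cube hK).IsFlat X := fun q =>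
  D.curvature_pullback hK q e₁ e₂ e₃ (hD.curvatureVanishes _ _ _ _)

theorem IsThinHomotopy.isFlat (h : IsThinHomotopy EM p₀ p₁ S₀ S₁ K) :
    (D.cube h.1.1).IsFlat X := fun q => by
  refine D.curvature_pullback h.1.1 q e₁ e₂ e₃
    (D.curvatureVanishes_of_not_linearIndependent _ _ _ _ ?_)
  rw [← vec_map_three]
  refine not_linearIndependent_of_rank_lt
    (mD (ℝ × ℝ × ℝ) EM K q : (ℝ × ℝ × ℝ) →ₗ[ℝ] EM) (n := 3) ?_ ![e₁, e₂, e₃]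
  exact lt_of_le_of_lt (h.2 q) (by exact_mod_cast Nat.lt_succ_self 2)

variable {S : ℝ → ℝ × ℝ → M}

theorem pullback_slice {V : Type*} [NormedAddCommGroup V] [NormedSpace ℝ V] {k : ℕ}
    (η : ∀ p : M, TangentSpace 𝓘(ℝ, EM) p [⋀^Fin k]→L[ℝ] V)
    (hK : ContMDiff 𝓘(ℝ, ℝ × ℝ × ℝ) 𝓘(ℝ, EM) ∞ fun q : ℝ × ℝ × ℝ => S q.2.2 (q.1, q.2.1))
    (z : ℝ) (q : ℝ × ℝ) (v : Fin k → ℝ × ℝ) :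
    pullback η (S z) q v = pullback η (fun q : ℝ × ℝ × ℝ => S q.2.2 (q.1, q.2.1)) (q.1, q.2, z)
      (fun i => ((v i).1, (v i).2, 0)) := by
  have hf : HasFDerivAt (fun s : ℝ × ℝ => (s.1, s.2, z))
      ((ContinuousLinearMap.fst ℝ ℝ ℝ).prod ((ContinuousLinearMap.snd ℝ ℝ ℝ).prod 0)) q :=
    hasFDerivAt_fst.prodMk (hasFDerivAt_snd.prodMk (hasFDerivAt_const z q))
  have h := pullback_comp_apply η (f := fun s : ℝ × ℝ => (s.1, s.2, z)) (q := q)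
    (hK.mdifferentiable (by simp) _) hf.differentiableAt v
  rw [hf.fderiv] at h
  exact h

/-- Solving on ℝ³ with z as a parameter and restricting to a slice gives the cocycle of each
surface, now with smooth dependence on z. -/
theorem isSolF_slice
    (hK : ContMDiff 𝓘(ℝ, ℝ × ℝ × ℝ) 𝓘(ℝ, EM) ∞ fun q : ℝ × ℝ × ℝ => S q.2.2 (q.1, q.2.1))
    {x₀ : ℝ} {u : ℝ × ℝ × ℝ → G} (hu : ContMDiff 𝓘(ℝ, ℝ × ℝ × ℝ) 𝓘(ℝ, EG) ∞ u)
    (hu1 : ∀ t p, (logDerivR (fun s => u (s, p)) t : EG) = -(D.cube hK).a₁ (t, p))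
    (hu0 : ∀ p, u (x₀, p) = 1) (z : ℝ) :
    IsSolF (pullback D.θ.toFun (S z)) x₀ (fun q => u (q.1, q.2, z)) where
  smooth := hu.comp (by fun_prop : ContDiff ℝ ∞ fun q : ℝ × ℝ => (q.1, q.2, z)).contMDiff
  eqn x y := by
    rw [hu1 x (y, z), pullback_slice D.θ.toFun hK z]
    refine congrArg (fun v => -(pullback D.θ.toFun _ (x, y, z) v)) (?_ : ![e₁] = _)
    ext1 i
    fin_cases i
    rfl
  init y := hu0 _

/-- The 1-transports along the bounding curves do not depend on `z`. -/
theorem transportSource_transportTarget_eq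
    (h : IsHomotopy EM p₀ p₁ S₀ S₁ fun q : ℝ × ℝ × ℝ => S q.2.2 (q.1, q.2.1)) (z z' : ℝ) :
    D.transportSource (S z) = D.transportSource (S z') ∧
      D.transportTarget (S z) = D.transportTarget (S z') := by
  have hF := h.isFramed (D := D)
  obtain ⟨f, hf, hf1, hf0⟩ := exists_global_solution (G := G) _ (D.cube h.1).smooth_a₁.neg 0
  have hs := fun z => isSolF_slice h.1 hf hf1 hf0 z
  have hr : ∀ q, rightLog f q e₁ = -(D.cube h.1).a₁ q := fun q =>
    (logDerivR_comp (c := fun s => (s, q.2.1, q.2.2)) (hf.mdifferentiable (by simp) _)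
      (hasDerivAt_line₁ q.1 q.2.1 q.2.2)).symm.trans (hf1 _ _)
  unfold ConnDoublet.transportSource ConnDoublet.transportTarget
  rw [(hs z).cocycleF_eq, (hs z').cocycleF_eq, (hs z).cocycleF_eq, (hs z').cocycleF_eq]
  exact ⟨hF.transport_eq hf hr (fun y z => hf0 _) hF.B₁₃_bot z z',
    hF.transport_eq hf hr (fun y z => hf0 _) hF.B₁₃_top z z'⟩

/-- The 2-transport does not depend on `z`. -/
theorem transportSurface_eq
    (h : IsHomotopy EM p₀ p₁ S₀ S₁ fun q : ℝ × ℝ × ℝ => S q.2.2 (q.1, q.2.1))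
    (hC : (D.cube h.1).IsFlat X) (z z' : ℝ) :
    D.transportSurface (S z) = D.transportSurface (S z') := by
  have : CompleteSpace EH := FiniteDimensional.complete ℝ EH
  have hF := h.isFramed (D := D)
  -- The base is x = 1, as in W(0, 1; 1, 0); the 1-transport uses the base x = 0 instead.
  obtain ⟨u, hu, hu1, hu0⟩ := exists_global_solution (G := G) _ (D.cube h.1).smooth_a₁.neg 1
  obtain ⟨w₂, hw₂, hw₂1, hw₂0⟩ := exists_primitive _
    (CubeDoublet.contDiff_mDotL_inv X hu (D.cube h.1).smooth_B₁₂).neg 1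
  obtain ⟨w₃, hw₃, hw₃1, hw₃0⟩ := exists_primitive _
    (CubeDoublet.contDiff_mDotL_inv X hu (D.cube h.1).smooth_B₁₃).neg 1
  have hl : ContDiff ℝ ∞ fun q : ℝ × ℝ × ℝ => (q.2.1, q.1, q.2.2) := by fun_prop
  obtain ⟨W', hW', hW'1, hW'0⟩ := exists_global_solution (G := H)
    (fun q : ℝ × ℝ × ℝ => w₂ (q.2.1, q.1, q.2.2)) (hw₂.comp hl) 0
  let W : ℝ × ℝ × ℝ → H := fun q => W' (q.2.1, q.1, q.2.2)
  have hW : ContMDiff 𝓘(ℝ, ℝ × ℝ × ℝ) 𝓘(ℝ, EH) ∞ W := hW'.comp hl.contMDiff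
  have hW1 : ∀ x y z, (logDerivR (fun s => W (x, s, z)) y : EH) = w₂ (x, y, z) := fun x y z =>
    hW'1 y (x, z)
  have hg : (D.cube h.1).IsGauge X u w₂ w₃ :=
    { smooth_u := hu
      smooth_w₂ := hw₂
      smooth_w₃ := hw₃
      eqn_u := fun q => (logDerivR_comp (c := fun s => (s, q.2.1, q.2.2))
        (hu.mdifferentiable (by simp) _) (hasDerivAt_line₁ q.1 q.2.1 q.2.2)).symm.trans (hu1 _ _)
      init_u := fun y z => hu0 _
      eqn_w₂ := fun q => fderiv_eq_of_hasDerivAt_comp (c := fun s => (s, q.2.1, q.2.2))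
        (hasDerivAt_line₁ q.1 q.2.1 q.2.2) (hw₂.differentiable (by simp) _) (hw₂1 q.1 q.2)
      eqn_w₃ := fun q => fderiv_eq_of_hasDerivAt_comp (c := fun s => (s, q.2.1, q.2.2))
        (hasDerivAt_line₁ q.1 q.2.1 q.2.2) (hw₃.differentiable (by simp) _) (hw₃1 q.1 q.2)
      init_w₂ := fun y z => hw₂0 _
      init_w₃ := fun y z => hw₃0 _ }
  have hsol : ∀ z, IsSolW X (pullback D.θ.toFun (S z)) (pullback D.Υ.toFun (S z)) 1 0
      (fun q => W (q.1, q.2, z)) := by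
    intro z
    have hslice : ContDiff ℝ ∞ fun q : ℝ × ℝ => (q.1, q.2, z) := by fun_prop
    have hE : ContMDiff 𝓘(ℝ, ℝ × ℝ) 𝓘(ℝ, EH) ∞ fun q : ℝ × ℝ => W (q.1, q.2, z) :=
      hW.comp hslice.contMDiff
    have hSz : ContMDiff 𝓘(ℝ, ℝ × ℝ) 𝓘(ℝ, EM) ∞ (S z) := h.1.comp hslice.contMDiff
    refine ⟨hE, fun x y => ?_, fun y => ?_, fun x => hW'0 _⟩
    · obtain ⟨v, hv⟩ := exists_isSolG (G := G) (contDiff_pullback_apply D.θ hSz ![(0, 1)]) 0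
      -- The y-component of the connection vanishes at x = 1, so g(1; y, 0) = 1 and only f⁻¹ remains
      -- in the twist.
      have hv1 : v (1, y) = 1 := by
        refine eq_one_of_logDerivR_eq_zero (EG := EG) (u := fun s => v (1, s))
          (fun t => mdifferentiableAt_vertical hv.smooth 1 t) (fun t => ?_) (hv.init 1) y
        rw [hv.eqn, pullback_slice D.θ.toFun h.1, pullback_eq_zero_of_eventuallyEq_const
          (k := 0) _ (h.eventuallyEq_right t z), neg_zero]
      simp only [hW1]
      rw [(hw₂1 x (y, z)).deriv, hv.cocycleG_eq, hv1, inv_one, one_mul,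
        (isSolF_slice h.1 hu hu1 hu0 z).cocycleF_eq, X.mDot_eq, pullback_slice D.Υ.toFun h.1]
      refine congrArg (fun v => -X.mDotL (u (x, y, z))⁻¹ (pullback D.Υ.toFun _ (x, y, z) v))
        (?_ : ![e₁, e₂] = _)
      ext1 i
      fin_cases i <;> rfl
    · exact eq_one_of_logDerivR_eq_zero (EG := EH) (u := fun s => W (1, s, z))
        (fun t => mdifferentiableAt_vertical hE 1 t) (fun t => by rw [hW1, hw₂0])
        (hW'0 _) y
  unfold ConnDoublet.transportSurface
  rw [(hsol z).cocycleW_eq, (hsol z').cocycleW_eq]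
  exact hg.surface_transport_eq hF hC hW (fun q => (logDerivR_comp
    (c := fun s => (q.1, s, q.2.2)) (hW.mdifferentiable (by simp) _)
    (hasDerivAt_line₂ q.1 q.2.1 q.2.2)).symm.trans (hW1 _ _ _)) (fun x z => hW'0 _) z z'

end Homotopy

end HigherTransport

end

/-! ### The main theorem -/

theorem mainTheorem5
    {EG : Type*} [NormedAddCommGroup EG] [NormedSpace ℝ EG] [FiniteDimensional ℝ EG]
    {G : Type*} [TopologicalSpace G] [ChartedSpace EG G] [Group G] [LieGroup 𝓘(ℝ, EG) ∞ G]
    {EH : Type*} [NormedAddCommGroup EH] [NormedSpace ℝ EH] [FiniteDimensional ℝ EH]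
    {H : Type*} [TopologicalSpace H] [ChartedSpace EH H] [Group H] [LieGroup 𝓘(ℝ, EH) ∞ H]
    {EM : Type*} [NormedAddCommGroup EM] [NormedSpace ℝ EM] [FiniteDimensional ℝ EM]
    {M : Type*} [TopologicalSpace M] [ChartedSpace EM M] [IsManifold 𝓘(ℝ, EM) ∞ M]
    (X : HigherTransport.LieCrossedModule EG G EH H)
    (D : HigherTransport.ConnDoublet EM M X)
    (p₀ p₁ : M) (γ₀ γ₁ : ℝ → ℝ → M) (S : ℝ → ℝ × ℝ → M)
    (hγ₀ : ∀ z, HigherTransport.IsCurve EM p₀ p₁ (γ₀ z))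
    (hγ₁ : ∀ z, HigherTransport.IsCurve EM p₀ p₁ (γ₁ z))
    (hS : ∀ z, HigherTransport.IsSurface EM p₀ p₁ (γ₀ z) (γ₁ z) (S z))
    (hK : HigherTransport.IsThinHomotopy EM p₀ p₁ (S 0) (S 1)
        (fun q : ℝ × ℝ × ℝ => S q.2.2 (q.1, q.2.1)) ∨
      (D.IsFlat ∧ HigherTransport.IsHomotopy EM p₀ p₁ (S 0) (S 1)
        (fun q : ℝ × ℝ × ℝ => S q.2.2 (q.1, q.2.1)))) :
    -- the transports are well defined
    (∀ z, HigherTransport.HasCocycle X (HigherTransport.pullback D.θ.toFun (S z))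
      (HigherTransport.pullback D.Υ.toFun (S z))) ∧
    (∀ z, D.transportSource (S z) = D.transportCurve (γ₀ z) ∧
      D.transportTarget (S z) = D.transportCurve (γ₁ z)) ∧
    -- and they do not depend on the parameter
    (∀ z, D.transportCurve (γ₀ z) = D.transportCurve (γ₀ 0)) ∧
    (∀ z, D.transportCurve (γ₁ z) = D.transportCurve (γ₁ 0)) ∧
    (∀ z, D.transportSurface (S z) = D.transportSurface (S 0)) := by
  have hK' : HigherTransport.IsHomotopy EM p₀ p₁ (S 0) (S 1)
      (fun q : ℝ × ℝ × ℝ => S q.2.2 (q.1, q.2.1)) := hK.elim (fun h => h.1) (fun h => h.2)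
  -- The two alternatives enter only through the vanishing of the curvature on the cube.
  have hC : (D.cube hK'.1).IsFlat X := hK.elim (fun h => h.isFlat) (fun h => h.1.cube hK'.1)
  have hu : ∀ {γ : ℝ → M}, HigherTransport.IsCurve EM p₀ p₁ γ →
      ContMDiff 𝓘(ℝ, ℝ × ℝ) 𝓘(ℝ, EM) ∞ (HigherTransport.unitSurface γ) := fun h =>
    h.1.comp (contDiff_fst : ContDiff ℝ ∞ fun q : ℝ × ℝ => q.1).contMDiff
  have hsource : ∀ z, D.transportSource (S z) = D.transportCurve (γ₀ z) := by
    intro z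
    obtain ⟨ε, hε, -, -, -, h, -⟩ := (hS z).2
    exact HigherTransport.transport_eq_of_curve_eq D (hS z).1 (hu (hγ₀ z))
      (fun x => h x 0 hε) 1 0
  have htarget : ∀ z, D.transportTarget (S z) = D.transportCurve (γ₁ z) := by
    intro z
    obtain ⟨ε, hε, -, -, -, -, h⟩ := (hS z).2
    exact HigherTransport.transport_eq_of_curve_eq D (hS z).1 (hu (hγ₁ z))
      (fun x => h x 1 (by linarith)) 1 0
  refine ⟨fun z => D.hasCocycle (hS z).1, fun z => ⟨hsource z, htarget z⟩, fun z => ?_, fun z => ?_,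
    fun z => HigherTransport.transportSurface_eq hK' hC z 0⟩
  · rw [← hsource, ← hsource]
    exact (HigherTransport.transportSource_transportTarget_eq hK' z 0).1
  · rw [← htarget, ← htarget]
    exact (HigherTransport.transportSource_transportTarget_eq hK' z 0).2
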